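/- Conventions. Manifolds $M$ are smooth, Hausdorff, second countable, without boundary, with a smooth Riemannian metric $g$; $\mathrm{dvol}$ is the Riemannian measure. A vector bundle $E\to M$ is a smooth, finite rank complex vector bundle with a smoothly varying Hermitian inner product and a smooth metric preserving connection $\nabla^E$, that is, $X(\xi,\eta)_E=(\nabla^E_X\xi,\eta)_E+(\xi,\nabla^E_X\eta)_E$. The bundle $\operatorname{Hom}(E;E_1)$ carries the induced Hermitian inner product $(A,B)=\sum_\alpha (Ae_\alpha,Be_\alpha)_{E_1}$, where $(e_\alpha)$ is an orthonormal basis of the fibre of $E$, and the induced connection $(\nabla_X a)u=\nabla^{E_1}_X(au)-a\,\nabla^E_Xu$. The bundles $T^{*\otimes j}M\otimes V$ carry the inner products and connections induced by those of $V$, by $g$ and by the Levi-Civita connection. For $\ell\in\mathbb N=\{0,1,2,\dots\}$ and $p\in[1,\infty]$, the space $W^{\ell,p}_\nabla(M;V)$ consists of the (classes of) measurable sections $u$ of $V$ whose iterated covariant derivatives $\nabla^ju$, taken in the weak sense, exist and belong to $L^p(M;T^{*\otimes j}M\otimes V)$ for $0\le j\le \ell$; its norm is the $\ell^p$-norm of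 the finite family $\|\nabla^ju\|_{L^p}$, $0\le j\le \ell$. Proposition. Let $\ell\in\mathbb N$ and let $p,q,r\in[1,\infty]$ be such that $\frac1p+\frac1q=\frac1r$. Then there is a constant $C_{\ell,p,q}>0$ such that, for all $M$ (of any dimension), all $E,E_1\to M$, all connections $\nabla^E$ and $\nabla^{E_1}$ as above, and all $(a,u)\in W^{\ell,p}_\nabla(M;\operatorname{Hom}(E;E_1))\times W^{\ell,q}_\nabla(M;E)$, the section $au$ belongs to $W^{\ell,r}_\nabla(M;E_1)$ and $$\|au\|_{W^{\ell,r}_\nabla(M;E_1)}\le C_{\ell,p,q}\,\|a\|_{W^{\ell,p}_\nabla(M;\operatorname{Hom}(E;E_1))}\,\|u\|_{W^{\ell,q}_\nabla(M;E)}.$$ In particular, the evaluation $(a,u)\mapsto au$ defines a continuous bilinear map $$W^{\ell,p}_\nabla(M;\operatorname{Hom}(E;E_1))\times W^{\ell,q}_\nabla(M;E)\to W^{\ell,r}_\nabla(M;E_1).$$ -/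

import Mathlib

open MeasureTheory Bundle Set
open scoped Manifold ContDiff ENNReal NNReal

namespace NablaSobolev

noncomputable section

/-! ### Riemannian geometry of the base manifold -/

section Base

variable {n : ℕ} {M : Type*} [TopologicalSpace M] [ChartedSpace (EuclideanSpace ℝ (Fin n)) M]

/-- The tangent vector `v^i ∂_i` at the point of `M` with coordinates `y` in the chart `e`. -/
def chartVector (e : OpenPartialHomeomorph M (EuclideanSpace ℝ (Fin n)))
    (y v : EuclideanSpace ℝ (Fin n)) : TangentSpace (𝓡 n) (e.symm y) :=
  mfderiv (𝓡 n) (𝓡 n) e.symm y v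

/-- `θ` is the weak (distributional) differential of the function `h : M → ℂ`: in every chart, `h`
and the components `θ(∂_v)` are locally integrable, and `∫ h ∂_v η = - ∫ θ(∂_v) η` for all smooth
functions `η` with compact support in the chart. -/
def IsWeakDifferential (h : M → ℂ) (θ : ∀ x : M, TangentSpace (𝓡 n) x → ℂ) : Prop :=
  ∀ e ∈ atlas (EuclideanSpace ℝ (Fin n)) M,
    LocallyIntegrableOn (fun y ↦ h (e.symm y)) e.target volume ∧
    ∀ v : EuclideanSpace ℝ (Fin n),
      LocallyIntegrableOn (fun y ↦ θ (e.symm y) (chartVector e y v)) e.target volume ∧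
      ∀ η : EuclideanSpace ℝ (Fin n) → ℝ, ContDiff ℝ ∞ η → HasCompactSupport η →
        tsupport η ⊆ e.target →
        ∫ y in e.target, (fderiv ℝ η y v) • h (e.symm y) =
          - ∫ y in e.target, η y • θ (e.symm y) (chartVector e y v)

variable [IsManifold (𝓡 n) ∞ M]

/-- Smooth vector fields on `M`. -/
def IsSmoothVectorField (Y : ∀ x : M, TangentSpace (𝓡 n) x) : Prop :=
  ContMDiff (𝓡 n) ((𝓡 n).prod (𝓡 n)) ∞
    (fun x ↦ TotalSpace.mk' (EuclideanSpace ℝ (Fin n)) x (Y x))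

variable [RiemannianBundle (fun x : M ↦ TangentSpace (𝓡 n) x)]

instance finiteDimensional_tangentSpace (x : M) : FiniteDimensional ℝ (TangentSpace (𝓡 n) x) :=
  inferInstanceAs (FiniteDimensional ℝ (EuclideanSpace ℝ (Fin n)))

/-- An orthonormal basis of the tangent space `T_x M`. -/
def tangentBasis (x : M) :
    OrthonormalBasis (Fin (Module.finrank ℝ (TangentSpace (𝓡 n) x))) ℝ (TangentSpace (𝓡 n) x) :=
  stdOrthonormalBasis ℝ (TangentSpace (𝓡 n) x)

/-- The measure `√(det (g_ij)) dx` on the domain of the chart `e`, where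
`g_ij = g(∂_i, ∂_j)`, extended by zero to `M`. -/
def chartVolume [MeasurableSpace M] (e : OpenPartialHomeomorph M (EuclideanSpace ℝ (Fin n))) :
    Measure M :=
  Measure.map e.symm ((volume.restrict e.target).withDensity fun y ↦
    ENNReal.ofReal (Real.sqrt (Matrix.det (Matrix.of fun i j : Fin n ↦
      inner ℝ (chartVector e y (EuclideanSpace.single i 1))
        (chartVector e y (EuclideanSpace.single j 1))))))

variable (n M) in
/-- The Riemannian volume measure `dvol`: the smallest measure on `M` that dominates
`√(det (g_ij)) dx` in every chart; since the chart measures agree on overlaps, it coincides with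
`√(det (g_ij)) dx` on the domain of each chart. -/
def riemannianVolume [MeasurableSpace M] : Measure M :=
  ⨆ e ∈ atlas (EuclideanSpace ℝ (Fin n)) M, chartVolume e

/-- The right hand side of Koszul's formula for `g(∇_X Y, Z)` at `x`; the tangent vectors `X` and
`Z` are extended to local smooth vector fields `X'` and `Z'`. -/
def koszul (Y : ∀ x : M, TangentSpace (𝓡 n) x) (x : M) (X Z : TangentSpace (𝓡 n) x) : ℝ :=
  let X' : ∀ y : M, TangentSpace (𝓡 n) y := FiberBundle.extend (EuclideanSpace ℝ (Fin n)) X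
  let Z' : ∀ y : M, TangentSpace (𝓡 n) y := FiberBundle.extend (EuclideanSpace ℝ (Fin n)) Z
  (1 / 2 : ℝ) *
    (mvfderiv (𝓡 n) (fun y : M ↦ (inner ℝ (Y y) (Z' y) : ℝ)) x X
      + mvfderiv (𝓡 n) (fun y : M ↦ (inner ℝ (X' y) (Z' y) : ℝ)) x (Y x)
      - mvfderiv (𝓡 n) (fun y : M ↦ (inner ℝ (X' y) (Y y) : ℝ)) x Z
      + inner ℝ (VectorField.mlieBracket (𝓡 n) X' Y x) Z
      - inner ℝ (VectorField.mlieBracket (𝓡 n) X' Z' x) (Y x)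
      - inner ℝ (VectorField.mlieBracket (𝓡 n) Y Z' x) X)

/-- The Levi-Civita connection `(∇_X Y)(x)` applied to a smooth vector field `Y`, for `X ∈ T_x M`:
the vector of `T_x M` determined by Koszul's formula. -/
def leviCivita (Y : ∀ x : M, TangentSpace (𝓡 n) x) (x : M) (X : TangentSpace (𝓡 n) x) :
    TangentSpace (𝓡 n) x :=
  ∑ k, koszul Y x X (tangentBasis x k) • tangentBasis x k

end Base

/-! ### Hermitian bundles with connection -/

/-- The data of a Hermitian vector bundle with connection which enter the definition of Sobolev
spaces: the inner products on the fibres (linear in the second variable), the smooth sections, and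
the covariant derivative `(∇_X φ)(x) = nabla φ x X` of smooth sections `φ`. It is used only for the
bundles given by `ofBundle` and `hom` below. -/
structure BundleData (n : ℕ) {M : Type*} [TopologicalSpace M]
    [ChartedSpace (EuclideanSpace ℝ (Fin n)) M]
    (V : M → Type*) [∀ x, AddCommGroup (V x)] [∀ x, Module ℂ (V x)] where
  inner : ∀ x, V x → V x → ℂ
  IsSmooth : (∀ x, V x) → Prop
  nabla : (∀ x, V x) → ∀ x, TangentSpace (𝓡 n) x → V x

section Bundles

variable {n : ℕ} {M : Type*} [TopologicalSpace M] [ChartedSpace (EuclideanSpace ℝ (Fin n)) M]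
  [IsManifold (𝓡 n) ∞ M]
  {F : Type*} [NormedAddCommGroup F] [NormedSpace ℂ F]
  {E : M → Type*} [TopologicalSpace (TotalSpace F E)]
  [∀ x, NormedAddCommGroup (E x)] [∀ x, InnerProductSpace ℂ (E x)]
  [∀ x, FiniteDimensional ℂ (E x)]
  [FiberBundle F E] [VectorBundle ℝ F E]
  {F₁ : Type*} [NormedAddCommGroup F₁] [NormedSpace ℂ F₁]
  {E₁ : M → Type*} [TopologicalSpace (TotalSpace F₁ E₁)]
  [∀ x, NormedAddCommGroup (E₁ x)] [∀ x, InnerProductSpace ℂ (E₁ x)]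
  [FiberBundle F₁ E₁] [VectorBundle ℝ F₁ E₁]

variable (n F) in
/-- Smooth sections of the vector bundle `E` with typical fibre `F`. -/
def IsSmoothSection (σ : ∀ x, E x) : Prop :=
  ContMDiff (𝓡 n) ((𝓡 n).prod 𝓘(ℝ, F)) ∞ (fun x ↦ TotalSpace.mk' F x (σ x))

variable (n F E) in
/-- The inner products on the fibres of `E` vary smoothly. -/
def IsSmoothHermitian : Prop :=
  ∀ σ τ : ∀ x, E x, IsSmoothSection n F σ → IsSmoothSection n F τ →
    ContMDiff (𝓡 n) 𝓘(ℝ, ℂ) ∞ (fun x ↦ (inner ℂ (σ x) (τ x) : ℂ))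

/-- A smooth, complex linear, metric preserving connection on the Hermitian bundle `E`. -/
structure IsMetricConnection (cov : CovariantDerivative (𝓡 n) F E) : Prop where
  smooth : ContMDiffCovariantDerivativeOn F ∞ cov.toFun univ
  complex_linear : ∀ (σ : ∀ x, E x), IsSmoothSection n F σ → ∀ x (X : TangentSpace (𝓡 n) x),
    cov (fun y ↦ Complex.I • σ y) x X = Complex.I • cov σ x X
  metric : ∀ (σ τ : ∀ x, E x), IsSmoothSection n F σ → IsSmoothSection n F τ →
    ∀ x (X : TangentSpace (𝓡 n) x),
      mvfderiv (𝓡 n) (fun y : M ↦ (inner ℂ (σ y) (τ y) : ℂ)) x X =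
        inner ℂ (cov σ x X) (τ x) + inner ℂ (σ x) (cov τ x X)

/-- The Hermitian bundle `E` with the connection `cov`. -/
def ofBundle (cov : CovariantDerivative (𝓡 n) F E) : BundleData n E where
  inner _ e e₁ := inner ℂ e e₁
  IsSmooth := IsSmoothSection n F
  nabla φ x X := cov φ x X

/-- The Hermitian bundle `Hom(E; E₁)`, with the induced inner product
`(A, B) = ∑ α, (A e_α, B e_α)` for an orthonormal basis `(e_α)` of the fibre of `E`, and with the
induced connection, `(∇_X a) e = ∇_X (a e) - a (∇_X e)`, where in order to compute the left hand
side at `x` one extends the basis vectors `e_α` of `E_x` to local smooth sections. -/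
def hom (cov : CovariantDerivative (𝓡 n) F E) (cov₁ : CovariantDerivative (𝓡 n) F₁ E₁) :
    BundleData n (fun x ↦ E x →L[ℂ] E₁ x) where
  inner x A B := ∑ α,
    inner ℂ (A (stdOrthonormalBasis ℂ (E x) α)) (B (stdOrthonormalBasis ℂ (E x) α))
  IsSmooth a := ∀ σ : ∀ x, E x, IsSmoothSection n F σ → IsSmoothSection n F₁ fun x ↦ a x (σ x)
  nabla a x X := ∑ α,
    (innerSL ℂ (stdOrthonormalBasis ℂ (E x) α)).smulRight
      (cov₁ (fun y ↦ a y (FiberBundle.extend F (stdOrthonormalBasis ℂ (E x) α) y)) x X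
        - a x (cov (FiberBundle.extend F (stdOrthonormalBasis ℂ (E x) α)) x X))

end Bundles

/-! ### Sobolev spaces -/

section Sobolev

variable {n : ℕ} {M : Type*} [TopologicalSpace M] [ChartedSpace (EuclideanSpace ℝ (Fin n)) M]
  [IsManifold (𝓡 n) ∞ M]
  [RiemannianBundle (fun x : M ↦ TangentSpace (𝓡 n) x)]
  {V : M → Type*} [∀ x, AddCommGroup (V x)] [∀ x, Module ℂ (V x)]

variable (n V) in
/-- The fibre at `x` of `T^{*⊗j} M ⊗ V`: the `j`-linear maps `T_x M × ⋯ × T_x M → V_x`. -/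
abbrev Tensor (j : ℕ) (x : M) : Type _ :=
  MultilinearMap ℝ (fun _ : Fin j ↦ TangentSpace (𝓡 n) x) (V x)

/-- The norm of `w` for the induced inner product on `T_x^{*⊗j} M ⊗ V_x`. -/
def tensorNorm (B : BundleData n V) {j : ℕ} {x : M} (w : Tensor n V j x) : ℝ :=
  Real.sqrt (∑ k : Fin j → Fin (Module.finrank ℝ (TangentSpace (𝓡 n) x)),
    (B.inner x (w fun i ↦ tangentBasis x (k i)) (w fun i ↦ tangentBasis x (k i))).re)

/-- Measurability of a section of `T^{*⊗j} M ⊗ V` with respect to `dvol`: its components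
`(φ, w(Y_1, …, Y_j))` are measurable. -/
def IsMeasurableSection [MeasurableSpace M] (B : BundleData n V) {j : ℕ}
    (w : ∀ x : M, Tensor n V j x) : Prop :=
  ∀ φ : ∀ x, V x, B.IsSmooth φ →
    ∀ Y : Fin j → ∀ x : M, TangentSpace (𝓡 n) x, (∀ i, IsSmoothVectorField (Y i)) →
      AEStronglyMeasurable (fun x ↦ B.inner x (φ x) (w x fun i ↦ Y i x)) (riemannianVolume n M)

/-- The section `w'` of `T^{*⊗(j+1)} M ⊗ V` is the weak covariant derivative of the section `w` of
`T^{*⊗j} M ⊗ V` (for the connection induced by that of `V` and the Levi-Civita connection):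
for all smooth sections `φ` of `V` and all smooth vector fields `Y_1, …, Y_j`,
`X (φ, w(Y_1, …, Y_j)) = (φ, (∇_X w)(Y_1, …, Y_j)) + (∇_X φ, w(Y_1, …, Y_j))
  + ∑ i, (φ, w(Y_1, …, ∇_X Y_i, …, Y_j))` holds in the weak sense with
`(∇_X w)(Y_1, …, Y_j) = w'(X, Y_1, …, Y_j)`. -/
def IsWeakCovariantDerivative (B : BundleData n V) {j : ℕ}
    (w : ∀ x : M, Tensor n V j x) (w' : ∀ x : M, Tensor n V (j + 1) x) : Prop :=
  ∀ φ : ∀ x, V x, B.IsSmooth φ →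
    ∀ Y : Fin j → ∀ x : M, TangentSpace (𝓡 n) x, (∀ i, IsSmoothVectorField (Y i)) →
      IsWeakDifferential (n := n) (fun x ↦ B.inner x (φ x) (w x fun i ↦ Y i x))
        (fun x X ↦ B.inner x (φ x) ((w' x).curryLeft X fun i ↦ Y i x)
          + B.inner x (B.nabla φ x X) (w x fun i ↦ Y i x)
          + ∑ i, B.inner x (φ x)
              (w x (Function.update (fun k ↦ Y k x) i (leviCivita (Y i) x X))))

/-- `w j = ∇^j u` for `0 ≤ j ≤ s` in the weak sense, all these sections being measurable. -/
structure IsDerivativeTower [MeasurableSpace M] (B : BundleData n V) (s : ℕ) (u : ∀ x, V x)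
    (w : ∀ (j : ℕ) (x : M), Tensor n V j x) : Prop where
  zero : ∀ x, w 0 x = MultilinearMap.constOfIsEmpty ℝ _ (u x)
  measurable : ∀ j ≤ s, IsMeasurableSection B (w j)
  succ : ∀ j < s, IsWeakCovariantDerivative B (w j) (w (j + 1))

/-- The `L^p` norm of a section of `T^{*⊗j} M ⊗ V` with respect to `dvol`. -/
def sectionLpNorm [MeasurableSpace M] (B : BundleData n V) {j : ℕ}
    (w : ∀ x : M, Tensor n V j x) (p : ℝ≥0∞) : ℝ≥0∞ :=
  eLpNorm (fun x ↦ tensorNorm B (w x)) p (riemannianVolume n M)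

/-- The `ℓ^p` norm of a finite family in `[0, ∞]`, for `1 ≤ p ≤ ∞`. -/
def littleLpNorm (p : ℝ≥0∞) {ι : Type*} [Fintype ι] (c : ι → ℝ≥0∞) : ℝ≥0∞ :=
  if p = ⊤ then ⨆ i, c i else (∑ i, c i ^ p.toReal) ^ (1 / p.toReal)

/-- `u` belongs to the Sobolev space `W^{s,p}_∇(M; V)`. -/
def MemSobolev [MeasurableSpace M] (B : BundleData n V) (s : ℕ) (p : ℝ≥0∞) (u : ∀ x, V x) : Prop :=
  ∃ w, IsDerivativeTower B s u w ∧ ∀ j ≤ s, sectionLpNorm B (w j) p < ⊤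

/-- The norm of `W^{s,p}_∇(M; V)`: the `ℓ^p` norm of the family of the `L^p` norms of `∇^j u`,
`0 ≤ j ≤ s`. As weak derivatives are only determined almost everywhere, it is written as an infimum
over all their representatives (which give the same value); it is `∞` if there are none. -/
def sobolevNorm [MeasurableSpace M] (B : BundleData n V) (s : ℕ) (p : ℝ≥0∞) (u : ∀ x, V x) :
    ℝ≥0∞ :=
  ⨅ (w : ∀ (j : ℕ) (x : M), Tensor n V j x) (_ : IsDerivativeTower B s u w),
    littleLpNorm p fun j : Fin (s + 1) ↦ sectionLpNorm B (w j) p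

end Sobolev

end

end NablaSobolev

/-!
The iterated covariant derivatives of `a u` are given by the Leibniz rule: in the argument slots
`X₁, …, X_k`,
`∇^k (a u)(X₁, …, X_k) = ∑ (∇^{|I|} a)(X_I) ((∇^{|J|} u)(X_J))`,
the sum being over the `2^k` ways to distribute the slots over two disjoint sets `I` and `J`
(`productTower`). Pointwise, each term has norm at most `|∇^{|I|} a| |∇^{|J|} u|`
(`tensorNorm_mul_le`), so Hölder's inequality bounds the `L^r` norm of `∇^k (a u)` by `2^k` times
the product of the norms of `a` and `u` (`sectionLpNorm_productTower_le`). Hence the constant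
`(l + 1) 2^l`, which is independent of the manifold, of the bundles and of the connections.

What has to be shown is that the Leibniz rule holds for weak derivatives
(`isDerivativeTower_productTower`). The question is local. Near a point, a frame `(s_i)` of `E` and
its dual frame `(t_i)` extend to smooth sections with `e = ∑ (t_i, e) s_i`, so that the pairing of
`a u` with a smooth section `φ` of `E₁` is
`(φ, a u) = ∑ (φ, a s_i) (t_i, u) = ∑ (φ ⊗ s_i^*, a) (t_i, u)`,
in which `φ ⊗ s_i^*` is a smooth section of `Hom(E; E₁)` (`HasWeakDerivAlong.apply`). This reduces
the claim to the product rule for weak derivatives of complex-valued functions on an open subset of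
`ℝⁿ`, for factors that lie, with their weak derivatives, in `L^p_loc` and in `L^q_loc`
(`IsWeakDeriv.mul`). That rule is proved by mollifying a factor of finite exponent; mollification
does not converge in `L^∞`, and if both exponents are `∞`, one of the factors is regarded as an
element of `L^1_loc`.

Weak covariant derivatives are defined by testing against smooth sections and smooth vector fields.
The local integrability of the terms that contain the Levi-Civita connection requires that it map
smooth vector fields to smooth vector fields (`IsSmoothVectorField.leviCivita`): this follows from
Koszul's formula, since its right hand side is tensorial in the fields `X` and `Z`.
-/

set_option linter.unusedSectionVars false

namespace NablaSobolev

/-! ### Mollification in `L^p` -/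

section Mollification

open Filter Topology ContinuousLinearMap
open scoped Convolution

variable {G : Type*} [NormedAddCommGroup G] [NormedSpace ℝ G] [FiniteDimensional ℝ G]
  [MeasurableSpace G] [BorelSpace G] {μ : Measure G} [μ.IsAddHaarMeasure]

/-- Young's inequality for a kernel `ρ`, in its dual form: `R ↦ ρ ⋆ R`, paired with `L^q`, is
bounded on `L^p` by the `L^1` norm of `ρ`. -/
theorem lintegral_enorm_convolution_mul_le {p q : ℝ≥0∞} [p.HolderConjugate q] {ρ : G → ℝ}
    (hρ : Continuous ρ) {R h : G → ℂ} (hR : AEStronglyMeasurable R μ)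
    (hh : AEStronglyMeasurable h μ) :
    ∫⁻ x, ‖(ρ ⋆[lsmul ℝ ℝ, μ] R) x * h x‖ₑ ∂μ ≤
      (∫⁻ z, ‖ρ z‖ₑ ∂μ) * (eLpNorm R p μ * eLpNorm h q μ) := by
  have hmeas : AEMeasurable (fun z : G × G ↦ ‖ρ z.2‖ₑ * ‖R (z.1 - z.2)‖ₑ * ‖h z.1‖ₑ)
      (μ.prod μ) := by
    refine ((hρ.measurable.comp measurable_snd).enorm.aemeasurable.mul ?_).mul
      hh.comp_fst.enorm
    exact (hR.comp_quasiMeasurePreserving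
      (quasiMeasurePreserving_sub_of_right_invariant μ μ)).enorm
  calc ∫⁻ x, ‖(ρ ⋆[lsmul ℝ ℝ, μ] R) x * h x‖ₑ ∂μ
      ≤ ∫⁻ x, ∫⁻ z, ‖ρ z‖ₑ * ‖R (x - z)‖ₑ * ‖h x‖ₑ ∂μ ∂μ := by
        refine lintegral_mono fun x ↦ ?_
        rw [enorm_mul, lintegral_mul_const' _ _ enorm_ne_top]
        gcongr
        refine (enorm_integral_le_lintegral_enorm _).trans_eq ?_
        simp_rw [lsmul_apply, enorm_smul]
    _ = ∫⁻ z, ∫⁻ x, ‖ρ z‖ₑ * ‖R (x - z)‖ₑ * ‖h x‖ₑ ∂μ ∂μ := lintegral_lintegral_swap hmeas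
    _ ≤ ∫⁻ z, ‖ρ z‖ₑ * (eLpNorm R p μ * eLpNorm h q μ) ∂μ := by
        refine lintegral_mono fun z ↦ ?_
        simp_rw [mul_assoc]
        rw [lintegral_const_mul' _ _ enorm_ne_top]
        gcongr
        have hm := measurePreserving_sub_right μ z
        have h1 := eLpNorm_smul_le_mul_eLpNorm (p := p) (q := q) (r := 1) hh
          (hR.comp_measurePreserving hm)
        rw [eLpNorm_comp_measurePreserving hR hm, eLpNorm_one_eq_lintegral_enorm] at h1
        simpa [enorm_mul] using h1
    _ = _ := by
        rw [lintegral_mul_const _ hρ.measurable.enorm]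

/-- Mollifications of an `L^p` function, `p < ∞`, converge weakly against `L^q`. -/
theorem tendsto_integral_convolution_mul {p q : ℝ≥0∞} [p.HolderConjugate q] (hp : p ≠ ⊤)
    {φ : ℕ → ContDiffBump (0 : G)} (hφ : Tendsto (fun i ↦ (φ i).rOut) atTop (𝓝 0))
    {R h : G → ℂ} (hR : MemLp R p μ) (hh : MemLp h q μ) (hh1 : Integrable h μ) :
    Tendsto (fun i ↦ ∫ x, ((φ i).normed μ ⋆[lsmul ℝ ℝ, μ] R) x * h x ∂μ) atTop
      (𝓝 (∫ x, R x * h x ∂μ)) := by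
  have hρ1 (i : ℕ) : ∫⁻ z, ‖(φ i).normed μ z‖ₑ ∂μ = 1 := by
    have := (φ i).integral_normed (μ := μ)
    rw [integral_eq_lintegral_of_nonneg_ae (.of_forall (φ i).nonneg_normed)
      (φ i).continuous_normed.aestronglyMeasurable] at this
    simp_rw [Real.enorm_eq_ofReal ((φ i).nonneg_normed _)]
    exact (ENNReal.toReal_eq_one_iff _).1 this
  have hp1 : 1 ≤ p := ENNReal.HolderConjugate.one_le p q
  have hint {R : G → ℂ} (hR : MemLp R p μ) (i : ℕ) :
      Integrable (fun x ↦ ((φ i).normed μ ⋆[lsmul ℝ ℝ, μ] R) x * h x) μ := by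
    refine ⟨?_, ?_⟩
    · refine AEStronglyMeasurable.mul ?_ hh.1
      exact ((φ i).hasCompactSupport_normed.continuous_convolution_left (lsmul ℝ ℝ)
        (φ i).continuous_normed (hR.locallyIntegrable hp1)).aestronglyMeasurable
    · refine (lintegral_enorm_convolution_mul_le (p := p) (q := q) (φ i).continuous_normed
        hR.1 hh.1).trans_lt ?_
      rw [hρ1, one_mul]
      exact ENNReal.mul_lt_top hR.2 hh.2
  have hprod {R : G → ℂ} (hR : MemLp R p μ) : Integrable (fun x ↦ R x * h x) μ :=
    memLp_one_iff_integrable.1 (hh.mul' hR)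
  rw [Metric.tendsto_atTop]
  intro ε hε
  -- `h` has finite norms; fix a bound for both of them
  obtain ⟨C, hC0, hC1, hC2⟩ : ∃ C : ℝ, 0 < C ∧ eLpNorm h q μ ≤ ENNReal.ofReal C ∧
      ∫ x, ‖h x‖ ∂μ ≤ C := by
    refine ⟨max 1 (max (eLpNorm h q μ).toReal (∫ x, ‖h x‖ ∂μ)), by positivity, ?_, by simp⟩
    rw [← ENNReal.ofReal_toReal hh.2.ne]
    exact ENNReal.ofReal_le_ofReal (by simp)
  obtain ⟨g, hgs, hgε, hgc, hgp⟩ := hR.exists_hasCompactSupport_eLpNorm_sub_le hp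
    (ε := ENNReal.ofReal (ε / (4 * C))) (by simp; positivity)
  have huc := hgs.uniformContinuous_of_continuous hgc
  obtain ⟨δ, hδ, hgδ⟩ := Metric.uniformContinuous_iff.1 huc (ε / (4 * C)) (by positivity)
  obtain ⟨N, hN⟩ := Metric.tendsto_atTop.1 hφ δ hδ
  refine ⟨N, fun i hi ↦ ?_⟩
  have hi' : (φ i).rOut ≤ δ := by
    have := hN i hi
    rw [Real.dist_eq, sub_zero] at this
    exact (le_abs_self _).trans this.le
  have hD : MemLp (R - g) p μ := hR.sub hgp
  have hconv (x : G) : ((φ i).normed μ ⋆[lsmul ℝ ℝ, μ] R) x =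
      ((φ i).normed μ ⋆[lsmul ℝ ℝ, μ] (R - g)) x + ((φ i).normed μ ⋆[lsmul ℝ ℝ, μ] g) x := by
    have h1 := ((φ i).hasCompactSupport_normed (μ := μ)).convolutionExists_left (lsmul ℝ ℝ)
      (φ i).continuous_normed (hD.locallyIntegrable hp1) x
    have h2 := ((φ i).hasCompactSupport_normed (μ := μ)).convolutionExists_left (lsmul ℝ ℝ)
      (φ i).continuous_normed (hgp.locallyIntegrable hp1) x
    rw [← ConvolutionExistsAt.distrib_add h1 h2]
    simp
  have hbound : eLpNorm (R - g) p μ * eLpNorm h q μ ≤ ENNReal.ofReal (ε / 4) := by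
    refine (mul_le_mul' hgε hC1).trans_eq ?_
    rw [← ENNReal.ofReal_mul (by positivity)]
    congr 1
    field_simp
  have e1 : ‖∫ x, ((φ i).normed μ ⋆[lsmul ℝ ℝ, μ] (R - g)) x * h x ∂μ‖ ≤ ε / 4 := by
    have := lintegral_enorm_convolution_mul_le (p := p) (q := q)
      ((φ i).continuous_normed (μ := μ)) hD.1 hh.1
    rw [hρ1, one_mul] at this
    have := (enorm_integral_le_lintegral_enorm _).trans (this.trans hbound)
    rwa [← ofReal_norm, ENNReal.ofReal_le_ofReal_iff (by positivity)] at this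
  have e2 : ‖∫ x, (R - g) x * h x ∂μ‖ ≤ ε / 4 := by
    have h1 := eLpNorm_smul_le_mul_eLpNorm (p := p) (q := q) (r := 1) hh.1 hD.1
    rw [eLpNorm_one_eq_lintegral_enorm] at h1
    have := (enorm_integral_le_lintegral_enorm _).trans (h1.trans hbound)
    rwa [← ofReal_norm, ENNReal.ofReal_le_ofReal_iff (by positivity)] at this
  have e3 : ‖∫ x, (((φ i).normed μ ⋆[lsmul ℝ ℝ, μ] g) x - g x) * h x ∂μ‖ ≤ ε / 4 := by
    have : ‖∫ x, (((φ i).normed μ ⋆[lsmul ℝ ℝ, μ] g) x - g x) * h x ∂μ‖ ≤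
        ∫ x, ε / (4 * C) * ‖h x‖ ∂μ := by
      refine norm_integral_le_of_norm_le (hh1.norm.const_mul _) (.of_forall fun x ↦ ?_)
      rw [norm_mul]
      gcongr
      rw [← dist_eq_norm]
      refine (φ i).dist_normed_convolution_le hgc.aestronglyMeasurable fun y hy ↦ (hgδ ?_).le
      exact (Metric.mem_ball.1 hy).trans_le hi'
    refine this.trans ?_
    rw [integral_const_mul]
    calc ε / (4 * C) * ∫ x, ‖h x‖ ∂μ ≤ ε / (4 * C) * C := by gcongr
      _ = ε / 4 := by field_simp
  have key : (∫ x, ((φ i).normed μ ⋆[lsmul ℝ ℝ, μ] R) x * h x ∂μ) - ∫ x, R x * h x ∂μ =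
      (∫ x, ((φ i).normed μ ⋆[lsmul ℝ ℝ, μ] (R - g)) x * h x ∂μ) -
        (∫ x, (R - g) x * h x ∂μ) +
        ∫ x, (((φ i).normed μ ⋆[lsmul ℝ ℝ, μ] g) x - g x) * h x ∂μ := by
    rw [← integral_sub (hint hR i) (hprod hR), ← integral_sub (hint hD i) (hprod hD),
      ← integral_add (by exact (hint hD i).sub (hprod hD))]
    · congr 1
      ext x
      rw [hconv x]
      simp only [Pi.sub_apply]
      ring
    · simp_rw [sub_mul]
      exact (hint hgp i).sub (hprod hgp)
  rw [dist_eq_norm, key]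
  calc _ ≤ ε / 4 + ε / 4 + ε / 4 :=
        (norm_add_le _ _).trans (add_le_add ((norm_sub_le _ _).trans (add_le_add e1 e2)) e3)
    _ < ε := by linarith

end Mollification

/-! ### Weak directional derivatives in a vector space -/

section WeakDerivative

open Filter Topology ContinuousLinearMap
open scoped Convolution

variable {G : Type*} [NormedAddCommGroup G] [NormedSpace ℝ G]
  [MeasurableSpace G]

/-- `f'` is the weak derivative of `f` in the direction `v` on the open set `U`. -/
structure IsWeakDeriv (μ : Measure G) (U : Set G) (v : G) (f f' : G → ℂ) : Prop where
  locallyIntegrableOn : LocallyIntegrableOn f U μ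
  locallyIntegrableOn_deriv : LocallyIntegrableOn f' U μ
  integral_eq : ∀ η : G → ℝ, ContDiff ℝ ∞ η → HasCompactSupport η → tsupport η ⊆ U →
    ∫ y in U, (fderiv ℝ η y v) • f y ∂μ = - ∫ y in U, η y • f' y ∂μ

theorem support_fderiv_apply_subset (η : G → ℝ) (v : G) :
    (Function.support fun y ↦ fderiv ℝ η y v) ⊆ tsupport η := by
  intro y hy
  refine support_fderiv_subset ℝ fun h ↦ hy ?_
  simp [h]

variable {μ : Measure G} {U : Set G} {v : G} {f f' g g' : G → ℂ}

theorem setIntegral_eq_integral_of_tsupport {F : Type*} [NormedAddCommGroup F] [NormedSpace ℝ F]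
    {η : G → ℝ} (hη : tsupport η ⊆ U) {u : G → F}
    (hu : Function.support u ⊆ tsupport η) : ∫ y in U, u y ∂μ = ∫ y, u y ∂μ :=
  setIntegral_eq_integral_of_forall_compl_eq_zero fun _ hy ↦
    by_contra fun h ↦ hy (hη (hu h))

theorem support_smul_subset_tsupport {F : Type*} [NormedAddCommGroup F] [NormedSpace ℝ F]
    (η : G → ℝ) (u : G → F) : (Function.support fun y ↦ η y • u y) ⊆ tsupport η :=
  (Function.support_smul_subset_left η u).trans (subset_tsupport η)

theorem support_fderiv_smul_subset_tsupport {F : Type*} [NormedAddCommGroup F] [NormedSpace ℝ F]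
    (η : G → ℝ) (v : G) (u : G → F) :
    (Function.support fun y ↦ (fderiv ℝ η y v) • u y) ⊆ tsupport η :=
  (Function.support_smul_subset_left _ u).trans (support_fderiv_apply_subset η v)

theorem IsWeakDeriv.integral_eq' (h : IsWeakDeriv μ U v f f') {η : G → ℝ} (hη : ContDiff ℝ ∞ η)
    (hc : HasCompactSupport η) (hU : tsupport η ⊆ U) :
    ∫ y, (fderiv ℝ η y v) • f y ∂μ = - ∫ y, η y • f' y ∂μ := by
  have := h.integral_eq η hη hc hU
  rwa [setIntegral_eq_integral_of_tsupport hU (support_fderiv_smul_subset_tsupport _ _ _),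
    setIntegral_eq_integral_of_tsupport hU (support_smul_subset_tsupport _ _)] at this

theorem isWeakDeriv_iff : IsWeakDeriv μ U v f f' ↔ LocallyIntegrableOn f U μ ∧
    LocallyIntegrableOn f' U μ ∧ ∀ η : G → ℝ, ContDiff ℝ ∞ η → HasCompactSupport η →
      tsupport η ⊆ U → ∫ y, (fderiv ℝ η y v) • f y ∂μ = - ∫ y, η y • f' y ∂μ := by
  refine ⟨fun h ↦ ⟨h.1, h.2, fun η h1 h2 h3 ↦ h.integral_eq' h1 h2 h3⟩, fun h ↦ ⟨h.1, h.2.1, ?_⟩⟩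
  intro η h1 h2 h3
  rw [setIntegral_eq_integral_of_tsupport h3 (support_fderiv_smul_subset_tsupport _ _ _),
    setIntegral_eq_integral_of_tsupport h3 (support_smul_subset_tsupport _ _)]
  exact h.2.2 η h1 h2 h3

theorem IsWeakDeriv.mono (h : IsWeakDeriv μ U v f f') {V : Set G} (hV : V ⊆ U) :
    IsWeakDeriv μ V v f f' :=
  isWeakDeriv_iff.2 ⟨h.1.mono_set hV, h.2.mono_set hV,
    fun _ h1 h2 h3 ↦ h.integral_eq' h1 h2 (h3.trans hV)⟩

theorem integrable_smul_of_tsupport [BorelSpace G] {F : Type*} [NormedAddCommGroup F]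
    [NormedSpace ℝ F] {θ η : G → ℝ}
    (hθ : Continuous θ) (hs : Function.support θ ⊆ tsupport η) (hc : HasCompactSupport η)
    (hU : tsupport η ⊆ U) {u : G → F} (hu : LocallyIntegrableOn u U μ) :
    Integrable (fun y ↦ θ y • u y) μ := by
  have h1 : IntegrableOn u (tsupport η) μ := hu.integrableOn_compact_subset hU hc
  have h2 : IntegrableOn (fun y ↦ θ y • u y) (tsupport η) μ :=
    h1.continuousOn_smul hθ.continuousOn hc
  rwa [integrableOn_iff_integrable_of_support_subset] at h2
  exact (Function.support_smul_subset_left _ u).trans hs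

theorem continuous_fderiv_apply_of_contDiff {η : G → ℝ} (hη : ContDiff ℝ ∞ η) (v : G) :
    Continuous fun y ↦ fderiv ℝ η y v :=
  (hη.continuous_fderiv (by simp)).clm_apply continuous_const

theorem IsWeakDeriv.add [BorelSpace G] (hf : IsWeakDeriv μ U v f f')
    (hg : IsWeakDeriv μ U v g g') :
    IsWeakDeriv μ U v (fun y ↦ f y + g y) (fun y ↦ f' y + g' y) := by
  refine isWeakDeriv_iff.2 ⟨hf.1.add hg.1, hf.2.add hg.2, fun η h1 h2 h3 ↦ ?_⟩
  have hd := continuous_fderiv_apply_of_contDiff h1 v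
  simp_rw [smul_add]
  rw [integral_add, integral_add, hf.integral_eq' h1 h2 h3, hg.integral_eq' h1 h2 h3]
  · ring
  · exact integrable_smul_of_tsupport h1.continuous (subset_tsupport _) h2 h3 hf.2
  · exact integrable_smul_of_tsupport h1.continuous (subset_tsupport _) h2 h3 hg.2
  · exact integrable_smul_of_tsupport hd (support_fderiv_apply_subset _ _) h2 h3 hf.1
  · exact integrable_smul_of_tsupport hd (support_fderiv_apply_subset _ _) h2 h3 hg.1

theorem IsWeakDeriv.zero : IsWeakDeriv μ U v (fun _ ↦ 0) (fun _ ↦ 0) := by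
  refine isWeakDeriv_iff.2 ⟨locallyIntegrableOn_zero, locallyIntegrableOn_zero, ?_⟩
  simp

theorem IsWeakDeriv.const_mul (c : ℂ) (hf : IsWeakDeriv μ U v f f') :
    IsWeakDeriv μ U v (fun y ↦ c * f y) (fun y ↦ c * f' y) := by
  refine isWeakDeriv_iff.2 ⟨hf.1.smul c, hf.2.smul c, fun η h1 h2 h3 ↦ ?_⟩
  have := congrArg (c * ·) (hf.integral_eq' h1 h2 h3)
  simp only [mul_neg, ← integral_const_mul] at this
  simpa only [mul_smul_comm] using this

theorem IsWeakDeriv.sum [BorelSpace G] {ι : Type*} (s : Finset ι) {f f' : ι → G → ℂ}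
    (h : ∀ i ∈ s, IsWeakDeriv μ U v (f i) (f' i)) :
    IsWeakDeriv μ U v (fun y ↦ ∑ i ∈ s, f i y) (fun y ↦ ∑ i ∈ s, f' i y) := by
  classical
  induction s using Finset.induction_on with
  | empty => simpa using IsWeakDeriv.zero
  | insert a s ha ih =>
    simp_rw [Finset.sum_insert ha]
    exact (h a (by simp)).add (ih fun i hi ↦ h i (by simp [hi]))

theorem IsWeakDeriv.congr [BorelSpace G] (hU : IsOpen U) (hf : IsWeakDeriv μ U v f f')
    (h : ∀ y ∈ U, f y = g y) (h' : ∀ y ∈ U, f' y = g' y) : IsWeakDeriv μ U v g g' := by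
  have e1 : f =ᵐ[μ.restrict U] g := (ae_restrict_iff' hU.measurableSet).2 (.of_forall h)
  have e2 : f' =ᵐ[μ.restrict U] g' := (ae_restrict_iff' hU.measurableSet).2 (.of_forall h')
  refine ⟨hf.1.congr e1, hf.2.congr e2, fun η h1 h2 h3 ↦ ?_⟩
  rw [setIntegral_congr_fun hU.measurableSet (g := fun y ↦ (fderiv ℝ η y v) • f y)
      fun y hy ↦ by simp [h y hy],
    setIntegral_congr_fun hU.measurableSet (f := fun y ↦ η y • g' y) (g := fun y ↦ η y • f' y)
      fun y hy ↦ by simp [h' y hy]]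
  exact hf.integral_eq η h1 h2 h3

/-- Being a weak derivative is a local property: a test function is split by a smooth partition
of unity. -/
theorem IsWeakDeriv.of_locally [BorelSpace G] [FiniteDimensional ℝ G]
    (h : ∀ y ∈ U, ∃ V, IsOpen V ∧ y ∈ V ∧ IsWeakDeriv μ V v f f') :
    IsWeakDeriv μ U v f f' := by
  have hl {u : G → ℂ} (hu : ∀ y ∈ U, ∃ V, IsOpen V ∧ y ∈ V ∧ LocallyIntegrableOn u V μ) :
      LocallyIntegrableOn u U μ := by
    intro y hy
    obtain ⟨V, hV, hyV, hVi⟩ := hu y hy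
    have := hVi y hyV
    rw [hV.nhdsWithin_eq hyV] at this
    exact this.filter_mono nhdsWithin_le_nhds
  have hf : LocallyIntegrableOn f U μ := hl fun y hy ↦
    let ⟨V, h1, h2, h3⟩ := h y hy; ⟨V, h1, h2, h3.1⟩
  have hf' : LocallyIntegrableOn f' U μ := hl fun y hy ↦
    let ⟨V, h1, h2, h3⟩ := h y hy; ⟨V, h1, h2, h3.2⟩
  refine isWeakDeriv_iff.2 ⟨hf, hf', fun η h1 h2 h3 ↦ ?_⟩
  choose! V hV hyV hw using h
  obtain ⟨s, hs⟩ := (IsCompact.elim_nhds_subcover' h2 (fun y hy ↦ V y)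
    fun y hy ↦ (hV y (h3 hy)).mem_nhds (hyV y (h3 hy)))
  obtain ⟨P, hP⟩ := SmoothPartitionOfUnity.exists_isSubordinate 𝓘(ℝ, G) (isClosed_tsupport η)
    (fun i : s ↦ V i.1) (fun i ↦ hV _ (h3 i.1.2)) (by simpa [iUnion_subtype] using hs)
  have hPη (i : s) : ContDiff ℝ ∞ fun y ↦ P i y * η y :=
    ((P i).contMDiff.contDiff).mul h1
  have hsum : ∀ y, η y = ∑ i, P i y * η y := fun y ↦ by
    by_cases hy : y ∈ tsupport η
    · rw [← Finset.sum_mul]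
      have := P.sum_eq_one hy
      rw [finsum_eq_sum_of_fintype] at this
      rw [this, one_mul]
    · simp [image_eq_zero_of_notMem_tsupport hy]
  have hcs (i : s) : HasCompactSupport fun y ↦ P i y * η y := h2.mul_left
  have hts (i : s) : tsupport (fun y ↦ P i y * η y) ⊆ V i.1 :=
    (tsupport_mul_subset_left).trans (hP i)
  have hfd (y : G) : fderiv ℝ η y v = ∑ i, fderiv ℝ (fun y ↦ P i y * η y) y v := by
    conv_lhs => rw [funext hsum]
    rw [fderiv_fun_sum fun i _ ↦ ((hPη i).differentiable (by simp)).differentiableAt]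
    simp
  have e1 : ∀ y, (fderiv ℝ η y v) • f y = ∑ i, (fderiv ℝ (fun y ↦ P i y * η y) y v) • f y :=
    fun y ↦ by rw [hfd, Finset.sum_smul]
  have e2 : ∀ y, η y • f' y = ∑ i, (P i y * η y) • f' y :=
    fun y ↦ by rw [← Finset.sum_smul, ← hsum]
  simp_rw [e1, e2]
  rw [integral_finsetSum, integral_finsetSum, ← Finset.sum_neg_distrib]
  · refine Finset.sum_congr rfl fun i _ ↦ (hw _ (h3 i.1.2)).integral_eq' (hPη i) (hcs i) (hts i)
  · intro i _
    exact integrable_smul_of_tsupport (hPη i).continuous (subset_tsupport _) (hcs i) (hts i)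
      (hw _ (h3 i.1.2)).2
  · intro i _
    exact integrable_smul_of_tsupport (continuous_fderiv_apply_of_contDiff (hPη i) v)
      (support_fderiv_apply_subset _ _) (hcs i) (hts i) (hw _ (h3 i.1.2)).1

end WeakDerivative

/-! ### The product rule for weak derivatives -/

section ProductRule

open Filter Topology ContinuousLinearMap
open scoped Convolution

variable {G : Type*} [NormedAddCommGroup G] [NormedSpace ℝ G]
  [MeasurableSpace G] [BorelSpace G] [FiniteDimensional ℝ G]
  {μ : Measure G} {U : Set G} {v : G} {f f' g g' : G → ℂ}

/-- `f` belongs to `L^p_loc(U)`. -/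
def MemLpLoc (f : G → ℂ) (p : ℝ≥0∞) (μ : Measure G) (U : Set G) : Prop :=
  ∀ K ⊆ U, IsCompact K → MemLp f p (μ.restrict K)

theorem MemLpLoc.mono_exponent [IsLocallyFiniteMeasure μ] {p q : ℝ≥0∞} (hf : MemLpLoc f q μ U)
    (h : p ≤ q) : MemLpLoc f p μ U := fun K hK hc ↦
  have : IsFiniteMeasure (μ.restrict K) := ⟨by simpa using hc.measure_lt_top⟩
  (hf K hK hc).mono_exponent h

theorem MemLpLoc.mono_set {p : ℝ≥0∞} (hf : MemLpLoc f p μ U) {V : Set G}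
    (h : V ⊆ U) : MemLpLoc f p μ V := fun K hK hc ↦ hf K (hK.trans h) hc

theorem MemLpLoc.add {p : ℝ≥0∞} (hf : MemLpLoc f p μ U) (hg : MemLpLoc g p μ U) :
    MemLpLoc (fun y ↦ f y + g y) p μ U := fun K hK hc ↦ (hf K hK hc).add (hg K hK hc)

theorem MemLpLoc.sum {p : ℝ≥0∞} {ι : Type*} (s : Finset ι) {f : ι → G → ℂ}
    (hf : ∀ i ∈ s, MemLpLoc (f i) p μ U) :
    MemLpLoc (fun y ↦ ∑ i ∈ s, f i y) p μ U := fun K hK hc ↦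
  memLp_finsetSum s fun i hi ↦ hf i hi K hK hc

theorem MemLpLoc.mul {p q r : ℝ≥0∞} [ENNReal.HolderTriple p q r] (hf : MemLpLoc f p μ U)
    (hg : MemLpLoc g q μ U) : MemLpLoc (fun y ↦ f y * g y) r μ U := fun K hK hc ↦
  (hg K hK hc).mul' (hf K hK hc)

theorem MemLpLoc.congr {p : ℝ≥0∞} (hf : MemLpLoc f p μ U) (h : ∀ y ∈ U, f y = g y) :
    MemLpLoc g p μ U := fun K hK hc ↦
  (memLp_congr_ae ((ae_restrict_iff' hc.measurableSet).2
    (.of_forall fun y hy ↦ h y (hK hy)))).1 (hf K hK hc)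

theorem MemLpLoc.locallyIntegrableOn [IsLocallyFiniteMeasure μ] {p : ℝ≥0∞} (hU : IsOpen U)
    (hp : 1 ≤ p) (hf : MemLpLoc f p μ U) : LocallyIntegrableOn f U μ := by
  rw [locallyIntegrableOn_iff hU.isLocallyClosed]
  intro K hK hc
  exact memLp_one_iff_integrable.1 (hf.mono_exponent hp K hK hc)

/-- A continuous function with compact support in `U` turns `L^p_loc(U)` into `L^p`. -/
theorem MemLpLoc.memLp_smul {p : ℝ≥0∞} (hf : MemLpLoc f p μ U) {θ η : G → ℝ}
    (hθ : Continuous θ) (hs : Function.support θ ⊆ tsupport η) (hc : HasCompactSupport η)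
    (hU : tsupport η ⊆ U) : MemLp (fun y ↦ θ y • f y) p μ := by
  have hm : MeasurableSet (tsupport η) := (isClosed_tsupport η).measurableSet
  have h1 := (memLp_indicator_iff_restrict hm).2 (hf _ hU hc)
  have he : (fun y ↦ θ y • f y) = fun y ↦ θ y • (tsupport η).indicator f y := by
    ext y
    by_cases hy : y ∈ tsupport η
    · simp [hy]
    · have : θ y = 0 := by_contra fun h ↦ hy (hs h)
      simp [this]
  obtain ⟨C, hC⟩ : ∃ C, ∀ y, ‖θ y‖ ≤ C := hθ.bounded_above_of_compact_support
    (hc.mono' hs)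
  rw [he]
  refine h1.of_le_mul (c := C) (hθ.aestronglyMeasurable.smul h1.1) (.of_forall fun y ↦ ?_)
  rw [norm_smul]
  gcongr
  exact hC y

/-- The defining identity of a weak derivative, tested with a complex valued function. -/
theorem IsWeakDeriv.integral_mul_eq (h : IsWeakDeriv μ U v f f') {Ψ : G → ℂ}
    (hΨ : ContDiff ℝ ∞ Ψ) (hc : HasCompactSupport Ψ) (hU : tsupport Ψ ⊆ U) :
    ∫ y, (fderiv ℝ Ψ y v) * f y ∂μ = - ∫ y, Ψ y * f' y ∂μ := by
  have hre : ContDiff ℝ ∞ fun y ↦ (Ψ y).re := Complex.reCLM.contDiff.comp hΨ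
  have him : ContDiff ℝ ∞ fun y ↦ (Ψ y).im := Complex.imCLM.contDiff.comp hΨ
  have hsre : tsupport (fun y ↦ (Ψ y).re) ⊆ tsupport Ψ :=
    closure_mono fun y hy hy' ↦ hy (by simp [hy'])
  have hsim : tsupport (fun y ↦ (Ψ y).im) ⊆ tsupport Ψ :=
    closure_mono fun y hy hy' ↦ hy (by simp [hy'])
  have hcre : HasCompactSupport fun y ↦ (Ψ y).re := hc.mono' ((subset_tsupport _).trans hsre)
  have hcim : HasCompactSupport fun y ↦ (Ψ y).im := hc.mono' ((subset_tsupport _).trans hsim)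
  have e1 := h.integral_eq' hre hcre (hsre.trans hU)
  have e2 := h.integral_eq' him hcim (hsim.trans hU)
  have hd (y : G) : fderiv ℝ Ψ y v = (fderiv ℝ (fun y ↦ (Ψ y).re) y v : ℂ) +
      Complex.I * (fderiv ℝ (fun y ↦ (Ψ y).im) y v : ℂ) := by
    have hΨd := (hΨ.differentiable (by simp)) y
    have h1 : HasFDerivAt (fun y ↦ (Ψ y).re) (Complex.reCLM.comp (fderiv ℝ Ψ y)) y :=
      Complex.reCLM.hasFDerivAt.comp y hΨd.hasFDerivAt
    have h2 : HasFDerivAt (fun y ↦ (Ψ y).im) (Complex.imCLM.comp (fderiv ℝ Ψ y)) y :=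
      Complex.imCLM.hasFDerivAt.comp y hΨd.hasFDerivAt
    rw [h1.fderiv, h2.fderiv]
    simp [mul_comm Complex.I, Complex.re_add_im]
  have i1 := integrable_smul_of_tsupport (continuous_fderiv_apply_of_contDiff hre v)
    (support_fderiv_apply_subset _ _) hcre (hsre.trans hU) h.1
  have i2 := integrable_smul_of_tsupport (continuous_fderiv_apply_of_contDiff him v)
    (support_fderiv_apply_subset _ _) hcim (hsim.trans hU) h.1
  have i3 := integrable_smul_of_tsupport hre.continuous (subset_tsupport _) hcre
    (hsre.trans hU) h.2
  have i4 := integrable_smul_of_tsupport him.continuous (subset_tsupport _) hcim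
    (hsim.trans hU) h.2
  have f1 : ∀ y, (fderiv ℝ Ψ y v) * f y = (fderiv ℝ (fun y ↦ (Ψ y).re) y v) • f y +
      Complex.I * ((fderiv ℝ (fun y ↦ (Ψ y).im) y v) • f y) := fun y ↦ by
    rw [hd, Complex.real_smul, Complex.real_smul]; ring
  have f2 : ∀ y, Ψ y * f' y = (Ψ y).re • f' y + Complex.I * ((Ψ y).im • f' y) := fun y ↦ by
    rw [Complex.real_smul, Complex.real_smul]
    conv_lhs => rw [← Complex.re_add_im (Ψ y)]
    ring
  simp_rw [f1, f2]
  rw [integral_add i1 (i2.const_mul _), integral_add i3 (i4.const_mul _), integral_const_mul,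
    integral_const_mul, e1, e2]
  ring

variable [μ.IsAddHaarMeasure]

/-- Mollification commutes with weak derivatives. -/
theorem IsWeakDeriv.fderiv_convolution (h : IsWeakDeriv μ univ v f f')
    {ρ : G → ℝ} (hρ : ContDiff ℝ ∞ ρ) (hc : HasCompactSupport ρ) (x : G) :
    fderiv ℝ (ρ ⋆[lsmul ℝ ℝ, μ] f) x v = (ρ ⋆[lsmul ℝ ℝ, μ] f') x := by
  have hf : LocallyIntegrable f μ := locallyIntegrableOn_univ.1 h.1
  have hd := hc.hasFDerivAt_convolution_left (lsmul ℝ ℝ) (hρ.of_le (by simp)) hf x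
  have hη : ContDiff ℝ ∞ fun y ↦ ρ (x - y) := hρ.comp (contDiff_const.sub contDiff_id)
  have hηc : HasCompactSupport fun y ↦ ρ (x - y) :=
    hc.comp_homeomorph (Homeomorph.subLeft x)
  have e := h.integral_eq' hη hηc (subset_univ _)
  have hηd (y : G) : fderiv ℝ (fun y ↦ ρ (x - y)) y v = - fderiv ℝ ρ (x - y) v := by
    have h1 : HasFDerivAt (fun y ↦ ρ (x - y)) ((fderiv ℝ ρ (x - y)).comp (-.id ℝ G)) y :=
      ((hρ.differentiable (by simp)) (x - y)).hasFDerivAt.comp y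
        ((hasFDerivAt_id y).const_sub x)
    rw [h1.fderiv]; simp
  have hce : ConvolutionExistsAt (fderiv ℝ ρ) f x ((lsmul ℝ ℝ).precompL G) μ :=
    (hc.fderiv ℝ).convolutionExists_left _ (hρ.continuous_fderiv (by simp)) hf x
  rw [hd.fderiv, convolution_def, ContinuousLinearMap.integral_apply hce,
    ← integral_sub_left_eq_self _ μ x, convolution_eq_swap]
  simp only [precompL_apply, lsmul_apply, sub_sub_cancel]
  simp_rw [hηd, neg_smul] at e
  rw [integral_neg] at e
  exact neg_injective e

/-- A cutoff makes a weakly differentiable function globally weakly differentiable. -/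
theorem IsWeakDeriv.cutoff (h : IsWeakDeriv μ U v f f') {ζ : G → ℝ} (hζ : ContDiff ℝ ∞ ζ)
    (hc : HasCompactSupport ζ) (hU : tsupport ζ ⊆ U) :
    IsWeakDeriv μ univ v (fun y ↦ ζ y • f y) (fun y ↦ ζ y • f' y + (fderiv ℝ ζ y v) • f y) := by
  have hζd := continuous_fderiv_apply_of_contDiff hζ v
  have i1 := integrable_smul_of_tsupport hζ.continuous (subset_tsupport _) hc hU h.1
  have i2 := integrable_smul_of_tsupport hζ.continuous (subset_tsupport _) hc hU h.2
  have i3 := integrable_smul_of_tsupport hζd (support_fderiv_apply_subset _ _) hc hU h.1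
  refine isWeakDeriv_iff.2 ⟨i1.locallyIntegrable.locallyIntegrableOn _,
    (i2.add i3).locallyIntegrable.locallyIntegrableOn _, fun η h1 h2 _ ↦ ?_⟩
  have e := h.integral_eq' (hη := hζ.mul h1) (hc := hc.mul_right)
    ((tsupport_mul_subset_left).trans hU)
  have hd (y : G) : fderiv ℝ (fun y ↦ ζ y * η y) y v =
      ζ y * fderiv ℝ η y v + η y * fderiv ℝ ζ y v := by
    rw [fderiv_fun_mul ((hζ.differentiable (by simp)) y) ((h1.differentiable (by simp)) y)]
    simp
  have hs {θ : G → ℝ} (hθ : Function.support θ ⊆ tsupport ζ) (η : G → ℝ) :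
      Function.support (fun y ↦ θ y * η y) ⊆ tsupport ζ :=
    (Function.support_mul_subset_left _ _).trans hθ
  have hηd := continuous_fderiv_apply_of_contDiff h1 v
  have j1 := integrable_smul_of_tsupport (hζ.continuous.fun_mul hηd)
    (hs (subset_tsupport _) _) hc hU h.1
  have j2 := integrable_smul_of_tsupport (hζd.fun_mul h1.continuous)
    (hs (support_fderiv_apply_subset _ _) _) hc hU h.1
  have j3 := integrable_smul_of_tsupport (hζ.continuous.fun_mul h1.continuous)
    (hs (subset_tsupport _) _) hc hU h.2
  have f1 : ∀ y, (fderiv ℝ (fun y ↦ ζ y * η y) y v) • f y =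
      (ζ y * fderiv ℝ η y v) • f y + (fderiv ℝ ζ y v * η y) • f y := fun y ↦ by
    rw [hd, add_smul, mul_comm (η y)]
  have f2 : ∀ y, η y • (ζ y • f' y + fderiv ℝ ζ y v • f y) =
      (ζ y * η y) • f' y + (fderiv ℝ ζ y v * η y) • f y := fun y ↦ by
    rw [smul_add, smul_smul, smul_smul, mul_comm, mul_comm (η y)]
  simp_rw [f1] at e
  simp_rw [f2, smul_smul]
  rw [integral_add j1 j2] at e
  rw [integral_add j3 j2]
  simp_rw [mul_comm (fderiv ℝ η _ v)]
  linear_combination e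

/-- The product rule for `f ∈ L^p_loc`, `g ∈ L^q_loc` with `1/p + 1/q = 1`, `p < ∞`: it holds for
the mollifications of `f`, whose limits are controlled by Hölder's inequality. -/
theorem IsWeakDeriv.mul_of_ne_top {p q : ℝ≥0∞} [p.HolderConjugate q] (hp : p ≠ ⊤) (hU : IsOpen U)
    (hf : IsWeakDeriv μ U v f f') (hg : IsWeakDeriv μ U v g g') (hfp : MemLpLoc f p μ U)
    (hfp' : MemLpLoc f' p μ U) (hgq : MemLpLoc g q μ U) (hgq' : MemLpLoc g' q μ U) :
    IsWeakDeriv μ U v (fun y ↦ f y * g y) (fun y ↦ f' y * g y + f y * g' y) := by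
  have hli {a b : G → ℂ} (ha : MemLpLoc a p μ U) (hb : MemLpLoc b q μ U) :
      LocallyIntegrableOn (fun y ↦ a y * b y) U μ :=
    (ha.mul (r := 1) hb).locallyIntegrableOn hU le_rfl
  refine isWeakDeriv_iff.2 ⟨hli hfp hgq, (hli hfp' hgq).add (hli hfp hgq'), fun η h1 h2 h3 ↦ ?_⟩
  have hηd := continuous_fderiv_apply_of_contDiff h1 v
  -- a cutoff function that is equal to `1` near the support of `η`
  obtain ⟨K, hK, hηK, hKU⟩ := exists_compact_between h2 hU h3
  obtain ⟨ζ, hζ1, hζ0, -⟩ := exists_contMDiffMap_one_nhds_of_subset_interior 𝓘(ℝ, G)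
    (n := (⊤ : ℕ∞)) (isClosed_tsupport η) hηK
  have hζ : ContDiff ℝ ∞ ζ := ζ.contMDiff.contDiff
  have hζs : tsupport ζ ⊆ K :=
    closure_minimal (fun y hy ↦ by_contra fun h ↦ hy (hζ0 y h)) hK.isClosed
  have hζc : HasCompactSupport ζ := hK.of_isClosed_subset (isClosed_tsupport _) hζs
  have hζU : tsupport ζ ⊆ U := hζs.trans hKU
  have hζd := continuous_fderiv_apply_of_contDiff hζ v
  have hζe : ∀ y ∈ tsupport η, ζ y = 1 ∧ fderiv ℝ ζ y v = 0 := fun y hy ↦ by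
    have hy' : ∀ᶠ z in 𝓝 y, ζ z = 1 := hζ1.filter_mono (nhds_le_nhdsSet hy)
    refine ⟨hy'.self_of_nhds, ?_⟩
    rw [Filter.EventuallyEq.fderiv_eq (f := fun _ ↦ (1 : ℝ)) hy']
    simp
  set F : G → ℂ := fun y ↦ ζ y • f y with hF
  set F' : G → ℂ := fun y ↦ ζ y • f' y + (fderiv ℝ ζ y v) • f y with hF'
  have hFw : IsWeakDeriv μ univ v F F' := hf.cutoff hζ hζc hζU
  have hFp : MemLp F p μ := hfp.memLp_smul hζ.continuous (subset_tsupport _) hζc hζU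
  have hFp' : MemLp F' p μ :=
    (hfp'.memLp_smul hζ.continuous (subset_tsupport _) hζc hζU).add
      (hfp.memLp_smul hζd (support_fderiv_apply_subset _ _) hζc hζU)
  have hp1 : 1 ≤ p := ENNReal.HolderConjugate.one_le p q
  have hq1 : 1 ≤ q := ENNReal.HolderConjugate.one_le q p
  have hFl : LocallyIntegrable F μ := hFp.locallyIntegrable hp1
  -- the three functions against which the mollifications are tested
  have m1 := hgq.memLp_smul hηd (support_fderiv_apply_subset _ _) h2 h3
  have m2 := hgq.memLp_smul h1.continuous (subset_tsupport _) h2 h3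
  have m3 := hgq'.memLp_smul h1.continuous (subset_tsupport _) h2 h3
  have n1 := integrable_smul_of_tsupport hηd (support_fderiv_apply_subset _ _) h2 h3 hg.1
  have n2 := integrable_smul_of_tsupport h1.continuous (subset_tsupport _) h2 h3 hg.1
  have n3 := integrable_smul_of_tsupport h1.continuous (subset_tsupport _) h2 h3 hg.2
  let φ : ℕ → ContDiffBump (0 : G) := fun i ↦
    ⟨1 / (i + 2), 1 / (i + 1), by positivity, by
      apply one_div_lt_one_div_of_lt <;> linarith [i.cast_nonneg (α := ℝ)]⟩
  have hφ : Tendsto (fun i ↦ (φ i).rOut) atTop (𝓝 0) :=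
    tendsto_one_div_add_atTop_nhds_zero_nat
  have hid (i : ℕ) :
      (∫ x, ((φ i).normed μ ⋆[lsmul ℝ ℝ, μ] F) x * (fderiv ℝ η x v • g x) ∂μ) +
        (∫ x, ((φ i).normed μ ⋆[lsmul ℝ ℝ, μ] F') x * (η x • g x) ∂μ) =
      - ∫ x, ((φ i).normed μ ⋆[lsmul ℝ ℝ, μ] F) x * (η x • g' x) ∂μ := by
    have hρc := (φ i).hasCompactSupport_normed (μ := μ)
    have hρ : ContDiff ℝ ∞ ((φ i).normed μ) := (φ i).contDiff_normed
    set Φ : G → ℂ := (φ i).normed μ ⋆[lsmul ℝ ℝ, μ] F with hΦ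
    have hΦs : ContDiff ℝ ∞ Φ := hρc.contDiff_convolution_left _ hρ hFl
    have hηc : ContDiff ℝ ∞ fun y ↦ (η y : ℂ) := Complex.ofRealCLM.contDiff.comp h1
    have hts : tsupport (fun y ↦ (η y : ℂ) * Φ y) ⊆ tsupport η :=
      closure_mono fun y hy hy' ↦ hy (by simp [hy'])
    have e := hg.integral_mul_eq (hηc.mul hΦs) (h2.mono' ((subset_tsupport _).trans hts))
      (hts.trans h3)
    have hd (y : G) : fderiv ℝ (fun y ↦ (η y : ℂ) * Φ y) y v =
        (fderiv ℝ η y v : ℂ) * Φ y + η y * ((φ i).normed μ ⋆[lsmul ℝ ℝ, μ] F') y := by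
      have d1 : HasFDerivAt (fun y ↦ (η y : ℂ)) (Complex.ofRealCLM.comp (fderiv ℝ η y)) y :=
        Complex.ofRealCLM.hasFDerivAt.comp y ((h1.differentiable (by simp)) y).hasFDerivAt
      have d2 := ((hΦs.differentiable (by simp)) y).hasFDerivAt
      rw [(d1.fun_mul d2).fderiv]
      simp only [add_apply, smul_apply, smul_eq_mul, comp_apply, Complex.ofRealCLM_apply]
      rw [hΦ, hFw.fderiv_convolution hρ hρc]
      ring
    have hF'l : LocallyIntegrable F' μ := hFp'.locallyIntegrable hp1
    have hb {a b : G → ℂ} (ha : Continuous a) {θ : G → ℝ} (hθ : Continuous θ)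
        (hs : Function.support θ ⊆ tsupport η) (hb : LocallyIntegrableOn b U μ) :
        Integrable (fun x ↦ a x * (θ x • b x)) μ := by
      have : LocallyIntegrableOn (fun x ↦ a x * b x) U μ := hb.continuousOn_mul
        ha.continuousOn hU.isLocallyClosed
      have := integrable_smul_of_tsupport hθ hs h2 h3 this
      simpa only [mul_smul_comm] using this
    rw [← integral_add (hb hΦs.continuous hηd (support_fderiv_apply_subset _ _) hg.1)
      (hb (hρc.continuous_convolution_left _ hρ.continuous hF'l) h1.continuous
        (subset_tsupport _) hg.1)]
    convert! e using 1
    · congr 1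
      ext y
      rw [hd, Complex.real_smul, Complex.real_smul]
      ring
    · congr 2
      ext y
      rw [Complex.real_smul]
      ring
  have hlim := tendsto_nhds_unique
    (((tendsto_integral_convolution_mul hp hφ hFp m1 n1).add
      (tendsto_integral_convolution_mul hp hφ hFp' m2 n2)).congr hid)
    (tendsto_integral_convolution_mul hp hφ hFp m3 n3).neg
  have hpr {a b : G → ℂ} (ha : MemLp a p μ) (hb : MemLp b q μ) :
      Integrable (fun x ↦ a x * b x) μ := memLp_one_iff_integrable.1 (hb.mul' ha)
  have hzero {y : G} (hy : y ∉ tsupport η) : η y = 0 ∧ fderiv ℝ η y v = 0 :=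
    ⟨image_eq_zero_of_notMem_tsupport hy,
      by_contra fun h ↦ hy (support_fderiv_apply_subset η v h)⟩
  have k1 : ∀ y, fderiv ℝ η y v • (f y * g y) = F y * (fderiv ℝ η y v • g y) := fun y ↦ by
    by_cases hy : y ∈ tsupport η
    · simp only [hF, (hζe y hy).1, one_smul, mul_smul_comm]
    · simp [(hzero hy).2]
  have k2 : ∀ y, η y • (f' y * g y + f y * g' y) =
      F' y * (η y • g y) + F y * (η y • g' y) := fun y ↦ by
    by_cases hy : y ∈ tsupport η
    · simp only [hF, hF', (hζe y hy).1, (hζe y hy).2, one_smul, zero_smul, add_zero,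
        mul_smul_comm, smul_add]
    · simp [(hzero hy).1]
  simp_rw [k1, k2]
  rw [integral_add (hpr hFp' m2) (hpr hFp m3)]
  linear_combination hlim

/-- The product rule for `f ∈ L^p_loc`, `g ∈ L^q_loc` with `1/p + 1/q ≤ 1`. -/
theorem IsWeakDeriv.mul {p q r : ℝ≥0∞} [ENNReal.HolderTriple p q r] (hr : 1 ≤ r) (hU : IsOpen U)
    (hf : IsWeakDeriv μ U v f f') (hg : IsWeakDeriv μ U v g g') (hfp : MemLpLoc f p μ U)
    (hfp' : MemLpLoc f' p μ U) (hgq : MemLpLoc g q μ U) (hgq' : MemLpLoc g' q μ U) :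
    IsWeakDeriv μ U v (fun y ↦ f y * g y) (fun y ↦ f' y * g y + f y * g' y) := by
  have hpqr : p⁻¹ + q⁻¹ = r⁻¹ := ENNReal.HolderTriple.inv_add_inv_eq_inv p q r
  have hpq : p⁻¹ + q⁻¹ ≤ 1 := by rw [hpqr]; simpa using hr
  have main {p q : ℝ≥0∞} (hpq : p⁻¹ + q⁻¹ ≤ 1) (hp : p ≠ ⊤) {f f' g g' : G → ℂ}
      (hf : IsWeakDeriv μ U v f f') (hg : IsWeakDeriv μ U v g g') (hfp : MemLpLoc f p μ U)
      (hfp' : MemLpLoc f' p μ U) (hgq : MemLpLoc g q μ U) (hgq' : MemLpLoc g' q μ U) :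
      IsWeakDeriv μ U v (fun y ↦ f y * g y) (fun y ↦ f' y * g y + f y * g' y) := by
    have hp1 : p⁻¹ ≤ 1 := le_self_add.trans hpq
    have : p.HolderConjugate (1 - p⁻¹)⁻¹ := ⟨by
      rw [inv_inv, inv_one, add_tsub_cancel_of_le hp1]⟩
    have hq : (1 - p⁻¹)⁻¹ ≤ q := by
      rw [ENNReal.inv_le_iff_inv_le]
      exact ENNReal.le_sub_of_add_le_left (ne_top_of_le_ne_top ENNReal.one_ne_top hp1) hpq
    exact hf.mul_of_ne_top hp hU hg hfp hfp' (hgq.mono_exponent hq) (hgq'.mono_exponent hq)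
  by_cases hp : p = ⊤
  · by_cases hq : q = ⊤
    · subst hp hq
      -- `L^∞_loc ⊆ L^1_loc`, and `1` and `∞` are conjugate exponents
      exact main (p := 1) (q := ⊤) (by simp) (by simp) hf hg (hfp.mono_exponent le_top)
        (hfp'.mono_exponent le_top) hgq hgq'
    · have := main (p := q) (q := p) (by rwa [add_comm]) hq hg hf hgq hgq' hfp hfp'
      refine this.congr hU (fun y _ ↦ mul_comm _ _) fun y _ ↦ by ring
  · exact main hpq hp hf hg hfp hfp' hgq hgq'

end ProductRule

/-! ### Cutoff of sections and local dual frames -/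

section DualFrames

open Filter Topology

/-- The sections `∑ j, conj (G⁻¹)ᵢⱼ sⱼ`, where `G` is the Gram matrix of a basis `s`, are dual to
the basis `s`. -/
theorem eq_sum_inner_gram_inv_smul {𝕜 V ι : Type*} [RCLike 𝕜] [NormedAddCommGroup V]
    [InnerProductSpace 𝕜 V] [Fintype ι] [DecidableEq ι] {s : ι → V}
    (hli : LinearIndependent 𝕜 s) (hsp : ⊤ ≤ Submodule.span 𝕜 (range s)) (v : V) :
    v = ∑ i, inner 𝕜 (∑ j, star ((Matrix.gram 𝕜 s)⁻¹ i j) • s j) v • s i := by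
  have hdet : IsUnit (Matrix.gram 𝕜 s).det :=
    (Matrix.det_gram_ne_zero_iff_linearIndependent.2 hli).isUnit
  obtain ⟨c, rfl⟩ : ∃ c : ι → 𝕜, ∑ i, c i • s i = v := by
    have := hsp (show v ∈ ⊤ from trivial)
    exact (Submodule.mem_span_range_iff_exists_fun 𝕜).1 this
  refine Finset.sum_congr rfl fun i _ ↦ ?_
  congr 1
  have h1 (j : ι) : inner 𝕜 (s j) (∑ k, c k • s k) = (Matrix.gram 𝕜 s).mulVec c j := by
    simp [inner_sum, inner_smul_right, Matrix.mulVec, dotProduct, Matrix.gram, mul_comm]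
  have h2 : (Matrix.gram 𝕜 s)⁻¹.mulVec ((Matrix.gram 𝕜 s).mulVec c) = c := by
    rw [Matrix.mulVec_mulVec, Matrix.nonsing_inv_mul _ hdet, Matrix.one_mulVec]
  rw [sum_inner]
  simp_rw [inner_smul_left, h1]
  conv_lhs => rw [← h2]
  simp [Matrix.mulVec, dotProduct]

/-- The entries of the inverse matrix are smooth functions of the matrix. -/
theorem contDiffAt_matrix_inv_apply {𝕜 ι : Type*} [RCLike 𝕜] [Fintype ι] [DecidableEq ι]
    {A : ι → ι → 𝕜} (hA : (Matrix.of A).det ≠ 0) (i j : ι) :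
    ContDiffAt ℝ ∞ (fun A : ι → ι → 𝕜 ↦ (Matrix.of A)⁻¹ i j) A := by
  have hdet {B : (ι → ι → 𝕜) → Matrix ι ι 𝕜} (hB : ∀ i j, ContDiff ℝ ∞ fun A ↦ B A i j) :
      ContDiff ℝ ∞ fun A ↦ (B A).det := by
    simp_rw [Matrix.det_apply]
    refine ContDiff.sum fun σ _ ↦ ?_
    have : ContDiff ℝ ∞ fun A ↦ ∏ k, B A (σ k) k := contDiff_prod fun k _ ↦ hB _ _
    rcases Int.units_eq_one_or (Equiv.Perm.sign σ) with h | h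
    · simpa [h] using this
    · simpa [h] using this.neg
  have hentry (i j : ι) : ContDiff ℝ ∞ fun A : ι → ι → 𝕜 ↦ A i j := contDiff_apply_apply _ _ _ _
  have h1 : ContDiff ℝ ∞ fun A : ι → ι → 𝕜 ↦ (Matrix.of A).adjugate i j := by
    simp_rw [Matrix.adjugate_apply]
    refine hdet fun k l ↦ ?_
    by_cases hk : k = j
    · subst hk; simpa using contDiff_const
    · simpa [Matrix.updateRow_ne hk] using hentry k l
  have h2 : ContDiff ℝ ∞ fun A : ι → ι → 𝕜 ↦ (Matrix.of A).det := hdet hentry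
  simp_rw [Matrix.inv_def, Matrix.smul_apply, Ring.inverse_eq_inv', smul_eq_mul]
  exact (h2.contDiffAt.inv hA).mul h1.contDiffAt

variable {n : ℕ} {M : Type*} [TopologicalSpace M] [ChartedSpace (EuclideanSpace ℝ (Fin n)) M]
  {F : Type*} [NormedAddCommGroup F]
  {E : M → Type*} [TopologicalSpace (TotalSpace F E)]

/-- A section that is smooth near a point agrees near this point with a global smooth section. -/
theorem exists_contMDiff_section_eventuallyEq [T2Space M] [IsManifold (𝓡 n) ∞ M]
    [NormedSpace ℝ F] [∀ x, AddCommGroup (E x)]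
    [∀ x, Module ℝ (E x)] [∀ x, TopologicalSpace (E x)] [FiberBundle F E] [VectorBundle ℝ F E]
    [∀ x, IsTopologicalAddGroup (E x)] [∀ x, ContinuousSMul ℝ (E x)]
    {σ : ∀ x, E x} {x₀ : M}
    (hσ : ∀ᶠ x in 𝓝 x₀, ContMDiffAt (𝓡 n) ((𝓡 n).prod 𝓘(ℝ, F)) ∞
      (fun x ↦ TotalSpace.mk' F x (σ x)) x) :
    ∃ σ' : ∀ x, E x, ContMDiff (𝓡 n) ((𝓡 n).prod 𝓘(ℝ, F)) ∞
      (fun x ↦ TotalSpace.mk' F x (σ' x)) ∧ ∀ᶠ x in 𝓝 x₀, σ' x = σ x := by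
  obtain ⟨U, hU, hUo, hxU⟩ := eventually_nhds_iff.1 hσ
  obtain ⟨ψ, -, hψ⟩ := (SmoothBumpFunction.nhds_basis_tsupport (I := 𝓡 n) x₀).mem_iff.1
    (hUo.mem_nhds hxU)
  refine ⟨(ψ : M → ℝ) • σ, ContMDiffOn.smul_section_of_tsupport ψ.contMDiff.contMDiffOn hUo hψ
    fun x hx ↦ (hU x hx).contMDiffWithinAt, ?_⟩
  filter_upwards [ψ.eventuallyEq_one] with x hx
  simp [hx]

variable {𝕜 : Type*} [RCLike 𝕜]

section Scalars

variable [NormedSpace ℝ F] [NormedSpace 𝕜 F]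
  [∀ x, AddCommGroup (E x)] [∀ x, TopologicalSpace (E x)]
  [∀ x, Module ℝ (E x)] [∀ x, Module 𝕜 (E x)]
  [FiberBundle F E] [VectorBundle 𝕜 F E] [VectorBundle ℝ F E]

theorem contMDiffAt_smul_section_of_isScalarTower [IsScalarTower ℝ 𝕜 F]
    {c : M → 𝕜} {σ : ∀ x, E x} {x₀ : M}
    (hc : ContMDiffAt (𝓡 n) 𝓘(ℝ, 𝕜) ∞ c x₀)
    (hσ : ContMDiffAt (𝓡 n) ((𝓡 n).prod 𝓘(ℝ, F)) ∞ (fun x ↦ TotalSpace.mk' F x (σ x)) x₀) :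
    ContMDiffAt (𝓡 n) ((𝓡 n).prod 𝓘(ℝ, F)) ∞ (fun x ↦ TotalSpace.mk' F x (c x • σ x)) x₀ := by
  rw [contMDiffAt_section] at hσ ⊢
  have hb : ContDiff ℝ ∞ fun p : 𝕜 × F ↦ p.1 • p.2 :=
    (isBoundedBilinearMap_smul (𝕜 := ℝ) (A := 𝕜) (E := F)).contDiff
  have h1 : ContMDiffAt (𝓡 n) 𝓘(ℝ, F) ∞
      (fun x ↦ c x • (trivializationAt F E x₀ ⟨x, σ x⟩).2) x₀ :=
    hb.contDiffAt.contMDiffAt.comp x₀ (hc.prodMk_space hσ)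
  refine h1.congr_of_eventuallyEq ?_
  filter_upwards [(trivializationAt F E x₀).open_baseSet.mem_nhds
    (FiberBundle.mem_baseSet_trivializationAt' x₀)] with x hx
  exact ((trivializationAt F E x₀).linear 𝕜 hx).map_smul _ _

end Scalars

variable [NormedSpace ℝ F] [NormedSpace 𝕜 F] [IsScalarTower ℝ 𝕜 F] [FiniteDimensional 𝕜 F]
  [∀ x, NormedAddCommGroup (E x)]
  [∀ x, InnerProductSpace 𝕜 (E x)]
  [∀ x, Module ℝ (E x)] [∀ x, ContinuousSMul ℝ (E x)]
  [FiberBundle F E] [VectorBundle 𝕜 F E] [VectorBundle ℝ F E] [IsManifold (𝓡 n) ∞ M]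
  [ContMDiffVectorBundle ∞ F E (𝓡 n)]

/-- Near every point there are global smooth sections `sᵢ`, `tᵢ` such that `v = ∑ (tᵢ, v) sᵢ`:
a local frame and its dual frame, which depends smoothly on the point by Cramer's rule. -/
theorem exists_smooth_dual_frames [T2Space M]
    (hE : ∀ σ τ : ∀ x, E x,
      ContMDiff (𝓡 n) ((𝓡 n).prod 𝓘(ℝ, F)) ∞ (fun x ↦ TotalSpace.mk' F x (σ x)) →
      ContMDiff (𝓡 n) ((𝓡 n).prod 𝓘(ℝ, F)) ∞ (fun x ↦ TotalSpace.mk' F x (τ x)) →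
      ContMDiff (𝓡 n) 𝓘(ℝ, 𝕜) ∞ (fun x ↦ (inner 𝕜 (σ x) (τ x) : 𝕜))) (x₀ : M) :
    ∃ (m : ℕ) (s t : Fin m → ∀ x, E x),
      (∀ i, ContMDiff (𝓡 n) ((𝓡 n).prod 𝓘(ℝ, F)) ∞ (fun x ↦ TotalSpace.mk' F x (s i x))) ∧
      (∀ i, ContMDiff (𝓡 n) ((𝓡 n).prod 𝓘(ℝ, F)) ∞ (fun x ↦ TotalSpace.mk' F x (t i x))) ∧
      ∀ᶠ x in 𝓝 x₀, ∀ v : E x, v = ∑ i, inner 𝕜 (t i x) v • s i x := by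
  set e := trivializationAt F E x₀
  let b := Module.finBasis 𝕜 F
  have hx₀ : x₀ ∈ e.baseSet := FiberBundle.mem_baseSet_trivializationAt' x₀
  have he : ∀ᶠ x in 𝓝 x₀, x ∈ e.baseSet := e.open_baseSet.mem_nhds hx₀
  have hs (i : Fin _) : ContMDiffOn (𝓡 n) ((𝓡 n).prod 𝓘(ℝ, F)) ∞
      (fun x ↦ TotalSpace.mk' F x (e.symm x (b i))) e.baseSet := by
    rw [e.contMDiffOn_section_baseSet_iff]
    refine (contMDiffOn_const (c := b i)).congr fun y hy ↦ ?_
    rw [e.apply_mk_symm hy]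
  choose s hsm hse using fun i ↦ exists_contMDiff_section_eventuallyEq
    (he.mono fun x hx ↦ (hs i).contMDiffAt (e.open_baseSet.mem_nhds hx))
  have hbasis : ∀ᶠ x in 𝓝 x₀, LinearIndependent 𝕜 (s · x) ∧
      ⊤ ≤ Submodule.span 𝕜 (range (s · x)) := by
    filter_upwards [he, eventually_all.2 hse] with x hx hsx
    have : (s · x) = b.map (e.linearEquivAt (R := 𝕜) x hx).symm := by
      ext i
      rw [hsx i, Module.Basis.map_apply, Trivialization.linearEquivAt_symm_apply]
    rw [this]
    exact ⟨Module.Basis.linearIndependent _, (Module.Basis.span_eq _).ge⟩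
  let A : M → Fin _ → Fin _ → 𝕜 := fun x i j ↦ inner 𝕜 (s i x) (s j x)
  have hA : ContMDiff (𝓡 n) 𝓘(ℝ, Fin _ → Fin _ → 𝕜) ∞ A :=
    contMDiff_pi_space.2 fun i ↦ contMDiff_pi_space.2 fun j ↦ hE _ _ (hsm i) (hsm j)
  have hT (i : Fin _) : ∀ᶠ x in 𝓝 x₀, ContMDiffAt (𝓡 n) ((𝓡 n).prod 𝓘(ℝ, F)) ∞
      (fun x ↦ TotalSpace.mk' F x (∑ j, star ((Matrix.gram 𝕜 (s · x))⁻¹ i j) • s j x)) x := by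
    filter_upwards [hbasis] with x hx
    have hdet : (Matrix.gram 𝕜 (s · x)).det ≠ 0 :=
      Matrix.det_gram_ne_zero_iff_linearIndependent.2 hx.1
    refine ContMDiffAt.sum_section fun j _ ↦ ?_
    refine contMDiffAt_smul_section_of_isScalarTower ?_ (hsm j x)
    have h1 : ContMDiffAt (𝓡 n) 𝓘(ℝ, 𝕜) ∞ (fun x ↦ (Matrix.gram 𝕜 (s · x))⁻¹ i j) x :=
      (contDiffAt_matrix_inv_apply (A := A x) hdet i j).contMDiffAt.comp x (hA x)
    exact (RCLike.conjCLE (K := 𝕜)).contDiff.contDiffAt.contMDiffAt.comp x h1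
  choose t htm hte using fun i ↦ exists_contMDiff_section_eventuallyEq (hT i)
  refine ⟨_, s, t, hsm, htm, ?_⟩
  filter_upwards [hbasis, eventually_all.2 hte] with x hx htx v
  simp_rw [htx]
  exact eq_sum_inner_gram_inv_smul hx.1 hx.2 v

end DualFrames

/-! ### Smooth vector fields and the Levi-Civita connection -/

section LeviCivita

open Filter Topology VectorField

variable {n : ℕ} {M : Type*} [TopologicalSpace M] [ChartedSpace (EuclideanSpace ℝ (Fin n)) M]
  [IsManifold (𝓡 n) ∞ M]

/-- Differentiability of a vector field at a point. -/
abbrev DifferentiableVectorFieldAt (X : ∀ x : M, TangentSpace (𝓡 n) x) (x : M) : Prop :=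
  MDifferentiableAt (𝓡 n) ((𝓡 n).prod (𝓡 n))
    (fun y ↦ TotalSpace.mk' (EuclideanSpace ℝ (Fin n)) y (X y)) x

theorem IsSmoothVectorField.differentiableAt {X : ∀ x : M, TangentSpace (𝓡 n) x}
    (hX : IsSmoothVectorField X) (x : M) : DifferentiableVectorFieldAt X x :=
  (hX x).mdifferentiableAt (by simp)

/-- The derivative of a smooth function along a smooth vector field is smooth. -/
theorem IsSmoothVectorField.contMDiff_mvfderiv {G : Type*} [NormedAddCommGroup G] [NormedSpace ℝ G]
    {X : ∀ x : M, TangentSpace (𝓡 n) x} (hX : IsSmoothVectorField X) {f : M → G}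
    (hf : ContMDiff (𝓡 n) 𝓘(ℝ, G) ∞ f) :
    ContMDiff (𝓡 n) 𝓘(ℝ, G) ∞ (fun x ↦ mvfderiv (𝓡 n) f x (X x)) := by
  have h1 : ContMDiff (𝓡 n).tangent 𝓘(ℝ, G).tangent ∞ (tangentMap (𝓡 n) 𝓘(ℝ, G) f) :=
    hf.contMDiff_tangentMap (by simp)
  have h2 := h1.comp hX
  exact (contMDiff_snd_tangentBundle_modelSpace G 𝓘(ℝ, G)).comp h2

/-- Every coordinate vector field extends, near every point of the chart, to a global smooth vector
field. -/
theorem exists_isSmoothVectorField_eventuallyEq_chartVector [T2Space M]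
    {e : OpenPartialHomeomorph M (EuclideanSpace ℝ (Fin n))}
    (he : e ∈ atlas (EuclideanSpace ℝ (Fin n)) M) {y₀ : EuclideanSpace ℝ (Fin n)}
    (hy₀ : y₀ ∈ e.target) (v : EuclideanSpace ℝ (Fin n)) :
    ∃ X : ∀ x : M, TangentSpace (𝓡 n) x, IsSmoothVectorField X ∧
      ∀ᶠ y in 𝓝 y₀, X (e.symm y) = chartVector e y v := by
  have hes : ContMDiffOn (𝓡 n) (𝓡 n) ∞ e e.source :=
    contMDiffOn_of_mem_maximalAtlas (IsManifold.subset_maximalAtlas he)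
  have hes' : ContMDiffOn (𝓡 n) (𝓡 n) ∞ e.symm e.target :=
    contMDiffOn_symm_of_mem_maximalAtlas (IsManifold.subset_maximalAtlas he)
  have hd : ContMDiffOn (𝓡 n).tangent (𝓡 n).tangent ∞ (tangentMapWithin (𝓡 n) (𝓡 n) e.symm e.target)
      (TotalSpace.proj ⁻¹' e.target) :=
    hes'.contMDiffOn_tangentMapWithin (by simp) e.open_target.uniqueMDiffOn
  let S : M → TangentBundle (𝓡 n) (EuclideanSpace ℝ (Fin n)) := fun x ↦ ⟨e x, v⟩
  have hS : ContMDiffOn (𝓡 n) (𝓡 n).tangent ∞ S e.source := by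
    intro x hx
    rw [Bundle.contMDiffWithinAt_totalSpace]
    exact ⟨hes x hx, by simpa [S] using contMDiffWithinAt_const⟩
  have hc := hd.comp hS (fun x hx ↦ e.map_source hx)
  let σ : ∀ x : M, TangentSpace (𝓡 n) x := fun x ↦ mfderiv (𝓡 n) (𝓡 n) e.symm (e x) v
  have hX (x : M) (hx : x ∈ e.source) : ContMDiffAt (𝓡 n) ((𝓡 n).prod (𝓡 n)) ∞
      (fun x ↦ TotalSpace.mk' (EuclideanSpace ℝ (Fin n)) x (σ x)) x := by
    refine (hc.contMDiffAt (e.open_source.mem_nhds hx)).congr_of_eventuallyEq ?_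
    filter_upwards [e.open_source.mem_nhds hx] with z hz
    simp only [Function.comp, S, tangentMapWithin]
    rw [mfderivWithin_of_mem_nhds (e.open_target.mem_nhds (e.map_source hz))]
    exact congrArg (fun w : M ↦ (⟨w, mfderiv (𝓡 n) (𝓡 n) e.symm (e z) v⟩ :
      TotalSpace (EuclideanSpace ℝ (Fin n)) (TangentSpace (𝓡 n) : M → Type _))) (e.left_inv hz).symm
  obtain ⟨X, hXs, hXe⟩ := exists_contMDiff_section_eventuallyEq (x₀ := e.symm y₀)
    (eventually_of_mem (e.open_source.mem_nhds (e.map_target hy₀)) hX)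
  refine ⟨X, hXs, ?_⟩
  filter_upwards [(e.symm.continuousAt hy₀).eventually hXe, e.open_target.mem_nhds hy₀]
    with y hy hyt
  rw [hy]
  change (mfderiv (𝓡 n) (𝓡 n) e.symm (e (e.symm y)) v : EuclideanSpace ℝ (Fin n)) =
    (mfderiv (𝓡 n) (𝓡 n) e.symm y v : EuclideanSpace ℝ (Fin n))
  rw [e.right_inv hyt]

variable [RiemannianBundle (fun x : M ↦ TangentSpace (𝓡 n) x)]

/-- The right hand side of Koszul's formula for `g(∇_X Y, Z)` with vector fields `X`, `Y`, `Z`. -/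
noncomputable def koszulForm (Y X Z : ∀ x : M, TangentSpace (𝓡 n) x) (x : M) : ℝ :=
  (1 / 2 : ℝ) *
    (mvfderiv (𝓡 n) (fun y : M ↦ (inner ℝ (Y y) (Z y) : ℝ)) x (X x)
      + mvfderiv (𝓡 n) (fun y : M ↦ (inner ℝ (X y) (Z y) : ℝ)) x (Y x)
      - mvfderiv (𝓡 n) (fun y : M ↦ (inner ℝ (X y) (Y y) : ℝ)) x (Z x)
      + inner ℝ (mlieBracket (𝓡 n) X Y x) (Z x)
      - inner ℝ (mlieBracket (𝓡 n) X Z x) (Y x)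
      - inner ℝ (mlieBracket (𝓡 n) Y Z x) (X x))

theorem koszul_eq_koszulForm (Y : ∀ x : M, TangentSpace (𝓡 n) x) (x : M)
    (X Z : TangentSpace (𝓡 n) x) :
    koszul Y x X Z = koszulForm Y (FiberBundle.extend (EuclideanSpace ℝ (Fin n)) X)
      (FiberBundle.extend (EuclideanSpace ℝ (Fin n)) Z) x := by
  simp [koszul, koszulForm]

variable [IsContMDiffRiemannianBundle (𝓡 n) ∞ (EuclideanSpace ℝ (Fin n))
    (fun x : M ↦ TangentSpace (𝓡 n) x)]

theorem mdifferentiableAt_inner {X Y : ∀ x : M, TangentSpace (𝓡 n) x} {x : M}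
    (hX : DifferentiableVectorFieldAt X x) (hY : DifferentiableVectorFieldAt Y x) :
    MDifferentiableAt (𝓡 n) 𝓘(ℝ, ℝ) (fun y : M ↦ (inner ℝ (X y) (Y y) : ℝ)) x :=
  have : IsContMDiffRiemannianBundle (𝓡 n) 1 (EuclideanSpace ℝ (Fin n))
      (fun x : M ↦ TangentSpace (𝓡 n) x) :=
    IsContMDiffRiemannianBundle.of_le (n := ∞) (mod_cast le_top)
  MDifferentiableAt.inner_bundle (F := EuclideanSpace ℝ (Fin n))
    (E := fun x : M ↦ TangentSpace (𝓡 n) x) hX hY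

/-- The derivatives of the coefficient function cancel in Koszul's formula. -/
theorem tensorialAt_koszulForm_left {Y Z : ∀ x : M, TangentSpace (𝓡 n) x} {x : M}
    (hY : DifferentiableVectorFieldAt Y x) (hZ : DifferentiableVectorFieldAt Z x) :
    TensorialAt (𝓡 n) (EuclideanSpace ℝ (Fin n)) (fun X ↦ koszulForm Y X Z x) x where
  smul {f X} hf hX := by
    have h1 : (fun y : M ↦ (inner ℝ ((f • X) y) (Z y) : ℝ)) =
        fun y ↦ f y * inner ℝ (X y) (Z y) := by
      ext y; simp [inner_smul_left]
    have h2 : (fun y : M ↦ (inner ℝ ((f • X) y) (Y y) : ℝ)) =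
        fun y ↦ f y * inner ℝ (X y) (Y y) := by
      ext y; simp [inner_smul_left]
    simp only [koszulForm, h1, h2]
    rw [mvfderiv_fun_mul hf (mdifferentiableAt_inner hX hZ),
      mvfderiv_fun_mul hf (mdifferentiableAt_inner hX hY), mlieBracket_smul_left hf hX,
      mlieBracket_smul_left hf hX]
    simp only [Pi.smul_apply', map_smul, smul_eq_mul, add_apply,
      smul_apply, inner_add_left, inner_smul_left, inner_smul_right,
      conj_trivial]
    ring
  add {X X'} hX hX' := by
    have h (W : ∀ x : M, TangentSpace (𝓡 n) x) : (fun y : M ↦ (inner ℝ ((X + X') y) (W y) : ℝ)) =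
        fun y ↦ inner ℝ (X y) (W y) + inner ℝ (X' y) (W y) := by
      ext y; simp [inner_add_left]
    simp only [koszulForm, h]
    rw [mvfderiv_fun_add (mdifferentiableAt_inner hX hZ) (mdifferentiableAt_inner hX' hZ),
      mvfderiv_fun_add (mdifferentiableAt_inner hX hY) (mdifferentiableAt_inner hX' hY),
      mlieBracket_add_left hX hX', mlieBracket_add_left hX hX']
    simp only [Pi.add_apply, map_add, add_apply, inner_add_left,
      inner_add_right]
    ring

theorem tensorialAt_koszulForm_right {Y X : ∀ x : M, TangentSpace (𝓡 n) x} {x : M}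
    (hY : DifferentiableVectorFieldAt Y x) (hX : DifferentiableVectorFieldAt X x) :
    TensorialAt (𝓡 n) (EuclideanSpace ℝ (Fin n)) (fun Z ↦ koszulForm Y X Z x) x where
  smul {f Z} hf hZ := by
    have h (W : ∀ x : M, TangentSpace (𝓡 n) x) :
        (fun y : M ↦ (inner ℝ (W y) ((f • Z) y) : ℝ)) = fun y ↦ f y * inner ℝ (W y) (Z y) := by
      ext y; simp [inner_smul_right]
    simp only [koszulForm, h]
    rw [mvfderiv_fun_mul hf (mdifferentiableAt_inner hX hZ),
      mvfderiv_fun_mul hf (mdifferentiableAt_inner hY hZ), mlieBracket_smul_right hf hZ,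
      mlieBracket_smul_right hf hZ]
    simp only [Pi.smul_apply', map_smul, smul_eq_mul, add_apply,
      smul_apply, inner_add_left, inner_smul_left, inner_smul_right,
      conj_trivial, real_inner_comm (Z x)]
    ring
  add {Z Z'} hZ hZ' := by
    have h (W : ∀ x : M, TangentSpace (𝓡 n) x) : (fun y : M ↦ (inner ℝ (W y) ((Z + Z') y) : ℝ)) =
        fun y ↦ inner ℝ (W y) (Z y) + inner ℝ (W y) (Z' y) := by
      ext y; simp [inner_add_right]
    simp only [koszulForm, h]
    rw [mvfderiv_fun_add (mdifferentiableAt_inner hX hZ) (mdifferentiableAt_inner hX hZ'),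
      mvfderiv_fun_add (mdifferentiableAt_inner hY hZ) (mdifferentiableAt_inner hY hZ'),
      mlieBracket_add_right hZ hZ', mlieBracket_add_right hZ hZ']
    simp only [Pi.add_apply, map_add, add_apply, inner_add_left,
      inner_add_right]
    ring

/-- By tensoriality, Koszul's formula may be evaluated on arbitrary extensions. -/
theorem koszul_apply_eq_koszulForm {Y X Z : ∀ x : M, TangentSpace (𝓡 n) x} {x : M}
    (hY : DifferentiableVectorFieldAt Y x) (hX : DifferentiableVectorFieldAt X x)
    (hZ : DifferentiableVectorFieldAt Z x) :
    koszul Y x (X x) (Z x) = koszulForm Y X Z x := by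
  rw [koszul_eq_koszulForm]
  exact TensorialAt.pointwise₂ (I := 𝓡 n) (F := EuclideanSpace ℝ (Fin n))
    (F' := EuclideanSpace ℝ (Fin n)) (V := fun x : M ↦ TangentSpace (𝓡 n) x)
    (V' := fun x : M ↦ TangentSpace (𝓡 n) x) (Φ := fun X Z ↦ koszulForm Y X Z x)
    (fun τ hτ ↦ tensorialAt_koszulForm_left hY hτ)
    (fun σ hσ ↦ tensorialAt_koszulForm_right hY hσ)
    (FiberBundle.mdifferentiableAt_extend ..) hX (FiberBundle.mdifferentiableAt_extend ..) hZ
    (by simp) (by simp)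

theorem contMDiff_koszulForm {Y X Z : ∀ x : M, TangentSpace (𝓡 n) x} (hY : IsSmoothVectorField Y)
    (hX : IsSmoothVectorField X) (hZ : IsSmoothVectorField Z) :
    ContMDiff (𝓡 n) 𝓘(ℝ, ℝ) ∞ (koszulForm Y X Z) := by
  have hi {A B : ∀ x : M, TangentSpace (𝓡 n) x} (hA : IsSmoothVectorField A)
      (hB : IsSmoothVectorField B) :
      ContMDiff (𝓡 n) 𝓘(ℝ, ℝ) ∞ (fun y : M ↦ (inner ℝ (A y) (B y) : ℝ)) :=
    ContMDiff.inner_bundle (F := EuclideanSpace ℝ (Fin n))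
      (E := fun x : M ↦ TangentSpace (𝓡 n) x) hA hB
  have hm : minSmoothness ℝ 3 ≤ ((⊤ : ℕ∞) : ℕ∞ω) := by
    rw [minSmoothness_of_isRCLikeNormedField]; exact WithTop.coe_le_coe.2 (le_top : (3 : ℕ∞) ≤ ⊤)
  have : IsManifold (𝓡 n) (minSmoothness ℝ 3) M := IsManifold.of_le hm
  have : IsManifold (𝓡 n) (((⊤ : ℕ∞) : ℕ∞ω) + 1) M := ‹IsManifold (𝓡 n) ∞ M›
  have hb {A B : ∀ x : M, TangentSpace (𝓡 n) x} (hA : IsSmoothVectorField A)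
      (hB : IsSmoothVectorField B) : IsSmoothVectorField (mlieBracket (𝓡 n) A B) :=
    ContDiff.mlieBracket_vectorField (m := (⊤ : ℕ∞)) (n := (⊤ : ℕ∞)) hA hB (by simp)
  exact contMDiff_const.mul ((((((hX.contMDiff_mvfderiv (hi hY hZ)).add
    (hY.contMDiff_mvfderiv (hi hX hZ))).sub (hZ.contMDiff_mvfderiv (hi hX hY))).add
    (hi (hb hX hY) hZ)).sub (hi (hb hX hZ) hY)).sub (hi (hb hY hZ) hX))

/-- Near every point there are smooth vector fields `σᵢ`, `τᵢ` such that `v = ∑ g(τᵢ, v) σᵢ`. -/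
theorem exists_smooth_dual_vectorFields [T2Space M] (x₀ : M) :
    ∃ (m : ℕ) (σ τ : Fin m → ∀ x : M, TangentSpace (𝓡 n) x),
      (∀ i, IsSmoothVectorField (σ i)) ∧ (∀ i, IsSmoothVectorField (τ i)) ∧
      ∀ᶠ x in 𝓝 x₀, ∀ v : TangentSpace (𝓡 n) x, v = ∑ i, (inner ℝ (τ i x) v : ℝ) • σ i x :=
  exists_smooth_dual_frames (𝕜 := ℝ) (F := EuclideanSpace ℝ (Fin n))
    (E := fun x : M ↦ TangentSpace (𝓡 n) x)
    (fun _ _ hA hB ↦ ContMDiff.inner_bundle (IB := 𝓡 n) (F := EuclideanSpace ℝ (Fin n))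
      (E := fun x : M ↦ TangentSpace (𝓡 n) x) hA hB) x₀

/-- The covariant derivative of a smooth vector field along a smooth vector field is smooth. -/
theorem IsSmoothVectorField.leviCivita [T2Space M] {Y X : ∀ x : M, TangentSpace (𝓡 n) x}
    (hY : IsSmoothVectorField Y) (hX : IsSmoothVectorField X) :
    IsSmoothVectorField (fun x ↦ leviCivita Y x (X x)) := by
  intro x₀
  obtain ⟨m, σ, τ, hσ, hτ, hστ⟩ := exists_smooth_dual_vectorFields (n := n) x₀
  have hs : ContMDiffAt (𝓡 n) ((𝓡 n).prod (𝓡 n)) ∞ (fun x ↦ TotalSpace.mk'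
      (EuclideanSpace ℝ (Fin n)) x (∑ i, koszulForm Y X (σ i) x • τ i x)) x₀ :=
    ContMDiffAt.sum_section fun i _ ↦
      (contMDiff_koszulForm hY hX (hσ i) x₀).smul_section (hτ i x₀)
  refine hs.congr_of_eventuallyEq ?_
  filter_upwards [hστ] with x hx
  congr 1
  have hlin (Z : TangentSpace (𝓡 n) x) : koszul Y x (X x) Z =
      ∑ i, (inner ℝ (τ i x) Z : ℝ) * koszulForm Y X (σ i) x := by
    have hT := tensorialAt_koszulForm_right (hY.differentiableAt x) (hX.differentiableAt x)
    let L := TensorialAt.mkHom _ x hT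
    have hL {Z : ∀ x : M, TangentSpace (𝓡 n) x} (hZ : DifferentiableVectorFieldAt Z x) :
        L (Z x) = koszul Y x (X x) (Z x) := by
      rw [koszul_apply_eq_koszulForm (hY.differentiableAt x) (hX.differentiableAt x) hZ]
      exact TensorialAt.mkHom_apply hT hZ
    have hZ := hL (FiberBundle.mdifferentiableAt_extend (𝓡 n) (EuclideanSpace ℝ (Fin n)) Z)
    rw [FiberBundle.extend_apply_self] at hZ
    rw [← hZ, hx Z, map_sum]
    refine Finset.sum_congr rfl fun i _ ↦ ?_
    rw [map_smul, hL ((hσ i).differentiableAt x), ← hx Z, smul_eq_mul,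
      koszul_apply_eq_koszulForm (hY.differentiableAt x) (hX.differentiableAt x)
        ((hσ i).differentiableAt x)]
  simp only [NablaSobolev.leviCivita, hlin, Finset.sum_smul]
  rw [Finset.sum_comm]
  refine Finset.sum_congr rfl fun i _ ↦ ?_
  conv_rhs => rw [← (tangentBasis x).sum_repr' (τ i x), Finset.smul_sum]
  refine Finset.sum_congr rfl fun k _ ↦ ?_
  rw [smul_smul, mul_comm, real_inner_comm]

end LeviCivita

/-! ### Metric connections in local frames -/

section Connections

open Filter Topology

variable {n : ℕ} {M : Type*} [TopologicalSpace M] [ChartedSpace (EuclideanSpace ℝ (Fin n)) M]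
  [IsManifold (𝓡 n) ∞ M]
  {F : Type*} [NormedAddCommGroup F] [NormedSpace ℂ F]
  {E : M → Type*} [TopologicalSpace (TotalSpace F E)]
  [∀ x, NormedAddCommGroup (E x)] [∀ x, InnerProductSpace ℂ (E x)]
  [∀ x, FiniteDimensional ℂ (E x)]
  [FiberBundle F E] [VectorBundle ℂ F E] [VectorBundle ℝ F E]
  [ContMDiffVectorBundle ∞ F E (𝓡 n)]
  {cov : CovariantDerivative (𝓡 n) F E}

theorem IsSmoothSection.mdifferentiableAt {σ : ∀ x, E x} (hσ : IsSmoothSection n F σ) (x : M) :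
    MDifferentiableAt (𝓡 n) ((𝓡 n).prod 𝓘(ℝ, F)) (fun x ↦ TotalSpace.mk' F x (σ x)) x :=
  (hσ x).mdifferentiableAt (by simp)

theorem IsSmoothSection.smul {c : M → ℂ} {σ : ∀ x, E x} (hc : ContMDiff (𝓡 n) 𝓘(ℝ, ℂ) ∞ c)
    (hσ : IsSmoothSection n F σ) : IsSmoothSection n F (fun x ↦ c x • σ x) :=
  fun x ↦ contMDiffAt_smul_section_of_isScalarTower (hc x) (hσ x)

theorem IsSmoothSection.sum {ι : Type*} (s : Finset ι) {σ : ι → ∀ x, E x}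
    (hσ : ∀ i, IsSmoothSection n F (σ i)) : IsSmoothSection n F (fun x ↦ ∑ i ∈ s, σ i x) :=
  ContMDiff.sum_section fun i _ ↦ hσ i

theorem exists_isSmoothSection_eventuallyEq_extend [T2Space M] {x : M} (v : E x) :
    ∃ σ, IsSmoothSection n F σ ∧ ∀ᶠ y in 𝓝 x, σ y = FiberBundle.extend F v y := by
  obtain ⟨s, hs, h⟩ := FiberBundle.exists_contMDiffOn_extend (k := ∞) (𝓡 n) F v
  refine exists_contMDiff_section_eventuallyEq ?_
  filter_upwards [eventually_mem_nhds_iff.2 hs] with y hy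
  exact h.contMDiffAt hy

theorem exists_isSmoothSection_apply_eq [T2Space M] {x : M} (v : E x) :
    ∃ σ, IsSmoothSection n F σ ∧ σ x = v := by
  obtain ⟨σ, hσ, h⟩ := exists_isSmoothSection_eventuallyEq_extend (n := n) (F := F) v
  exact ⟨σ, hσ, by simpa using h.self_of_nhds⟩

theorem IsMetricConnection.isSmoothSection_apply (hcov : IsMetricConnection cov) {σ : ∀ x, E x}
    (hσ : IsSmoothSection n F σ) {X : ∀ x : M, TangentSpace (𝓡 n) x} (hX : IsSmoothVectorField X) :
    IsSmoothSection n F (fun x ↦ cov σ x (X x)) := by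
  have h1 := hcov.smooth.contMDiff (σ := σ) (fun x _ ↦ (hσ x).contMDiffWithinAt)
  rw [contMDiffOn_univ] at h1
  exact ContMDiff.clm_bundle_apply (b := fun x : M ↦ x) (F₁ := EuclideanSpace ℝ (Fin n))
    (E₁ := fun x : M ↦ TangentSpace (𝓡 n) x) (F₂ := F) (E₂ := E) h1 hX

theorem cov_add_apply {σ τ : ∀ x, E x} (hσ : IsSmoothSection n F σ) (hτ : IsSmoothSection n F τ)
    (x : M) (X : TangentSpace (𝓡 n) x) :
    cov (fun y ↦ σ y + τ y) x X = cov σ x X + cov τ x X := by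
  have := cov.isCovariantDerivativeOnUniv.add (hσ.mdifferentiableAt x) (hτ.mdifferentiableAt x)
  exact DFunLike.congr_fun this X

theorem cov_congr {σ τ : ∀ x, E x} {x : M}
    (hσ : MDifferentiableAt (𝓡 n) ((𝓡 n).prod 𝓘(ℝ, F)) (fun x ↦ TotalSpace.mk' F x (σ x)) x)
    (hστ : ∀ᶠ y in 𝓝 x, σ y = τ y) : cov σ x = cov τ x := by
  refine cov.isCovariantDerivativeOnUniv.congr_of_eventuallyEq hσ ?_ univ_mem hστ
  exact hσ.congr_of_eventuallyEq (hστ.mono fun y hy ↦ by simp [hy])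

theorem cov_sum_apply {ι : Type*} (s : Finset ι) {σ : ι → ∀ x, E x}
    (hσ : ∀ i, IsSmoothSection n F (σ i)) (x : M) (X : TangentSpace (𝓡 n) x) :
    cov (fun y ↦ ∑ i ∈ s, σ i y) x X = ∑ i ∈ s, cov (σ i) x X := by
  classical
  induction s using Finset.induction_on with
  | empty =>
    simp only [Finset.sum_empty]
    exact DFunLike.congr_fun (cov.isCovariantDerivativeOnUniv.zero (x := x)) X
  | insert i s hi ih =>
    simp_rw [Finset.sum_insert hi]
    rw [cov_add_apply (hσ i) (.sum s hσ), ih]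

/-- The Leibniz rule for complex valued functions. -/
theorem IsMetricConnection.cov_smul (hcov : IsMetricConnection cov) {c : M → ℂ} {σ : ∀ x, E x}
    (hc : ContMDiff (𝓡 n) 𝓘(ℝ, ℂ) ∞ c) (hσ : IsSmoothSection n F σ) (x : M)
    (X : TangentSpace (𝓡 n) x) :
    cov (fun y ↦ c y • σ y) x X = c x • cov σ x X + mvfderiv (𝓡 n) c x X • σ x := by
  have hre : ContMDiff (𝓡 n) 𝓘(ℝ, ℝ) ∞ (fun x ↦ (c x).re) :=
    Complex.reCLM.contDiff.contMDiff.comp hc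
  have him : ContMDiff (𝓡 n) 𝓘(ℝ, ℝ) ∞ (fun x ↦ (c x).im) :=
    Complex.imCLM.contDiff.contMDiff.comp hc
  have hIσ : IsSmoothSection n F (fun x ↦ Complex.I • σ x) := hσ.smul contMDiff_const
  have h1 : (fun y ↦ c y • σ y) =
      fun y ↦ ((c y).re • σ y) + ((c y).im • (Complex.I • σ y)) := by
    ext y
    conv_lhs => rw [← Complex.re_add_im (c y), add_smul, mul_smul]
    simp only [Complex.coe_smul]
  have hl {f : M → ℝ} (hf : ContMDiff (𝓡 n) 𝓘(ℝ, ℝ) ∞ f) {τ : ∀ x, E x}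
      (hτ : IsSmoothSection n F τ) :
      cov (fun y ↦ f y • τ y) x X = f x • cov τ x X + mvfderiv (𝓡 n) f x X • τ x :=
    DFunLike.congr_fun (cov.isCovariantDerivativeOnUniv.leibniz (hτ.mdifferentiableAt x)
      ((hf x).mdifferentiableAt (by simp))) X
  have hd : (mvfderiv (𝓡 n) c x X : ℂ) = mvfderiv (𝓡 n) (fun x ↦ (c x).re) x X +
      mvfderiv (𝓡 n) (fun x ↦ (c x).im) x X * Complex.I := by
    have hcd : MDifferentiableAt (𝓡 n) 𝓘(ℝ, ℂ) c x := (hc x).mdifferentiableAt (by simp)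
    have hL (L : ℂ →L[ℝ] ℝ) : mvfderiv (𝓡 n) (fun x ↦ L (c x)) x X = L (mvfderiv (𝓡 n) c x X) := by
      have := mfderiv_comp x L.differentiableAt.mdifferentiableAt hcd
      have h2 := DFunLike.congr_fun this X
      simp only [mfderiv_eq_fderiv, ContinuousLinearMap.fderiv] at h2
      exact h2
    have h2 := hL Complex.reCLM
    have h3 := hL Complex.imCLM
    simp only [Complex.reCLM_apply, Complex.imCLM_apply] at h2 h3
    rw [h2, h3, Complex.re_add_im]
  rw [h1, cov_add_apply (cov := cov) (σ := fun y ↦ (c y).re • σ y)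
    (τ := fun y ↦ (c y).im • (Complex.I • σ y)) (ContMDiff.smul_section hre hσ)
    (ContMDiff.smul_section him hIσ), hl hre hσ, hl him hIσ, hcov.complex_linear σ hσ, hd]
  conv_rhs => rw [← Complex.re_add_im (c x)]
  simp only [add_smul, mul_smul, Complex.coe_smul]
  abel

/-- Differentiating the expansion `v = ∑ (tᵢ, v) sᵢ` in a frame and its dual frame. -/
theorem IsMetricConnection.sum_cov_frame_eq_zero [T2Space M] (hE : IsSmoothHermitian n F E)
    (hcov : IsMetricConnection cov) {m : ℕ} {s t : Fin m → ∀ x, E x}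
    (hs : ∀ i, IsSmoothSection n F (s i)) (ht : ∀ i, IsSmoothSection n F (t i)) {x : M}
    (h : ∀ᶠ y in 𝓝 x, ∀ v : E y, v = ∑ i, inner ℂ (t i y) v • s i y)
    (X : TangentSpace (𝓡 n) x) (v : E x) :
    ∑ i, (inner ℂ (t i x) v • cov (s i) x X + inner ℂ (cov (t i) x X) v • s i x) = 0 := by
  obtain ⟨σ, hσ, rfl⟩ := exists_isSmoothSection_apply_eq (n := n) (F := F) v
  have h1 : cov σ x X = ∑ i, cov (fun y ↦ inner ℂ (t i y) (σ y) • s i y) x X := by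
    rw [← cov_sum_apply _ fun i ↦ (hs i).smul (hE _ _ (ht i) hσ)]
    rw [cov_congr (hσ.mdifferentiableAt x) (h.mono fun y hy ↦ hy (σ y))]
  have h2 (i : Fin m) : cov (fun y ↦ inner ℂ (t i y) (σ y) • s i y) x X =
      (inner ℂ (t i x) (σ x) • cov (s i) x X + inner ℂ (cov (t i) x X) (σ x) • s i x) +
        inner ℂ (t i x) (cov σ x X) • s i x := by
    rw [hcov.cov_smul (hE _ _ (ht i) hσ) (hs i), hcov.metric _ _ (ht i) hσ, add_smul, add_assoc]
  simp_rw [h2] at h1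
  rw [Finset.sum_add_distrib, ← h.self_of_nhds (cov σ x X)] at h1
  exact (right_eq_add.1 h1)

theorem exists_smooth_dual_sections [T2Space M] [FiniteDimensional ℂ F]
    (hE : IsSmoothHermitian n F E) (x₀ : M) :
    ∃ (m : ℕ) (s t : Fin m → ∀ x, E x),
      (∀ i, IsSmoothSection n F (s i)) ∧ (∀ i, IsSmoothSection n F (t i)) ∧
      ∀ᶠ x in 𝓝 x₀, ∀ v : E x, v = ∑ i, inner ℂ (t i x) v • s i x :=
  exists_smooth_dual_frames (𝕜 := ℂ) hE x₀

end Connections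

/-! ### The bundle of homomorphisms -/

section Hom

open Filter Topology

variable {n : ℕ} {M : Type*} [TopologicalSpace M] [ChartedSpace (EuclideanSpace ℝ (Fin n)) M]
  [IsManifold (𝓡 n) ∞ M]
  {F : Type*} [NormedAddCommGroup F] [NormedSpace ℂ F]
  {E : M → Type*} [TopologicalSpace (TotalSpace F E)]
  [∀ x, NormedAddCommGroup (E x)] [∀ x, InnerProductSpace ℂ (E x)]
  [∀ x, FiniteDimensional ℂ (E x)]
  [FiberBundle F E] [VectorBundle ℂ F E] [VectorBundle ℝ F E]
  [ContMDiffVectorBundle ∞ F E (𝓡 n)]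
  {F₁ : Type*} [NormedAddCommGroup F₁] [NormedSpace ℂ F₁]
  {E₁ : M → Type*} [TopologicalSpace (TotalSpace F₁ E₁)]
  [∀ x, NormedAddCommGroup (E₁ x)] [∀ x, InnerProductSpace ℂ (E₁ x)]
  [∀ x, FiniteDimensional ℂ (E₁ x)]
  [FiberBundle F₁ E₁] [VectorBundle ℂ F₁ E₁] [VectorBundle ℝ F₁ E₁]
  [ContMDiffVectorBundle ∞ F₁ E₁ (𝓡 n)]
  {cov : CovariantDerivative (𝓡 n) F E} {cov₁ : CovariantDerivative (𝓡 n) F₁ E₁}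

/-- The homomorphism `φ ⊗ s* : v ↦ (s, v) φ`. -/
noncomputable def rankOne {V W : Type*} [NormedAddCommGroup V] [InnerProductSpace ℂ V]
    [NormedAddCommGroup W] [InnerProductSpace ℂ W] (φ : W) (s : V) : V →L[ℂ] W :=
  (innerSL ℂ s).smulRight φ

@[simp]
theorem rankOne_apply {V W : Type*} [NormedAddCommGroup V] [InnerProductSpace ℂ V]
    [NormedAddCommGroup W] [InnerProductSpace ℂ W] (φ : W) (s v : V) :
    rankOne φ s v = inner ℂ s v • φ := rfl

theorem isSmooth_rankOne (hE : IsSmoothHermitian n F E) {φ : ∀ x, E₁ x} {s : ∀ x, E x}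
    (hφ : IsSmoothSection n F₁ φ) (hs : IsSmoothSection n F s) :
    (hom cov cov₁).IsSmooth (fun x ↦ rankOne (φ x) (s x)) :=
  fun σ hσ ↦ hφ.smul (hE s σ hs hσ)

theorem hom_inner_rankOne (x : M) (φ : E₁ x) (s : E x) (A : E x →L[ℂ] E₁ x) :
    (hom cov cov₁).inner x (rankOne φ s) A = inner ℂ φ (A s) := by
  simp only [hom, rankOne_apply, inner_smul_left, inner_conj_symm]
  conv_rhs => rw [← (stdOrthonormalBasis ℂ (E x)).sum_repr' s]
  simp

/-- The Leibniz rule `∇_X (φ ⊗ s*) = ∇_X φ ⊗ s* + φ ⊗ (∇_X s)*`. -/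
theorem hom_nabla_rankOne [T2Space M] (hE : IsSmoothHermitian n F E) (hcov : IsMetricConnection cov)
    (hcov₁ : IsMetricConnection cov₁) {φ : ∀ x, E₁ x} {s : ∀ x, E x}
    (hφ : IsSmoothSection n F₁ φ) (hs : IsSmoothSection n F s) (x : M)
    (X : TangentSpace (𝓡 n) x) :
    (hom cov cov₁).nabla (fun x ↦ rankOne (φ x) (s x)) x X =
      rankOne (cov₁ φ x X) (s x) + rankOne (φ x) (cov s x X) := by
  have key (v : E x) :
      cov₁ (fun y ↦ rankOne (φ y) (s y) (FiberBundle.extend F v y)) x X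
        - rankOne (φ x) (s x) (cov (FiberBundle.extend F v) x X) =
      (rankOne (cov₁ φ x X) (s x) + rankOne (φ x) (cov s x X)) v := by
    obtain ⟨σ, hσ, hσe⟩ := exists_isSmoothSection_eventuallyEq_extend (n := n) (F := F) v
    have hσx : σ x = v := by simpa using hσe.self_of_nhds
    rw [← cov_congr (cov := cov₁) (((hφ.smul (hE s σ hs hσ))).mdifferentiableAt x)
      (hσe.mono fun y hy ↦ by rw [← hy, rankOne_apply]),
      ← cov_congr (cov := cov) (hσ.mdifferentiableAt x) hσe,
      hcov₁.cov_smul (hE s σ hs hσ) hφ, hcov.metric s σ hs hσ, hσx]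
    simp only [rankOne_apply, add_apply, add_smul]
    abel
  ext v
  simp only [hom, key]
  conv_rhs => rw [← (stdOrthonormalBasis ℂ (E x)).sum_repr' v]
  simp [map_sum]

theorem rankOne_sum_eq {V W : Type*} [NormedAddCommGroup V] [InnerProductSpace ℂ V]
    [NormedAddCommGroup W] [InnerProductSpace ℂ W] {m m₁ : ℕ} {s t : Fin m → V} {s₁ t₁ : Fin m₁ → W}
    (h : ∀ v, v = ∑ i, inner ℂ (t i) v • s i) (h₁ : ∀ v, v = ∑ i, inner ℂ (t₁ i) v • s₁ i)
    (A : V →L[ℂ] W) :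
    A = ∑ k : Fin m₁ × Fin m, inner ℂ (t₁ k.1) (A (s k.2)) • rankOne (s₁ k.1) (t k.2) := by
  ext v
  rw [Fintype.sum_prod_type_right]
  conv_lhs => rw [h v, map_sum]
  simp only [map_smul, sum_apply, smul_apply, rankOne_apply]
  refine Finset.sum_congr rfl fun i _ ↦ ?_
  conv_lhs => rw [h₁ (A (s i)), Finset.smul_sum]
  exact Finset.sum_congr rfl fun j _ ↦ smul_comm _ _ _

end Hom

/-! ### Hermitian bundles with smooth frames -/

section Frames

open Filter Topology

variable {n : ℕ} {M : Type*} [TopologicalSpace M] [ChartedSpace (EuclideanSpace ℝ (Fin n)) M]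

/-- The properties of the inner products and of the smooth sections of a Hermitian bundle on which
the local description of its Sobolev spaces rests: the forms `(·,·)` are inner products, they are
continuous on smooth sections, and near every point there are global smooth sections `sᵢ`, `tᵢ` with
`v = ∑ (tᵢ, v) sᵢ`. -/
structure BundleData.IsHermitian {V : M → Type*} [∀ x, AddCommGroup (V x)] [∀ x, Module ℂ (V x)]
    (B : BundleData n V) : Prop where
  exists_embedding : ∀ x, ∃ (d : ℕ) (T : V x →ₗ[ℂ] EuclideanSpace ℂ (Fin d)),
    ∀ v w, B.inner x v w = Inner.inner ℂ (T v) (T w)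
  continuous_inner : ∀ φ ψ, B.IsSmooth φ → B.IsSmooth ψ → Continuous fun x ↦ B.inner x (φ x) (ψ x)
  exists_frames : ∀ x₀, ∃ (m : ℕ) (s t : Fin m → ∀ x, V x), (∀ i, B.IsSmooth (s i)) ∧
    (∀ i, B.IsSmooth (t i)) ∧ ∀ᶠ x in 𝓝 x₀, ∀ v : V x, v = ∑ i, B.inner x (t i x) v • s i x

namespace BundleData.IsHermitian

variable {V : M → Type*} [∀ x, AddCommGroup (V x)] [∀ x, Module ℂ (V x)] {B : BundleData n V}

theorem inner_add_right (hB : B.IsHermitian) {x : M} (u v w : V x) :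
    B.inner x u (v + w) = B.inner x u v + B.inner x u w := by
  obtain ⟨d, T, hT⟩ := hB.exists_embedding x
  simp [hT]

theorem inner_smul_right (hB : B.IsHermitian) {x : M} (c : ℂ) (u v : V x) :
    B.inner x u (c • v) = c * B.inner x u v := by
  obtain ⟨d, T, hT⟩ := hB.exists_embedding x
  simp [hT]

theorem inner_conj_symm (hB : B.IsHermitian) {x : M} (u v : V x) :
    star (B.inner x u v) = B.inner x v u := by
  obtain ⟨d, T, hT⟩ := hB.exists_embedding x
  simp only [hT]
  exact _root_.inner_conj_symm _ _

theorem inner_sum_right (hB : B.IsHermitian) {x : M} {ι : Type*} (s : Finset ι) (u : V x)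
    (v : ι → V x) : B.inner x u (∑ i ∈ s, v i) = ∑ i ∈ s, B.inner x u (v i) := by
  obtain ⟨d, T, hT⟩ := hB.exists_embedding x
  simp [hT]

theorem inner_neg_right (hB : B.IsHermitian) {x : M} (u v : V x) :
    B.inner x u (-v) = - B.inner x u v := by
  obtain ⟨d, T, hT⟩ := hB.exists_embedding x
  simp [hT]

theorem norm_inner_le (hB : B.IsHermitian) {x : M} (u v : V x) :
    ‖B.inner x u v‖ ≤ √(B.inner x u u).re * √(B.inner x v v).re := by
  obtain ⟨d, T, hT⟩ := hB.exists_embedding x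
  have h (w : V x) : √(B.inner x w w).re = ‖T w‖ := by
    rw [hT]
    exact (norm_eq_sqrt_re_inner (𝕜 := ℂ) (T w)).symm
  rw [h, h, hT]
  exact norm_inner_le_norm _ _

end BundleData.IsHermitian

theorem exists_embedding_euclideanSpace {W : Type*} [NormedAddCommGroup W] [InnerProductSpace ℂ W]
    [FiniteDimensional ℂ W] (k : ℕ) : ∃ (d : ℕ) (T : (Fin k → W) →ₗ[ℂ] EuclideanSpace ℂ (Fin d)),
      ∀ v w, ∑ i, inner ℂ (v i) (w i) = inner ℂ (T v) (T w) := by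
  let b := stdOrthonormalBasis ℂ (PiLp 2 fun _ : Fin k ↦ W)
  refine ⟨_, b.repr.toLinearEquiv.toLinearMap ∘ₗ
    (WithLp.linearEquiv 2 ℂ (Fin k → W)).symm.toLinearMap, fun v w ↦ ?_⟩
  simp [PiLp.inner_apply]

variable [IsManifold (𝓡 n) ∞ M]
  {F : Type*} [NormedAddCommGroup F] [NormedSpace ℂ F] [FiniteDimensional ℂ F]
  {E : M → Type*} [TopologicalSpace (TotalSpace F E)]
  [∀ x, NormedAddCommGroup (E x)] [∀ x, InnerProductSpace ℂ (E x)]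
  [∀ x, FiniteDimensional ℂ (E x)]
  [FiberBundle F E] [VectorBundle ℂ F E] [VectorBundle ℝ F E]
  [ContMDiffVectorBundle ∞ F E (𝓡 n)]
  {F₁ : Type*} [NormedAddCommGroup F₁] [NormedSpace ℂ F₁] [FiniteDimensional ℂ F₁]
  {E₁ : M → Type*} [TopologicalSpace (TotalSpace F₁ E₁)]
  [∀ x, NormedAddCommGroup (E₁ x)] [∀ x, InnerProductSpace ℂ (E₁ x)]
  [∀ x, FiniteDimensional ℂ (E₁ x)]
  [FiberBundle F₁ E₁] [VectorBundle ℂ F₁ E₁] [VectorBundle ℝ F₁ E₁]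
  [ContMDiffVectorBundle ∞ F₁ E₁ (𝓡 n)]
  {cov : CovariantDerivative (𝓡 n) F E} {cov₁ : CovariantDerivative (𝓡 n) F₁ E₁}

theorem isHermitian_ofBundle [T2Space M] (hE : IsSmoothHermitian n F E) :
    (ofBundle cov).IsHermitian where
  exists_embedding x := by
    let b := stdOrthonormalBasis ℂ (E x)
    exact ⟨_, b.repr.toLinearEquiv.toLinearMap, fun v w ↦ (b.repr.inner_map_map v w).symm⟩
  continuous_inner φ ψ hφ hψ := (hE φ ψ hφ hψ).continuous
  exists_frames x₀ := exists_smooth_dual_sections hE x₀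

theorem isHermitian_hom [T2Space M] (hE : IsSmoothHermitian n F E)
    (hE₁ : IsSmoothHermitian n F₁ E₁) : (hom cov cov₁).IsHermitian where
  exists_embedding x := by
    obtain ⟨d, T, hT⟩ := exists_embedding_euclideanSpace (W := E₁ x) (Module.finrank ℂ (E x))
    refine ⟨d, T ∘ₗ LinearMap.pi fun i ↦
      (ContinuousLinearMap.apply ℂ (E₁ x) (stdOrthonormalBasis ℂ (E x) i)).toLinearMap,
      fun v w ↦ ?_⟩
    simp only [LinearMap.comp_apply, ← hT]
    rfl
  continuous_inner a b ha hb := by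
    rw [continuous_iff_continuousAt]
    intro x₀
    obtain ⟨m, s, t, hs, ht, h⟩ := exists_smooth_dual_sections (n := n) hE x₀
    have hc : Continuous fun x ↦ ∑ i, inner ℂ (a x (t i x)) (b x (s i x)) :=
      continuous_finsetSum _ fun i _ ↦
        (hE₁ _ _ (ha _ (ht i)) (hb _ (hs i))).continuous
    refine hc.continuousAt.congr ?_
    filter_upwards [h] with x hx
    simp only [hom]
    have h1 (α : Fin (Module.finrank ℂ (E x))) : b x (stdOrthonormalBasis ℂ (E x) α) =
        ∑ i, inner ℂ (t i x) (stdOrthonormalBasis ℂ (E x) α) • b x (s i x) := by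
      conv_lhs => rw [hx (stdOrthonormalBasis ℂ (E x) α)]
      simp
    simp_rw [h1, inner_sum, _root_.inner_smul_right]
    rw [Finset.sum_comm]
    refine Finset.sum_congr rfl fun i _ ↦ ?_
    conv_lhs => rw [← (stdOrthonormalBasis ℂ (E x)).sum_repr' (t i x)]
    simp [mul_comm]
  exists_frames x₀ := by
    obtain ⟨m, s, t, hs, ht, h⟩ := exists_smooth_dual_sections (n := n) hE x₀
    obtain ⟨m₁, s₁, t₁, hs₁, ht₁, h₁⟩ := exists_smooth_dual_sections (n := n) hE₁ x₀
    let k := (Fintype.equivFin (Fin m₁ × Fin m)).symm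
    refine ⟨_, fun i x ↦ rankOne (s₁ (k i).1 x) (t (k i).2 x),
      fun i x ↦ rankOne (t₁ (k i).1 x) (s (k i).2 x),
      fun i ↦ isSmooth_rankOne hE (hs₁ _) (ht _),
      fun i ↦ isSmooth_rankOne hE (ht₁ _) (hs _), ?_⟩
    filter_upwards [h, h₁] with x hx hx₁ A
    simp only [hom_inner_rankOne]
    rw [k.sum_comp fun k ↦ inner ℂ (t₁ k.1 x) (A (s k.2 x)) • rankOne (s₁ k.1 x) (t k.2 x)]
    exact rankOne_sum_eq hx hx₁ A

end Frames

/-! ### The norms of tensors -/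

section TensorNorm

variable {W H : Type*} [NormedAddCommGroup W] [InnerProductSpace ℝ W]
  [NormedAddCommGroup H] [InnerProductSpace ℂ H] {j m : ℕ} {κ : Type*} [Fintype κ]

/-- Expansion of a multilinear map in a frame. -/
theorem multilinearMap_apply_eq_sum_frame {N : Type*} [AddCommGroup N] [Module ℝ N]
    (w : MultilinearMap ℝ (fun _ : Fin j ↦ W) N) {s t : κ → W}
    (h : ∀ v, v = ∑ i, (inner ℝ (t i) v : ℝ) • s i) (v : Fin j → W) :
    w v = ∑ k : Fin j → κ, (∏ i, (inner ℝ (t (k i)) (v i) : ℝ)) • w fun i ↦ s (k i) := by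
  classical
  conv_lhs => rw [show v = fun i ↦ ∑ a, (inner ℝ (t a) (v i) : ℝ) • s a from funext fun i ↦ h (v i)]
  rw [MultilinearMap.map_sum]
  exact Finset.sum_congr rfl fun k _ ↦ MultilinearMap.map_smul_univ _ _ _

theorem sum_prod_mul_eq_prod_inner (b : OrthonormalBasis κ ℝ W) (v v' : Fin j → W) :
    ∑ k : Fin j → κ, (∏ i, (inner ℝ (v i) (b (k i)) : ℝ)) * ∏ i, (inner ℝ (v' i) (b (k i)) : ℝ) =
      ∏ i, (inner ℝ (v i) (v' i) : ℝ) := by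
  classical
  simp_rw [← Finset.prod_mul_distrib]
  rw [← Fintype.piFinset_univ, ← Finset.prod_univ_sum (fun _ ↦ Finset.univ)
    (fun i k ↦ (inner ℝ (v i) (b k) : ℝ) * inner ℝ (v' i) (b k))]
  refine Finset.prod_congr rfl fun i _ ↦ ?_
  rw [← b.sum_inner_mul_inner (v i) (v' i)]
  exact Finset.sum_congr rfl fun k _ ↦ by rw [real_inner_comm (v' i)]

/-- The sum `∑ |w(b_k)|²` over an orthonormal basis, in terms of an arbitrary frame. -/
theorem sum_inner_orthonormalBasis_eq {ι : Type*} [Fintype ι]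
    (w : MultilinearMap ℝ (fun _ : Fin j ↦ W) H) (b : OrthonormalBasis κ ℝ W) {s t : ι → W}
    (h : ∀ v, v = ∑ i, (inner ℝ (t i) v : ℝ) • s i) :
    ∑ k : Fin j → κ, (inner ℂ (w fun i ↦ b (k i)) (w fun i ↦ b (k i)) : ℂ) =
      ∑ a : Fin j → ι, ∑ a' : Fin j → ι, ((∏ i, (inner ℝ (t (a i)) (t (a' i)) : ℝ) : ℝ) : ℂ) *
        inner ℂ (w fun i ↦ s (a i)) (w fun i ↦ s (a' i)) := by
  have h1 (k : Fin j → κ) : (inner ℂ (w fun i ↦ b (k i)) (w fun i ↦ b (k i)) : ℂ) =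
      ∑ a : Fin j → ι, ∑ a' : Fin j → ι, (((∏ i, (inner ℝ (t (a i)) (b (k i)) : ℝ)) *
        (∏ i, (inner ℝ (t (a' i)) (b (k i)) : ℝ)) : ℝ) : ℂ) *
        inner ℂ (w fun i ↦ s (a i)) (w fun i ↦ s (a' i)) := by
    rw [multilinearMap_apply_eq_sum_frame w h]
    rw [sum_inner]
    refine Finset.sum_congr rfl fun a _ ↦ ?_
    rw [inner_sum]
    refine Finset.sum_congr rfl fun a' _ ↦ ?_
    rw [← Complex.coe_smul, ← Complex.coe_smul, inner_smul_left, inner_smul_right, ← mul_assoc,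
      Complex.conj_ofReal, Complex.ofReal_mul]
  simp_rw [h1]
  rw [Finset.sum_comm]
  refine Finset.sum_congr rfl fun a _ ↦ ?_
  rw [Finset.sum_comm]
  refine Finset.sum_congr rfl fun a' _ ↦ ?_
  rw [← Finset.sum_mul, ← Complex.ofReal_sum, sum_prod_mul_eq_prod_inner b]

/-- The operator norm of a multilinear map is at most its Hilbert–Schmidt norm. -/
theorem norm_multilinearMap_apply_le (w : MultilinearMap ℝ (fun _ : Fin j ↦ W) H)
    (b : OrthonormalBasis κ ℝ W) (v : Fin j → W) :
    ‖w v‖ ≤ √(∑ k : Fin j → κ, ‖w fun i ↦ b (k i)‖ ^ 2) * ∏ i, ‖v i‖ := by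
  have hb : ∀ v, v = ∑ i, (inner ℝ (b i) v : ℝ) • b i := fun v ↦ (b.sum_repr' v).symm
  rw [multilinearMap_apply_eq_sum_frame w hb v]
  calc _ ≤ ∑ k : Fin j → κ, |∏ i, (inner ℝ (b (k i)) (v i) : ℝ)| * ‖w fun i ↦ b (k i)‖ := by
        refine (norm_sum_le _ _).trans (Finset.sum_le_sum fun k _ ↦ ?_)
        rw [norm_smul, Real.norm_eq_abs]
    _ ≤ √(∑ k : Fin j → κ, |∏ i, (inner ℝ (b (k i)) (v i) : ℝ)| ^ 2) *
        √(∑ k : Fin j → κ, ‖w fun i ↦ b (k i)‖ ^ 2) := Real.sum_mul_le_sqrt_mul_sqrt _ _ _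
    _ = _ := by
        rw [mul_comm]
        congr 1
        have : ∑ k : Fin j → κ, |∏ i, (inner ℝ (b (k i)) (v i) : ℝ)| ^ 2 = (∏ i, ‖v i‖) ^ 2 := by
          simp_rw [sq_abs, sq, real_inner_comm (v _)]
          rw [sum_prod_mul_eq_prod_inner b, ← Finset.prod_mul_distrib]
          simp_rw [real_inner_self_eq_norm_mul_norm]
        rw [this, Real.sqrt_sq (Finset.prod_nonneg fun i _ ↦ norm_nonneg _)]

end TensorNorm

section TensorNormBundle

open Filter Topology

variable {n : ℕ} {M : Type*} [TopologicalSpace M] [ChartedSpace (EuclideanSpace ℝ (Fin n)) M]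
  [IsManifold (𝓡 n) ∞ M]
  [RiemannianBundle (fun x : M ↦ TangentSpace (𝓡 n) x)]
  {V : M → Type*} [∀ x, AddCommGroup (V x)] [∀ x, Module ℂ (V x)] {B : BundleData n V} {j : ℕ}

theorem tensorNorm_nonneg {x : M} (w : Tensor n V j x) : 0 ≤ tensorNorm B w := Real.sqrt_nonneg _

/-- The tensor norm is the Hilbert–Schmidt norm after an isometric embedding of the fibre. -/
theorem tensorNorm_eq_sqrt_sum {x : M} {d : ℕ} {T : V x →ₗ[ℂ] EuclideanSpace ℂ (Fin d)}
    (hT : ∀ v w, B.inner x v w = inner ℂ (T v) (T w)) (w : Tensor n V j x) :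
    tensorNorm B w = √(∑ k : Fin j → Fin (Module.finrank ℝ (TangentSpace (𝓡 n) x)),
      ‖T (w fun i ↦ tangentBasis x (k i))‖ ^ 2) := by
  simp only [tensorNorm, hT]
  congr 1
  refine Finset.sum_congr rfl fun k _ ↦ ?_
  exact (norm_sq_eq_re_inner (𝕜 := ℂ) _).symm

theorem tensorNorm_eq_norm_toLp {x : M} {d : ℕ} {T : V x →ₗ[ℂ] EuclideanSpace ℂ (Fin d)}
    (hT : ∀ v w, B.inner x v w = inner ℂ (T v) (T w)) (w : Tensor n V j x) :
    tensorNorm B w = ‖WithLp.toLp 2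
      (fun k : Fin j → Fin (Module.finrank ℝ (TangentSpace (𝓡 n) x)) ↦
        T (w fun i ↦ tangentBasis x (k i)))‖ := by
  rw [tensorNorm_eq_sqrt_sum hT, PiLp.norm_eq_of_L2]

theorem tensorNorm_add_le (hB : B.IsHermitian) {x : M} (w w' : Tensor n V j x) :
    tensorNorm B (w + w') ≤ tensorNorm B w + tensorNorm B w' := by
  obtain ⟨d, T, hT⟩ := hB.exists_embedding x
  simp_rw [tensorNorm_eq_norm_toLp hT]
  refine le_trans (le_of_eq ?_) (norm_add_le _ _)
  congr 1
  ext k : 1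
  simp

theorem tensorNorm_neg (hB : B.IsHermitian) {x : M} (w : Tensor n V j x) :
    tensorNorm B (-w) = tensorNorm B w := by
  obtain ⟨d, T, hT⟩ := hB.exists_embedding x
  simp [tensorNorm_eq_sqrt_sum hT]

theorem tensorNorm_zero (hB : B.IsHermitian) {x : M} :
    tensorNorm B (0 : Tensor n V j x) = 0 := by
  obtain ⟨d, T, hT⟩ := hB.exists_embedding x
  simp [tensorNorm_eq_sqrt_sum hT]

theorem tensorNorm_sum_le (hB : B.IsHermitian) {x : M} {ι : Type*} (s : Finset ι)
    (w : ι → Tensor n V j x) : tensorNorm B (∑ i ∈ s, w i) ≤ ∑ i ∈ s, tensorNorm B (w i) := by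
  classical
  induction s using Finset.induction_on with
  | empty => simp [tensorNorm_zero hB]
  | insert i s hi ih =>
    rw [Finset.sum_insert hi, Finset.sum_insert hi]
    exact (tensorNorm_add_le hB _ _).trans (by gcongr)

theorem norm_inner_tensor_apply_le (hB : B.IsHermitian) {x : M} (w : Tensor n V j x) (φ : V x)
    (v : Fin j → TangentSpace (𝓡 n) x) :
    ‖B.inner x φ (w v)‖ ≤ √(B.inner x φ φ).re * (∏ i, ‖v i‖) * tensorNorm B w := by
  refine (hB.norm_inner_le _ _).trans ?_
  rw [mul_assoc]
  gcongr
  obtain ⟨d, T, hT⟩ := hB.exists_embedding x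
  have h1 : √(B.inner x (w v) (w v)).re = ‖T (w v)‖ := by
    rw [hT]
    exact (norm_eq_sqrt_re_inner (𝕜 := ℂ) _).symm
  rw [h1, tensorNorm_eq_sqrt_sum hT, mul_comm]
  exact norm_multilinearMap_apply_le ((T.restrictScalars ℝ).compMultilinearMap w)
    (tangentBasis x) v

/-- The tensor norm in terms of components with respect to frames. -/
theorem tensorNorm_eq_sqrt_sum_frame (hB : B.IsHermitian) {x : M} {m m' : ℕ}
    {σ τ : Fin m → TangentSpace (𝓡 n) x} {s t : Fin m' → V x}
    (hσ : ∀ v, v = ∑ i, (inner ℝ (τ i) v : ℝ) • σ i) (hs : ∀ v, v = ∑ i, B.inner x (t i) v • s i)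
    (w : Tensor n V j x) :
    tensorNorm B w = √(∑ a : Fin j → Fin m, ∑ a' : Fin j → Fin m,
      ((∏ i, (inner ℝ (τ (a i)) (τ (a' i)) : ℝ) : ℝ) : ℂ) *
        ∑ k, B.inner x (t k) (w fun i ↦ σ (a' i)) *
          star (B.inner x (s k) (w fun i ↦ σ (a i)))).re := by
  obtain ⟨d, T, hT⟩ := hB.exists_embedding x
  rw [tensorNorm, ← Complex.re_sum]
  congr 2
  simp only [hT]
  have := sum_inner_orthonormalBasis_eq ((T.restrictScalars ℝ).compMultilinearMap w)
    (tangentBasis x) hσ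
  refine this.trans ?_
  refine Finset.sum_congr rfl fun a _ ↦ Finset.sum_congr rfl fun a' _ ↦ ?_
  congr 1
  simp only [LinearMap.compMultilinearMap_apply, LinearMap.restrictScalars_apply, ← hT]
  conv_lhs => rw [hs (w fun i ↦ σ (a' i)), hB.inner_sum_right]
  simp only [hB.inner_smul_right, hB.inner_conj_symm]

end TensorNormBundle

/-! ### Measurability and local integrability of the components of a section -/

section Components

open Filter Topology

theorem aestronglyMeasurable_of_eventuallyEq_nhds {X Y : Type*} [TopologicalSpace X]
    [SecondCountableTopology X] [MeasurableSpace X] [OpensMeasurableSpace X] [TopologicalSpace Y]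
    [TopologicalSpace.PseudoMetrizableSpace Y] {μ : Measure X} {f : X → Y}
    (h : ∀ x₀, ∃ g : X → Y, AEStronglyMeasurable g μ ∧ ∀ᶠ x in 𝓝 x₀, f x = g x) :
    AEStronglyMeasurable f μ := by
  choose g hg hfg using h
  choose U hU hUo hxU using fun x₀ ↦ eventually_nhds_iff.1 (hfg x₀)
  obtain ⟨S, hS, hSU⟩ := TopologicalSpace.isOpen_iUnion_countable U hUo
  have huniv : ⋃ x, U x = univ := eq_univ_of_forall fun x ↦ mem_iUnion.2 ⟨x, hxU x⟩
  have := hS.to_subtype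
  rw [← Measure.restrict_univ (μ := μ), ← huniv, ← hSU, biUnion_eq_iUnion,
    aestronglyMeasurable_iUnion_iff]
  intro x
  refine (hg x).restrict.congr ?_
  filter_upwards [ae_restrict_mem (hUo x).measurableSet] with y hy
  exact (hU x y hy).symm

variable {n : ℕ} {M : Type*} [TopologicalSpace M] [T2Space M] [SecondCountableTopology M]
  [MeasurableSpace M] [BorelSpace M]
  [ChartedSpace (EuclideanSpace ℝ (Fin n)) M] [IsManifold (𝓡 n) ∞ M]
  [RiemannianBundle (fun x : M ↦ TangentSpace (𝓡 n) x)]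
  [IsContMDiffRiemannianBundle (𝓡 n) ∞ (EuclideanSpace ℝ (Fin n))
    (fun x : M ↦ TangentSpace (𝓡 n) x)]
  {V : M → Type*} [∀ x, AddCommGroup (V x)] [∀ x, Module ℂ (V x)] {B : BundleData n V} {j : ℕ}

theorem IsSmoothVectorField.continuous_inner {X Y : ∀ x : M, TangentSpace (𝓡 n) x}
    (hX : IsSmoothVectorField X) (hY : IsSmoothVectorField Y) :
    Continuous fun x ↦ (inner ℝ (X x) (Y x) : ℝ) :=
  (ContMDiff.inner_bundle (F := EuclideanSpace ℝ (Fin n))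
    (E := fun x : M ↦ TangentSpace (𝓡 n) x) hX hY).continuous

theorem IsMeasurableSection.aestronglyMeasurable_tensorNorm (hB : B.IsHermitian)
    {w : ∀ x : M, Tensor n V j x} (hw : IsMeasurableSection B w) :
    AEStronglyMeasurable (fun x ↦ tensorNorm B (w x)) (riemannianVolume n M) := by
  refine aestronglyMeasurable_of_eventuallyEq_nhds fun x₀ ↦ ?_
  obtain ⟨m, σ, τ, hσ, hτ, h⟩ := exists_smooth_dual_vectorFields (n := n) x₀
  obtain ⟨m', s, t, hs, ht, h'⟩ := hB.exists_frames x₀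
  refine ⟨_, ?_, (h.and h').mono fun x hx ↦ tensorNorm_eq_sqrt_sum_frame hB hx.1 hx.2 (w x)⟩
  refine Real.continuous_sqrt.comp_aestronglyMeasurable
    (Complex.continuous_re.comp_aestronglyMeasurable ?_)
  refine Finset.aestronglyMeasurable_fun_sum _ fun a _ ↦
    Finset.aestronglyMeasurable_fun_sum _ fun a' _ ↦ ?_
  refine AEStronglyMeasurable.mul ?_ (Finset.aestronglyMeasurable_fun_sum _ fun k _ ↦ ?_)
  · have : Continuous fun x ↦ ((∏ i, (inner ℝ (τ (a i) x) (τ (a' i) x) : ℝ) : ℝ) : ℂ) :=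
      Complex.continuous_ofReal.comp
        (continuous_finsetProd _ fun i _ ↦ (hτ (a i)).continuous_inner (hτ (a' i)))
    exact this.aestronglyMeasurable
  · exact (hw _ (ht k) _ fun i ↦ hσ (a' i)).mul
      (continuous_star.comp_aestronglyMeasurable (hw _ (hs k) _ fun i ↦ hσ (a i)))

/-- The coordinate expression of the Riemannian density. -/
noncomputable def chartDensity (e : OpenPartialHomeomorph M (EuclideanSpace ℝ (Fin n)))
    (y : EuclideanSpace ℝ (Fin n)) : ℝ :=
  Real.sqrt (Matrix.det (Matrix.of fun i j : Fin n ↦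
      inner ℝ (chartVector e y (EuclideanSpace.single i 1))
        (chartVector e y (EuclideanSpace.single j 1))))

theorem chartVector_linearIndependent {e : OpenPartialHomeomorph M (EuclideanSpace ℝ (Fin n))}
    (he : e ∈ atlas (EuclideanSpace ℝ (Fin n)) M) {y : EuclideanSpace ℝ (Fin n)}
    (hy : y ∈ e.target) :
    LinearIndependent ℝ fun i : Fin n ↦ chartVector e y (EuclideanSpace.single i 1) := by
  have h1 := (mdifferentiable_of_mem_atlas (I := 𝓡 n) he).symm.mfderiv_injective hy
  have h2 : LinearIndependent ℝ fun i : Fin n ↦ EuclideanSpace.single i (1 : ℝ) := by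
    have := (EuclideanSpace.basisFun (Fin n) ℝ).orthonormal.linearIndependent
    rwa [show ⇑(EuclideanSpace.basisFun (Fin n) ℝ) = fun i ↦ EuclideanSpace.single i (1 : ℝ) from
      funext fun i ↦ EuclideanSpace.basisFun_apply _ _ i] at this
  exact h2.map' (mfderiv (𝓡 n) (𝓡 n) e.symm y).toLinearMap (LinearMap.ker_eq_bot.2 h1)

theorem chartDensity_pos {e : OpenPartialHomeomorph M (EuclideanSpace ℝ (Fin n))}
    (he : e ∈ atlas (EuclideanSpace ℝ (Fin n)) M) {y : EuclideanSpace ℝ (Fin n)}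
    (hy : y ∈ e.target) : 0 < chartDensity e y := by
  refine Real.sqrt_pos.2 ?_
  have h := Matrix.det_gram_ne_zero_iff_linearIndependent.2 (chartVector_linearIndependent he hy)
  exact lt_of_le_of_ne (Matrix.PosSemidef.det_nonneg (Matrix.posSemidef_gram ℝ _)) h.symm

theorem continuousOn_chartDensity {e : OpenPartialHomeomorph M (EuclideanSpace ℝ (Fin n))}
    (he : e ∈ atlas (EuclideanSpace ℝ (Fin n)) M) : ContinuousOn (chartDensity e) e.target := by
  intro y₀ hy₀
  refine ContinuousAt.continuousWithinAt ?_
  refine Real.continuous_sqrt.continuousAt.comp ?_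
  choose X hX hXe using fun i : Fin n ↦
    exists_isSmoothVectorField_eventuallyEq_chartVector he hy₀ (EuclideanSpace.single i 1)
  have h1 : ContinuousAt (fun y ↦ Matrix.det (Matrix.of fun i j : Fin n ↦
      (inner ℝ (X i (e.symm y)) (X j (e.symm y)) : ℝ))) y₀ := by
    have : Continuous fun x : M ↦ Matrix.det (Matrix.of fun i j : Fin n ↦
        (inner ℝ (X i x) (X j x) : ℝ)) :=
      Continuous.matrix_det (continuous_matrix fun i j ↦ (hX i).continuous_inner (hX j))
    exact this.continuousAt.comp (e.symm.continuousAt hy₀)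
  refine h1.congr ?_
  filter_upwards [eventually_all.2 hXe] with y hy
  simp_rw [hy]

theorem chartVolume_le_riemannianVolume {e : OpenPartialHomeomorph M (EuclideanSpace ℝ (Fin n))}
    (he : e ∈ atlas (EuclideanSpace ℝ (Fin n)) M) : chartVolume e ≤ riemannianVolume n M :=
  le_iSup₂_of_le e he le_rfl

/-- The Riemannian measure in the coordinates of a chart. -/
noncomputable def chartMeasure (e : OpenPartialHomeomorph M (EuclideanSpace ℝ (Fin n))) :
    Measure (EuclideanSpace ℝ (Fin n)) :=
  (volume.restrict e.target).withDensity fun y ↦ ENNReal.ofReal (chartDensity e y)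

theorem aemeasurable_symm (e : OpenPartialHomeomorph M (EuclideanSpace ℝ (Fin n))) :
    AEMeasurable e.symm (chartMeasure e) :=
  (e.continuousOn_symm.aemeasurable e.open_target.measurableSet).mono_ac
    (withDensity_absolutelyContinuous _ _)

theorem aestronglyMeasurable_comp_symm_chartMeasure
    {e : OpenPartialHomeomorph M (EuclideanSpace ℝ (Fin n))}
    (he : e ∈ atlas (EuclideanSpace ℝ (Fin n)) M) {Y : Type*} [TopologicalSpace Y]
    {f : M → Y} (hf : AEStronglyMeasurable f (riemannianVolume n M)) :
    AEStronglyMeasurable (fun y ↦ f (e.symm y)) (chartMeasure e) :=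
  (hf.mono_measure (chartVolume_le_riemannianVolume he)).comp_aemeasurable (aemeasurable_symm e)

theorem aestronglyMeasurable_comp_symm {e : OpenPartialHomeomorph M (EuclideanSpace ℝ (Fin n))}
    (he : e ∈ atlas (EuclideanSpace ℝ (Fin n)) M) {Y : Type*} [TopologicalSpace Y]
    {f : M → Y} (hf : AEStronglyMeasurable f (riemannianVolume n M)) :
    AEStronglyMeasurable (fun y ↦ f (e.symm y)) (volume.restrict e.target) := by
  refine (aestronglyMeasurable_comp_symm_chartMeasure he hf).mono_ac ?_
  refine withDensity_absolutelyContinuous' ?_ ?_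
  · exact ((continuousOn_chartDensity he).aemeasurable e.open_target.measurableSet).ennreal_ofReal
  · filter_upwards [ae_restrict_mem e.open_target.measurableSet] with y hy
    simpa using chartDensity_pos he hy

/-- On a compact subset of a chart, Lebesgue measure is dominated by the Riemannian measure. -/
theorem exists_restrict_le_smul_chartMeasure
    {e : OpenPartialHomeomorph M (EuclideanSpace ℝ (Fin n))}
    (he : e ∈ atlas (EuclideanSpace ℝ (Fin n)) M) {K : Set (EuclideanSpace ℝ (Fin n))}
    (hK : IsCompact K) (hKe : K ⊆ e.target) :
    ∃ c : ℝ≥0∞, c ≠ ⊤ ∧ volume.restrict K ≤ c • chartMeasure e := by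
  obtain ⟨δ, hδ, h⟩ : ∃ δ : ℝ, 0 < δ ∧ ∀ y ∈ K, δ ≤ chartDensity e y := by
    rcases K.eq_empty_or_nonempty with rfl | hne
    · exact ⟨1, one_pos, by simp⟩
    · obtain ⟨y, hy, h⟩ := hK.exists_isMinOn hne ((continuousOn_chartDensity he).mono hKe)
      exact ⟨_, chartDensity_pos he (hKe hy), fun z hz ↦ h hz⟩
  have hδ' : ENNReal.ofReal δ ≠ 0 := by simpa using hδ
  refine ⟨(ENNReal.ofReal δ)⁻¹, by simpa using hδ, ?_⟩
  refine Measure.le_iff.2 fun s hs ↦ ?_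
  rw [Measure.smul_apply, smul_eq_mul, ← ENNReal.mul_le_iff_le_inv hδ' ENNReal.ofReal_ne_top,
    chartMeasure, withDensity_apply _ hs, Measure.restrict_restrict hs, Measure.restrict_apply hs]
  calc ENNReal.ofReal δ * volume (s ∩ K) = ∫⁻ _ in s ∩ K, ENNReal.ofReal δ := by simp
    _ ≤ ∫⁻ y in s ∩ K, ENNReal.ofReal (chartDensity e y) :=
        setLIntegral_mono' (hs.inter hK.measurableSet) fun y hy ↦
          ENNReal.ofReal_le_ofReal (h y hy.2)
    _ ≤ _ := lintegral_mono_set (inter_subset_inter_right s hKe)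

/-- In a chart, the components of a section with finite `L^p` norm are locally in `L^p`. -/
theorem memLpLoc_inner_tensor_apply (hB : B.IsHermitian) {w : ∀ x : M, Tensor n V j x}
    (hw : IsMeasurableSection B w) {p : ℝ≥0∞} (hwp : sectionLpNorm B w p < ⊤)
    {φ : ∀ x, V x} (hφ : B.IsSmooth φ) {Y : Fin j → ∀ x : M, TangentSpace (𝓡 n) x}
    (hY : ∀ i, IsSmoothVectorField (Y i)) {e : OpenPartialHomeomorph M (EuclideanSpace ℝ (Fin n))}
    (he : e ∈ atlas (EuclideanSpace ℝ (Fin n)) M) :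
    MemLpLoc (fun y ↦ B.inner _ (φ (e.symm y)) (w (e.symm y) fun i ↦ Y i (e.symm y))) p volume
      e.target := by
  intro K hK hKc
  refine ⟨(aestronglyMeasurable_comp_symm he (hw φ hφ Y hY)).mono_set hK, ?_⟩
  let c : M → ℝ := fun x ↦ √(B.inner x (φ x) (φ x)).re * ∏ i, √(inner ℝ (Y i x) (Y i x))
  have hc : Continuous c :=
    (Real.continuous_sqrt.comp (Complex.continuous_re.comp (hB.continuous_inner φ φ hφ hφ))).mul
      (continuous_finsetProd _ fun i _ ↦ Real.continuous_sqrt.comp ((hY i).continuous_inner (hY i)))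
  obtain ⟨C, hC⟩ := hKc.exists_bound_of_continuousOn
    (f := fun y ↦ c (e.symm y)) (hc.comp_continuousOn (e.continuousOn_symm.mono hK))
  obtain ⟨d, hd, hle⟩ := exists_restrict_le_smul_chartMeasure he hKc hK
  have h1 : eLpNorm (fun y ↦ tensorNorm B (w (e.symm y))) p (volume.restrict K) < ⊤ := by
    have hwm := hw.aestronglyMeasurable_tensorNorm hB
    have h3 : eLpNorm (fun y ↦ tensorNorm B (w (e.symm y))) p (chartMeasure e) < ⊤ := by
      have h4 := eLpNorm_map_measure (p := p)
        (hwm.mono_measure (chartVolume_le_riemannianVolume he)) (aemeasurable_symm e)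
      refine lt_of_le_of_lt (le_of_eq h4.symm) (lt_of_le_of_lt ?_ hwp)
      exact eLpNorm_mono_measure _ (chartVolume_le_riemannianVolume he)
    refine (eLpNorm_mono_measure _ hle).trans_lt ((eLpNorm_smul_measure_le _ _ _ _).trans_lt ?_)
    exact ENNReal.mul_lt_top (ENNReal.rpow_lt_top_of_nonneg ENNReal.toReal_nonneg hd) h3
  have h2 := eLpNorm_le_mul_eLpNorm_of_ae_le_mul (μ := volume.restrict K) (p := p)
    (f := fun y ↦ B.inner _ (φ (e.symm y)) (w (e.symm y) fun i ↦ Y i (e.symm y)))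
    (g := fun y ↦ tensorNorm B (w (e.symm y))) (c := C) ?_
  · exact h2.trans_lt (ENNReal.mul_lt_top ENNReal.ofReal_lt_top h1)
  · filter_upwards [ae_restrict_mem hKc.measurableSet] with y hy
    refine (norm_inner_tensor_apply_le hB _ _ _).trans ?_
    rw [Real.norm_of_nonneg (tensorNorm_nonneg _)]
    refine mul_le_mul_of_nonneg_right ?_ (tensorNorm_nonneg _)
    refine le_trans (le_of_eq ?_) ((le_abs_self _).trans (hC y hy))
    simp only [c, norm_eq_sqrt_real_inner]

end Components

/-! ### The Leibniz rule for weak covariant derivatives -/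

section Leibniz

open Filter Topology

/-- Being locally in `L^p` is a local property. -/
theorem MemLpLoc.of_locally {G : Type*} [NormedAddCommGroup G] [NormedSpace ℝ G]
    [MeasurableSpace G] [BorelSpace G] [FiniteDimensional ℝ G] {μ : Measure G} {U : Set G}
    {f : G → ℂ} {p : ℝ≥0∞} (h : ∀ y ∈ U, ∃ V, IsOpen V ∧ y ∈ V ∧ MemLpLoc f p μ V) :
    MemLpLoc f p μ U := by
  intro K hK hKc
  obtain ⟨t, hKt, ht, hft⟩ : ∃ t, K ⊆ t ∧ MeasurableSet t ∧ MemLp (t.indicator f) p μ := by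
    refine hKc.induction_on (p := fun s ↦ ∃ t, s ⊆ t ∧ MeasurableSet t ∧ MemLp (t.indicator f) p μ)
      ⟨∅, by simp⟩ (fun s s' hs ⟨t, hst, ht⟩ ↦ ⟨t, hs.trans hst, ht⟩) ?_ ?_
    · rintro s s' ⟨t, hst, ht, hf⟩ ⟨t', hst', ht', hf'⟩
      refine ⟨t ∪ t', union_subset_union hst hst', ht.union ht', ?_⟩
      have h1 : (t ∪ t').indicator f = t.indicator f + tᶜ.indicator (t'.indicator f) := by
        ext y
        by_cases h1 : y ∈ t <;> by_cases h2 : y ∈ t' <;> simp [h1, h2]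
      rw [h1]
      exact hf.add (hf'.indicator ht.compl)
    · intro y hy
      obtain ⟨V, hV, hyV, hf⟩ := h y (hK hy)
      have : ProperSpace G := FiniteDimensional.proper ℝ G
      obtain ⟨ε, hε, hεV⟩ := Metric.nhds_basis_closedBall.mem_iff.1 (hV.mem_nhds hyV)
      have hm : MeasurableSet (Metric.closedBall y ε) := Metric.isClosed_closedBall.measurableSet
      exact ⟨_, mem_nhdsWithin_of_mem_nhds (Metric.closedBall_mem_nhds y hε), _, Subset.rfl, hm,
        (memLp_indicator_iff_restrict hm).2 (hf _ hεV (isCompact_closedBall y ε))⟩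
  exact ((memLp_indicator_iff_restrict ht).1 hft).mono_measure (Measure.restrict_mono hKt le_rfl)

variable {n : ℕ} {M : Type*} [TopologicalSpace M] [ChartedSpace (EuclideanSpace ℝ (Fin n)) M]

/-- In the chart `e`, the values `w'` are the weak covariant derivative of the section `w` along
the coordinate vector field with components `v`. -/
def HasWeakDerivAlong {V : M → Type*} [∀ x, AddCommGroup (V x)] [∀ x, Module ℂ (V x)]
    (B : BundleData n V) (e : OpenPartialHomeomorph M (EuclideanSpace ℝ (Fin n)))
    (v : EuclideanSpace ℝ (Fin n)) (w : ∀ x, V x) (w' : ∀ y, V (e.symm y)) : Prop :=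
  ∀ φ : ∀ x, V x, B.IsSmooth φ → IsWeakDeriv volume e.target v
    (fun y ↦ B.inner _ (φ (e.symm y)) (w (e.symm y)))
    (fun y ↦ B.inner _ (φ (e.symm y)) (w' y) +
      B.inner _ (B.nabla φ (e.symm y) (chartVector e y v)) (w (e.symm y)))

/-- The components of `w` (a family of vectors over the domain of the chart `e`) are locally in
`L^p`. -/
def MemLpLocAlong {V : M → Type*} [∀ x, AddCommGroup (V x)] [∀ x, Module ℂ (V x)]
    (B : BundleData n V) (e : OpenPartialHomeomorph M (EuclideanSpace ℝ (Fin n))) (p : ℝ≥0∞)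
    (w : ∀ y, V (e.symm y)) : Prop :=
  ∀ φ : ∀ x, V x, B.IsSmooth φ →
    MemLpLoc (fun y ↦ B.inner _ (φ (e.symm y)) (w y)) p volume e.target

variable [T2Space M] [IsManifold (𝓡 n) ∞ M]
  {F : Type*} [NormedAddCommGroup F] [NormedSpace ℂ F] [FiniteDimensional ℂ F]
  {E : M → Type*} [TopologicalSpace (TotalSpace F E)]
  [∀ x, NormedAddCommGroup (E x)] [∀ x, InnerProductSpace ℂ (E x)]
  [∀ x, FiniteDimensional ℂ (E x)]
  [FiberBundle F E] [VectorBundle ℂ F E] [VectorBundle ℝ F E]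
  [ContMDiffVectorBundle ∞ F E (𝓡 n)]
  {F₁ : Type*} [NormedAddCommGroup F₁] [NormedSpace ℂ F₁] [FiniteDimensional ℂ F₁]
  {E₁ : M → Type*} [TopologicalSpace (TotalSpace F₁ E₁)]
  [∀ x, NormedAddCommGroup (E₁ x)] [∀ x, InnerProductSpace ℂ (E₁ x)]
  [∀ x, FiniteDimensional ℂ (E₁ x)]
  [FiberBundle F₁ E₁] [VectorBundle ℂ F₁ E₁] [VectorBundle ℝ F₁ E₁]
  [ContMDiffVectorBundle ∞ F₁ E₁ (𝓡 n)]
  {cov : CovariantDerivative (𝓡 n) F E} {cov₁ : CovariantDerivative (𝓡 n) F₁ E₁}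

theorem inner_apply_eq_sum_frame {W W₁ : Type*} [NormedAddCommGroup W] [InnerProductSpace ℂ W]
    [NormedAddCommGroup W₁] [InnerProductSpace ℂ W₁] {m : ℕ} {s t : Fin m → W}
    (h : ∀ v, v = ∑ i, inner ℂ (t i) v • s i) (φ : W₁) (A : W →L[ℂ] W₁) (v : W) :
    ∑ i, inner ℂ φ (A (s i)) * inner ℂ (t i) v = inner ℂ φ (A v) := by
  conv_rhs => rw [h v]
  simp [mul_comm]

/-- The product rule `∇_X (a u) = (∇_X a) u + a (∇_X u)` in the weak sense. In frames,
`(φ, a u) = ∑ (φ ⊗ sᵢ*, a) (tᵢ, u)`, which reduces it to the product rule for functions. -/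
theorem HasWeakDerivAlong.apply (hE : IsSmoothHermitian n F E)
    (hcov : IsMetricConnection cov) (hcov₁ : IsMetricConnection cov₁)
    {p q r : ℝ≥0∞} [ENNReal.HolderTriple p q r] (hr : 1 ≤ r)
    {e : OpenPartialHomeomorph M (EuclideanSpace ℝ (Fin n))}
    (he : e ∈ atlas (EuclideanSpace ℝ (Fin n)) M) {v : EuclideanSpace ℝ (Fin n)}
    {a : ∀ x, E x →L[ℂ] E₁ x} {a' : ∀ y, E (e.symm y) →L[ℂ] E₁ (e.symm y)}
    {u : ∀ x, E x} {u' : ∀ y, E (e.symm y)}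
    (ha : HasWeakDerivAlong (hom cov cov₁) e v a a')
    (hu : HasWeakDerivAlong (ofBundle cov) e v u u')
    (hap : MemLpLocAlong (hom cov cov₁) e p (fun y ↦ a (e.symm y)))
    (hap' : MemLpLocAlong (hom cov cov₁) e p a')
    (huq : MemLpLocAlong (ofBundle cov) e q (fun y ↦ u (e.symm y)))
    (huq' : MemLpLocAlong (ofBundle cov) e q u') :
    HasWeakDerivAlong (ofBundle cov₁) e v (fun x ↦ a x (u x))
      (fun y ↦ a' y (u (e.symm y)) + a (e.symm y) (u' y)) := by
  intro φ hφ
  refine IsWeakDeriv.of_locally fun y₀ hy₀ ↦ ?_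
  obtain ⟨m, s, t, hs, ht, hst⟩ := exists_smooth_dual_sections (n := n) hE (e.symm y₀)
  obtain ⟨X, hX, hXe⟩ := exists_isSmoothVectorField_eventuallyEq_chartVector he hy₀ v
  obtain ⟨V, hV, hVo, hyV⟩ := eventually_nhds_iff.1
    ((hXe.and ((e.symm.continuousAt hy₀).eventually hst.eventually_nhds)).and
      (e.open_target.mem_nhds hy₀))
  have hVe : V ⊆ e.target := fun y hy ↦ (hV y hy).2
  refine ⟨V, hVo, hyV, ?_⟩
  have hA (i : Fin m) := isSmooth_rankOne (cov := cov) (cov₁ := cov₁) hE hφ (hs i)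
  have h1 (i : Fin m) := IsWeakDeriv.mul (p := p) (q := q) hr hVo ((ha _ (hA i)).mono hVe)
    ((hu _ (ht i)).mono hVe) ((hap _ (hA i)).mono_set hVe)
    (by
      refine MemLpLoc.add ((hap' _ (hA i)).mono_set hVe) ?_
      have hsm : MemLpLoc (fun y ↦ (hom cov cov₁).inner _
          (rankOne (cov₁ φ (e.symm y) (X (e.symm y))) (s i (e.symm y))) (a (e.symm y)) +
          (hom cov cov₁).inner _
          (rankOne (φ (e.symm y)) (cov (s i) (e.symm y) (X (e.symm y)))) (a (e.symm y)))
          p volume V :=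
        ((hap _ (isSmooth_rankOne hE (hcov₁.isSmoothSection_apply hφ hX) (hs i))).mono_set hVe).add
        ((hap _ (isSmooth_rankOne hE hφ (hcov.isSmoothSection_apply (hs i) hX))).mono_set hVe)
      refine hsm.congr fun y hy ↦ ?_
      rw [(hV y hy).1.1, hom_nabla_rankOne hE hcov hcov₁ hφ (hs i), hom_inner_rankOne,
        hom_inner_rankOne]
      simp only [hom, add_apply, rankOne_apply, inner_add_left, Finset.sum_add_distrib]
      congr 1
      · exact (hom_inner_rankOne (cov := cov) (cov₁ := cov₁) _ _ _ _).symm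
      · exact (hom_inner_rankOne (cov := cov) (cov₁ := cov₁) _ _ _ _).symm)
    ((huq _ (ht i)).mono_set hVe)
    (by
      refine MemLpLoc.add ((huq' _ (ht i)).mono_set hVe) ?_
      refine ((huq _ (hcov.isSmoothSection_apply (ht i) hX)).mono_set hVe).congr fun y hy ↦ ?_
      rw [(hV y hy).1.1]
      rfl)
  refine (IsWeakDeriv.sum Finset.univ fun i _ ↦ h1 i).congr hVo ?_ ?_
  · intro y hy
    simp only [hom_inner_rankOne]
    exact inner_apply_eq_sum_frame (hV y hy).1.2.self_of_nhds _ _ _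
  · intro y hy
    have hf := (hV y hy).1.2.self_of_nhds
    have hz := hcov.sum_cov_frame_eq_zero hE hs ht (hV y hy).1.2 (chartVector e y v) (u (e.symm y))
    set Z := chartVector e y v
    have hhom (i : Fin m) (A : E (e.symm y) →L[ℂ] E₁ (e.symm y)) : (hom cov cov₁).inner (e.symm y)
        ((hom cov cov₁).nabla (fun x ↦ rankOne (φ x) (s i x)) (e.symm y) Z) A =
        inner ℂ (cov₁ φ (e.symm y) Z) (A (s i (e.symm y))) +
          inner ℂ (φ (e.symm y)) (A (cov (s i) (e.symm y) Z)) := by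
      rw [hom_nabla_rankOne hE hcov hcov₁ hφ (hs i)]
      rw [← hom_inner_rankOne (cov := cov) (cov₁ := cov₁),
        ← hom_inner_rankOne (cov := cov) (cov₁ := cov₁)]
      simp only [hom, add_apply, inner_add_left, Finset.sum_add_distrib]
    simp only [hhom, hom_inner_rankOne]
    change _ = inner ℂ (φ (e.symm y)) (a' y (u (e.symm y)) + a (e.symm y) (u' y)) +
      inner ℂ (cov₁ φ (e.symm y) Z) (a (e.symm y) (u (e.symm y)))
    rw [inner_add_right, ← inner_apply_eq_sum_frame hf (φ (e.symm y)) (a' y),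
      ← inner_apply_eq_sum_frame hf (φ (e.symm y)) (a (e.symm y)) (u' y),
      ← inner_apply_eq_sum_frame hf (cov₁ φ (e.symm y) Z) (a (e.symm y)) (u (e.symm y))]
    have hz' := congrArg (fun z ↦ inner ℂ (φ (e.symm y)) (a (e.symm y) z)) hz
    simp only [map_sum, map_add, map_smul, inner_sum, inner_add_right, inner_smul_right, map_zero,
      inner_zero_right] at hz'
    rw [← sub_eq_zero, ← hz']
    simp only [← Finset.sum_add_distrib, ← Finset.sum_sub_distrib]
    refine Finset.sum_congr rfl fun i _ ↦ ?_
    simp only [ofBundle]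
    ring

end Leibniz

/-! ### Covariant derivatives of tensors along coordinate vector fields -/

section Along

open Filter Topology

variable {n : ℕ} {M : Type*} [TopologicalSpace M] [ChartedSpace (EuclideanSpace ℝ (Fin n)) M]
  [IsManifold (𝓡 n) ∞ M]
  [RiemannianBundle (fun x : M ↦ TangentSpace (𝓡 n) x)]
  {V : M → Type*} [∀ x, AddCommGroup (V x)] [∀ x, Module ℂ (V x)] {B : BundleData n V} {j : ℕ}

/-- The derivative `∇_v (w(Y_1, …, Y_j))` of a component of `w` along a coordinate vector field,
where `w'` is the covariant derivative of `w`. -/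
noncomputable def derivAlong (w : ∀ x : M, Tensor n V j x) (w' : ∀ x : M, Tensor n V (j + 1) x)
    (Y : Fin j → ∀ x : M, TangentSpace (𝓡 n) x)
    (e : OpenPartialHomeomorph M (EuclideanSpace ℝ (Fin n))) (v y : EuclideanSpace ℝ (Fin n)) :
    V (e.symm y) :=
  (w' (e.symm y)).curryLeft (chartVector e y v) (fun i ↦ Y i (e.symm y)) +
    ∑ i, w (e.symm y) (Function.update (fun k ↦ Y k (e.symm y)) i
      (leviCivita (Y i) (e.symm y) (chartVector e y v)))

theorem isWeakCovariantDerivative_iff (hB : B.IsHermitian) {w : ∀ x : M, Tensor n V j x}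
    {w' : ∀ x : M, Tensor n V (j + 1) x} : IsWeakCovariantDerivative B w w' ↔
      ∀ Y : Fin j → ∀ x : M, TangentSpace (𝓡 n) x, (∀ i, IsSmoothVectorField (Y i)) →
        ∀ e ∈ atlas (EuclideanSpace ℝ (Fin n)) M, ∀ v,
          HasWeakDerivAlong B e v (fun x ↦ w x fun i ↦ Y i x) (derivAlong w w' Y e v) := by
  have key (Y : Fin j → ∀ x : M, TangentSpace (𝓡 n) x)
      (e : OpenPartialHomeomorph M (EuclideanSpace ℝ (Fin n))) (v y : EuclideanSpace ℝ (Fin n))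
      (φ : ∀ x, V x) :
      B.inner _ (φ (e.symm y)) (derivAlong w w' Y e v y) +
        B.inner _ (B.nabla φ (e.symm y) (chartVector e y v)) (w (e.symm y) fun i ↦ Y i (e.symm y)) =
      B.inner _ (φ (e.symm y)) ((w' (e.symm y)).curryLeft (chartVector e y v)
        fun i ↦ Y i (e.symm y))
          + B.inner _ (B.nabla φ (e.symm y) (chartVector e y v))
            (w (e.symm y) fun i ↦ Y i (e.symm y))
          + ∑ i, B.inner _ (φ (e.symm y)) (w (e.symm y) (Function.update (fun k ↦ Y k (e.symm y)) i
              (leviCivita (Y i) (e.symm y) (chartVector e y v)))) := by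
    rw [derivAlong, hB.inner_add_right, hB.inner_sum_right]
    ring
  refine ⟨fun h Y hY e he v φ hφ ↦ ?_, fun h φ hφ Y hY e he ↦ ⟨?_, fun v ↦ ?_⟩⟩
  · have h1 := h φ hφ Y hY e he
    simp only [key]
    exact ⟨h1.1, (h1.2 v).1, (h1.2 v).2⟩
  · exact (h Y hY e he 0 φ hφ).1
  · have h1 := h Y hY e he v φ hφ
    simp only [key] at h1
    exact ⟨h1.2, h1.3⟩

variable [T2Space M] [SecondCountableTopology M]
  [MeasurableSpace M] [BorelSpace M]
  [IsContMDiffRiemannianBundle (𝓡 n) ∞ (EuclideanSpace ℝ (Fin n))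
    (fun x : M ↦ TangentSpace (𝓡 n) x)]

theorem memLpLocAlong_apply (hB : B.IsHermitian) {w : ∀ x : M, Tensor n V j x}
    (hw : IsMeasurableSection B w) {p : ℝ≥0∞} (hwp : sectionLpNorm B w p < ⊤)
    {Y : Fin j → ∀ x : M, TangentSpace (𝓡 n) x}
    (hY : ∀ i, IsSmoothVectorField (Y i)) {e : OpenPartialHomeomorph M (EuclideanSpace ℝ (Fin n))}
    (he : e ∈ atlas (EuclideanSpace ℝ (Fin n)) M) :
    MemLpLocAlong B e p (fun y ↦ w (e.symm y) fun i ↦ Y i (e.symm y)) :=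
  fun _ hφ ↦ memLpLoc_inner_tensor_apply hB hw hwp hφ hY he

theorem memLpLocAlong_derivAlong (hB : B.IsHermitian) {w : ∀ x : M, Tensor n V j x}
    (hw : IsMeasurableSection B w) {p : ℝ≥0∞} (hwp : sectionLpNorm B w p < ⊤)
    {w' : ∀ x : M, Tensor n V (j + 1) x} (hw' : IsMeasurableSection B w')
    (hwp' : sectionLpNorm B w' p < ⊤) {Y : Fin j → ∀ x : M, TangentSpace (𝓡 n) x}
    (hY : ∀ i, IsSmoothVectorField (Y i)) {e : OpenPartialHomeomorph M (EuclideanSpace ℝ (Fin n))}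
    (he : e ∈ atlas (EuclideanSpace ℝ (Fin n)) M) (v : EuclideanSpace ℝ (Fin n)) :
    MemLpLocAlong B e p (derivAlong w w' Y e v) := by
  intro φ hφ
  refine MemLpLoc.of_locally fun y₀ hy₀ ↦ ?_
  obtain ⟨X, hX, hXe⟩ := exists_isSmoothVectorField_eventuallyEq_chartVector he hy₀ v
  obtain ⟨U, hU, hUo, hyU⟩ := eventually_nhds_iff.1 (hXe.and (e.open_target.mem_nhds hy₀))
  have hUe : U ⊆ e.target := fun y hy ↦ (hU y hy).2
  refine ⟨U, hUo, hyU, ?_⟩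
  let Y' : Fin (j + 1) → ∀ x : M, TangentSpace (𝓡 n) x := Fin.cons X Y
  have hY' (i : Fin (j + 1)) : IsSmoothVectorField (Y' i) := by
    refine Fin.cases ?_ (fun i ↦ ?_) i
    · exact hX
    · exact hY i
  let Z : Fin j → Fin j → ∀ x : M, TangentSpace (𝓡 n) x := fun i ↦
    Function.update Y i (fun x ↦ leviCivita (Y i) x (X x))
  have hZ (i k : Fin j) : IsSmoothVectorField (Z i k) := by
    by_cases hk : k = i
    · subst hk
      simpa [Z] using (hY k).leviCivita hX
    · simpa [Z, hk] using hY k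
  refine (((memLpLoc_inner_tensor_apply hB hw' hwp' hφ hY' he).mono_set hUe).add
    (MemLpLoc.sum Finset.univ fun i _ ↦
      (memLpLoc_inner_tensor_apply hB hw hwp hφ (hZ i) he).mono_set hUe)).congr fun y hy ↦ ?_
  rw [derivAlong, hB.inner_add_right, hB.inner_sum_right, ← (hU y hy).1]
  congr 1
  · rw [MultilinearMap.curryLeft_apply]
    congr 2
    ext i : 1
    refine Fin.cases ?_ (fun i ↦ ?_) i <;> rfl
  · refine Finset.sum_congr rfl fun i _ ↦ ?_
    congr 2
    ext k : 1
    by_cases hk : k = i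
    · subst hk; simp [Z]
    · simp [Z, hk]

end Along

/-! ### Products of multilinear maps -/

section Split

/-- A splitting of `k` slots into `i` slots for the first factor of a product and `j` slots for the
second one. -/
structure Split (k : ℕ) where
  i : ℕ
  j : ℕ
  f : Fin i → Fin k
  g : Fin j → Fin k
  bijective : Function.Bijective (Sum.elim f g)

namespace Split

variable {k : ℕ}

/-- Adds a slot in front, which is attributed to the first factor. -/
def left (S : Split k) : Split (k + 1) where
  i := S.i + 1
  j := S.j
  f := Fin.cons 0 (fun c ↦ (S.f c).succ)
  g := fun c ↦ (S.g c).succ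
  bijective := by
    constructor
    · rw [Sum.elim_injective]
      have h := Sum.elim_injective.1 S.bijective.1
      refine ⟨Fin.cons_injective_iff.2 ⟨fun ⟨c, hc⟩ ↦ Fin.succ_ne_zero _ hc,
        (Fin.succ_injective k).comp h.1⟩, (Fin.succ_injective k).comp h.2.1, fun c d ↦ ?_⟩
      refine Fin.cases ?_ (fun c ↦ ?_) c
      · exact (Fin.succ_ne_zero _).symm
      · exact fun hcd ↦ h.2.2 c d (Fin.succ_injective k hcd)
    · refine fun m ↦ Fin.cases ⟨.inl 0, rfl⟩ (fun m ↦ ?_) m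
      obtain ⟨c | d, rfl⟩ := S.bijective.2 m
      · exact ⟨.inl c.succ, rfl⟩
      · exact ⟨.inr d, rfl⟩

/-- Adds a slot in front, which is attributed to the second factor. -/
def right (S : Split k) : Split (k + 1) where
  i := S.i
  j := S.j + 1
  f := fun c ↦ (S.f c).succ
  g := Fin.cons 0 (fun c ↦ (S.g c).succ)
  bijective := by
    constructor
    · rw [Sum.elim_injective]
      have h := Sum.elim_injective.1 S.bijective.1
      refine ⟨(Fin.succ_injective k).comp h.1, Fin.cons_injective_iff.2
        ⟨fun ⟨c, hc⟩ ↦ Fin.succ_ne_zero _ hc, (Fin.succ_injective k).comp h.2.1⟩, fun c d ↦ ?_⟩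
      refine Fin.cases ?_ (fun d ↦ ?_) d
      · exact Fin.succ_ne_zero _
      · exact fun hcd ↦ h.2.2 c d (Fin.succ_injective k hcd)
    · refine fun m ↦ Fin.cases ⟨.inr 0, rfl⟩ (fun m ↦ ?_) m
      obtain ⟨c | d, rfl⟩ := S.bijective.2 m
      · exact ⟨.inl c, rfl⟩
      · exact ⟨.inr d.succ, rfl⟩

/-- The splitting given by a word: the letters say to which factor each slot belongs. -/
def ofWord : ∀ {k : ℕ}, (Fin k → Bool) → Split k
  | 0, _ => ⟨0, 0, Fin.elim0, Fin.elim0, fun x ↦ by rcases x with x | x <;> exact x.elim0,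
      fun x ↦ x.elim0⟩
  | _ + 1, b => bif b 0 then (ofWord (Fin.tail b)).left else (ofWord (Fin.tail b)).right

theorem sum_ofWord_succ {N : Type*} [AddCommMonoid N] (G : Split (k + 1) → N) :
    ∑ b : Fin (k + 1) → Bool, G (ofWord b) =
      ∑ b : Fin k → Bool, (G (ofWord b).left + G (ofWord b).right) := by
  rw [← (Fin.consEquiv fun _ ↦ Bool).sum_comp, Fintype.sum_prod_type, Fintype.sum_bool,
    Finset.sum_add_distrib]
  rfl

/-- The slots of both factors together are all slots. -/
noncomputable def equiv (S : Split k) : Fin S.i ⊕ Fin S.j ≃ Fin k := Equiv.ofBijective _ S.bijective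

theorem i_add_j (S : Split k) : S.i + S.j = k := by
  simpa using Fintype.card_congr S.equiv

variable {W N H H₁ : Type*} [AddCommGroup W] [Module ℝ W] [AddCommGroup N] [Module ℂ N]
  [AddCommGroup H] [Module ℂ H] [AddCommGroup H₁] [Module ℂ H₁]

theorem update_comp_f {W : Type*} (S : Split k) (X : Fin k → W) (c : Fin S.i) (z : W) :
    (fun c' ↦ Function.update X (S.f c) z (S.f c')) =
      Function.update (fun c' ↦ X (S.f c')) c z :=
  Function.update_comp_eq_of_injective X (Sum.elim_injective.1 S.bijective.1).1 c z

theorem update_comp_f' {W : Type*} (S : Split k) (X : Fin k → W) (d : Fin S.j) (z : W) :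
    (fun c' ↦ Function.update X (S.g d) z (S.f c')) = fun c' ↦ X (S.f c') :=
  funext fun c ↦ Function.update_of_ne ((Sum.elim_injective.1 S.bijective.1).2.2 c d) _ _

theorem update_comp_g {W : Type*} (S : Split k) (X : Fin k → W) (d : Fin S.j) (z : W) :
    (fun c' ↦ Function.update X (S.g d) z (S.g c')) =
      Function.update (fun c' ↦ X (S.g c')) d z :=
  Function.update_comp_eq_of_injective X (Sum.elim_injective.1 S.bijective.1).2.1 d z

theorem update_comp_g' {W : Type*} (S : Split k) (X : Fin k → W) (c : Fin S.i) (z : W) :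
    (fun c' ↦ Function.update X (S.f c) z (S.g c')) = fun c' ↦ X (S.g c') :=
  funext fun d ↦ Function.update_of_ne ((Sum.elim_injective.1 S.bijective.1).2.2 c d).symm _ _

/-- The product of two multilinear maps, with the slots distributed according to a splitting. -/
def mul (S : Split k) (ev : N →ₗ[ℂ] H →ₗ[ℂ] H₁) (A : MultilinearMap ℝ (fun _ : Fin S.i ↦ W) N)
    (v : MultilinearMap ℝ (fun _ : Fin S.j ↦ W) H) : MultilinearMap ℝ (fun _ : Fin k ↦ W) H₁ :=
  MultilinearMap.mk' (fun X ↦ ev (A fun c ↦ X (S.f c)) (v fun d ↦ X (S.g d)))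
    (by
      intro X m y z
      obtain ⟨c | d, rfl⟩ := S.bijective.2 m
      · simp only [Sum.elim_inl, update_comp_f, update_comp_g', MultilinearMap.map_update_add,
          map_add, LinearMap.add_apply]
      · simp only [Sum.elim_inr, update_comp_f', update_comp_g, MultilinearMap.map_update_add,
          map_add])
    (by
      intro X m r y
      obtain ⟨c | d, rfl⟩ := S.bijective.2 m
      · simp only [Sum.elim_inl, update_comp_f, update_comp_g', MultilinearMap.map_update_smul,
          ← Complex.coe_smul, map_smul, LinearMap.smul_apply]
      · simp only [Sum.elim_inr, update_comp_f', update_comp_g, MultilinearMap.map_update_smul,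
          ← Complex.coe_smul, map_smul])

variable (S : Split k) (ev : N →ₗ[ℂ] H →ₗ[ℂ] H₁)

theorem mul_apply (A : MultilinearMap ℝ (fun _ : Fin S.i ↦ W) N)
    (v : MultilinearMap ℝ (fun _ : Fin S.j ↦ W) H) (X : Fin k → W) :
    S.mul ev A v X = ev (A fun c ↦ X (S.f c)) (v fun d ↦ X (S.g d)) := rfl

theorem left_mul_cons (A : MultilinearMap ℝ (fun _ : Fin S.left.i ↦ W) N)
    (v : MultilinearMap ℝ (fun _ : Fin S.j ↦ W) H) (x : W) (X : Fin k → W) :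
    S.left.mul ev A v (Fin.cons x X) =
      ev (A (Fin.cons x fun c ↦ X (S.f c) : Fin (S.i + 1) → W)) (v fun d ↦ X (S.g d)) := by
  have h : (fun c : Fin (S.i + 1) ↦ (Fin.cons x X : Fin (k + 1) → W) (S.left.f c)) =
      Fin.cons x fun c ↦ X (S.f c) := by
    ext c
    refine Fin.cases ?_ (fun c ↦ ?_) c <;> rfl
  exact congrArg (fun z : Fin (S.i + 1) → W ↦ ev (A z) (v fun d ↦ X (S.g d))) h

theorem right_mul_cons (A : MultilinearMap ℝ (fun _ : Fin S.i ↦ W) N)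
    (v : MultilinearMap ℝ (fun _ : Fin S.right.j ↦ W) H) (x : W) (X : Fin k → W) :
    S.right.mul ev A v (Fin.cons x X) =
      ev (A fun c ↦ X (S.f c)) (v (Fin.cons x fun d ↦ X (S.g d) : Fin (S.j + 1) → W)) := by
  have h : (fun d : Fin (S.j + 1) ↦ (Fin.cons x X : Fin (k + 1) → W) (S.right.g d)) =
      Fin.cons x fun d ↦ X (S.g d) := by
    ext c
    refine Fin.cases ?_ (fun c ↦ ?_) c <;> rfl
  exact congrArg (fun z : Fin (S.j + 1) → W ↦ ev (A fun c ↦ X (S.f c)) (v z)) h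

/-- A derivation acting on the slots of a product acts on the slots of the factors. -/
theorem sum_mul_update (A : MultilinearMap ℝ (fun _ : Fin S.i ↦ W) N)
    (v : MultilinearMap ℝ (fun _ : Fin S.j ↦ W) H) (X Z : Fin k → W) :
    ∑ m, S.mul ev A v (Function.update X m (Z m)) =
      ∑ c, ev (A (Function.update (fun c ↦ X (S.f c)) c (Z (S.f c)))) (v fun d ↦ X (S.g d)) +
        ∑ d, ev (A fun c ↦ X (S.f c))
          (v (Function.update (fun d ↦ X (S.g d)) d (Z (S.g d)))) := by
  rw [← S.equiv.sum_comp, Fintype.sum_sum_type]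
  congr 1
  · refine Finset.sum_congr rfl fun c _ ↦ ?_
    change S.mul ev A v (Function.update X (S.f c) (Z (S.f c))) = _
    rw [mul_apply, update_comp_f, update_comp_g']
  · refine Finset.sum_congr rfl fun d _ ↦ ?_
    change S.mul ev A v (Function.update X (S.g d) (Z (S.g d))) = _
    rw [mul_apply, update_comp_f', update_comp_g]

theorem sum_comp_mul_sum_comp {D : Type*} [Fintype D] (α : (Fin S.i → D) → ℝ)
    (β : (Fin S.j → D) → ℝ) :
    ∑ κ : Fin k → D, α (fun c ↦ κ (S.f c)) * β (fun d ↦ κ (S.g d)) =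
      (∑ κ, α κ) * ∑ κ, β κ := by
  classical
  rw [Finset.sum_mul_sum, ← Fintype.sum_prod_type',
    ← ((Equiv.arrowCongr S.equiv.symm (Equiv.refl D)).trans
      (Equiv.sumArrowEquivProdArrow _ _ _)).sum_comp]
  rfl

end Split

end Split

/-! ### The derivatives of a product -/

section ProductTower

open Filter Topology

variable {n : ℕ} {M : Type*} [TopologicalSpace M] [T2Space M] [SecondCountableTopology M]
  [MeasurableSpace M] [BorelSpace M]
  [ChartedSpace (EuclideanSpace ℝ (Fin n)) M] [IsManifold (𝓡 n) ∞ M]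
  [RiemannianBundle (fun x : M ↦ TangentSpace (𝓡 n) x)]
  [IsContMDiffRiemannianBundle (𝓡 n) ∞ (EuclideanSpace ℝ (Fin n))
    (fun x : M ↦ TangentSpace (𝓡 n) x)]
  {F : Type*} [NormedAddCommGroup F] [NormedSpace ℂ F] [FiniteDimensional ℂ F]
  {E : M → Type*} [TopologicalSpace (TotalSpace F E)]
  [∀ x, NormedAddCommGroup (E x)] [∀ x, InnerProductSpace ℂ (E x)]
  [∀ x, FiniteDimensional ℂ (E x)]
  [FiberBundle F E] [VectorBundle ℂ F E] [VectorBundle ℝ F E]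
  [ContMDiffVectorBundle ∞ F E (𝓡 n)]
  {F₁ : Type*} [NormedAddCommGroup F₁] [NormedSpace ℂ F₁] [FiniteDimensional ℂ F₁]
  {E₁ : M → Type*} [TopologicalSpace (TotalSpace F₁ E₁)]
  [∀ x, NormedAddCommGroup (E₁ x)] [∀ x, InnerProductSpace ℂ (E₁ x)]
  [∀ x, FiniteDimensional ℂ (E₁ x)]
  [FiberBundle F₁ E₁] [VectorBundle ℂ F₁ E₁] [VectorBundle ℝ F₁ E₁]
  [ContMDiffVectorBundle ∞ F₁ E₁ (𝓡 n)]
  {cov : CovariantDerivative (𝓡 n) F E} {cov₁ : CovariantDerivative (𝓡 n) F₁ E₁}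

/-- The candidate for `∇^k (a u)`: the sum over all splittings of the slots of the products of the
derivatives of `a` and of `u`. -/
noncomputable def productTower (a : ∀ (j : ℕ) (x : M), Tensor n (fun x ↦ E x →L[ℂ] E₁ x) j x)
    (u : ∀ (j : ℕ) (x : M), Tensor n E j x) (k : ℕ) (x : M) : Tensor n E₁ k x :=
  ∑ b : Fin k → Bool, (Split.ofWord b).mul (ContinuousLinearMap.coeLM ℂ) (a _ x) (u _ x)

/-- The norm of `A v` is at most the Hilbert–Schmidt norm of `A` times the norm of `v`. -/
theorem norm_apply_sq_le_hom_inner (x : M) (A : E x →L[ℂ] E₁ x) (v : E x) :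
    ‖A v‖ ^ 2 ≤ ((hom cov cov₁).inner x A A).re * ‖v‖ ^ 2 := by
  have h1 : ((hom cov cov₁).inner x A A).re = ∑ i, ‖A (stdOrthonormalBasis ℂ (E x) i)‖ ^ 2 := by
    simp only [hom, Complex.re_sum]
    exact Finset.sum_congr rfl fun i _ ↦ (norm_sq_eq_re_inner (𝕜 := ℂ) _).symm
  have h2 : ‖A v‖ ≤ ∑ i, ‖A (stdOrthonormalBasis ℂ (E x) i)‖ *
      ‖(inner ℂ (stdOrthonormalBasis ℂ (E x) i) v : ℂ)‖ := by
    conv_lhs => rw [← (stdOrthonormalBasis ℂ (E x)).sum_repr' v, map_sum]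
    refine (norm_sum_le _ _).trans (Finset.sum_le_sum fun i _ ↦ ?_)
    rw [map_smul, norm_smul, mul_comm]
  rw [h1, ← (stdOrthonormalBasis ℂ (E x)).sum_sq_norm_inner_right v]
  exact (pow_le_pow_left₀ (norm_nonneg _) h2 2).trans (Finset.sum_mul_sq_le_sq_mul_sq _ _ _)

/-- The bound holds without a constant, as the sum of squares over all indices of the product
factors over the two sets of slots. -/
theorem tensorNorm_mul_le {k : ℕ} (S : Split k) {x : M}
    (A : Tensor n (fun x ↦ E x →L[ℂ] E₁ x) S.i x) (v : Tensor n E S.j x) :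
    tensorNorm (ofBundle cov₁) (x := x) (S.mul (ContinuousLinearMap.coeLM ℂ) A v) ≤
      tensorNorm (hom cov cov₁) A * tensorNorm (ofBundle cov) v := by
  rw [tensorNorm, tensorNorm, tensorNorm, ← Real.sqrt_mul' _ (Finset.sum_nonneg fun k _ ↦ by
    simpa [ofBundle] using inner_self_nonneg (𝕜 := ℂ))]
  refine Real.sqrt_le_sqrt ?_
  rw [← S.sum_comp_mul_sum_comp]
  refine Finset.sum_le_sum fun κ _ ↦ ?_
  refine le_trans (le_of_eq ?_) ((norm_apply_sq_le_hom_inner (cov := cov) (cov₁ := cov₁) x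
    (A fun c ↦ tangentBasis x (κ (S.f c))) (v fun d ↦ tangentBasis x (κ (S.g d)))).trans
    (le_of_eq (congrArg _ ?_)))
  · exact (norm_sq_eq_re_inner (𝕜 := ℂ) _).symm
  · exact norm_sq_eq_re_inner (𝕜 := ℂ) _

theorem isMeasurableSection_mul (hE : IsSmoothHermitian n F E) {k : ℕ} (S : Split k)
    {a : ∀ x : M, Tensor n (fun x ↦ E x →L[ℂ] E₁ x) S.i x} {u : ∀ x : M, Tensor n E S.j x}
    (ha : IsMeasurableSection (hom cov cov₁) a) (hu : IsMeasurableSection (ofBundle cov) u) :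
    IsMeasurableSection (ofBundle cov₁)
      (fun x ↦ S.mul (ContinuousLinearMap.coeLM ℂ) (a x) (u x)) := by
  intro φ hφ Y hY
  refine aestronglyMeasurable_of_eventuallyEq_nhds fun x₀ ↦ ?_
  obtain ⟨m, s, t, hs, ht, hst⟩ := exists_smooth_dual_sections (n := n) hE x₀
  refine ⟨fun x ↦ ∑ i, (hom cov cov₁).inner x (rankOne (φ x) (s i x))
      (a x fun c ↦ Y (S.f c) x) * (ofBundle cov).inner x (t i x) (u x fun d ↦ Y (S.g d) x),
    Finset.aestronglyMeasurable_fun_sum _ fun i _ ↦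
      (ha _ (isSmooth_rankOne hE hφ (hs i)) _ fun c ↦ hY _).mul (hu _ (ht i) _ fun d ↦ hY _), ?_⟩
  filter_upwards [hst] with x hx
  simp only [hom_inner_rankOne]
  exact (inner_apply_eq_sum_frame hx _ _ _).symm

theorem HasWeakDerivAlong.sum {V : M → Type*} [∀ x, AddCommGroup (V x)] [∀ x, Module ℂ (V x)]
    {B : BundleData n V} (hB : B.IsHermitian)
    {e : OpenPartialHomeomorph M (EuclideanSpace ℝ (Fin n))} {v : EuclideanSpace ℝ (Fin n)}
    {ι : Type*} (s : Finset ι) {w : ι → ∀ x, V x} {w' : ι → ∀ y, V (e.symm y)}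
    (h : ∀ i ∈ s, HasWeakDerivAlong B e v (w i) (w' i)) :
    HasWeakDerivAlong B e v (fun x ↦ ∑ i ∈ s, w i x) (fun y ↦ ∑ i ∈ s, w' i y) := by
  intro φ hφ
  refine (IsWeakDeriv.sum s fun i hi ↦ h i hi φ hφ).congr e.open_target ?_ ?_
  · intro y _
    rw [hB.inner_sum_right]
  · intro y _
    rw [hB.inner_sum_right, hB.inner_sum_right, Finset.sum_add_distrib]

/-- The Leibniz rule for the product tower: a splitting of `k + 1` slots arises from one of `k`
slots by attributing the slot of the new derivative to `a` or to `u`. -/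
theorem derivAlong_productTower (a : ∀ (j : ℕ) (x : M), Tensor n (fun x ↦ E x →L[ℂ] E₁ x) j x)
    (u : ∀ (j : ℕ) (x : M), Tensor n E j x) (k : ℕ) (Y : Fin k → ∀ x : M, TangentSpace (𝓡 n) x)
    (e : OpenPartialHomeomorph M (EuclideanSpace ℝ (Fin n))) (v y : EuclideanSpace ℝ (Fin n)) :
    derivAlong (productTower a u k) (productTower a u (k + 1)) Y e v y =
      ∑ b : Fin k → Bool,
        (derivAlong (a (Split.ofWord b).i) (a ((Split.ofWord b).i + 1))
          (fun c ↦ Y ((Split.ofWord b).f c)) e v y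
          (u _ (e.symm y) fun d ↦ Y ((Split.ofWord b).g d) (e.symm y)) +
        a _ (e.symm y) (fun c ↦ Y ((Split.ofWord b).f c) (e.symm y))
          (derivAlong (u (Split.ofWord b).j) (u ((Split.ofWord b).j + 1))
            (fun d ↦ Y ((Split.ofWord b).g d)) e v y)) := by
  have h1 (X : Fin (k + 1) → TangentSpace (𝓡 n) (e.symm y)) :
      productTower a u (k + 1) (e.symm y) X = ∑ b : Fin k → Bool,
        ((Split.ofWord b).left.mul (ContinuousLinearMap.coeLM ℂ) (a _ (e.symm y)) (u _ (e.symm y)) X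
        + (Split.ofWord b).right.mul (ContinuousLinearMap.coeLM ℂ) (a _ (e.symm y))
          (u _ (e.symm y)) X) := by
    rw [productTower, sum_apply]
    exact Split.sum_ofWord_succ fun S ↦
      S.mul (ContinuousLinearMap.coeLM ℂ) (a _ (e.symm y)) (u _ (e.symm y)) X
  simp only [derivAlong, MultilinearMap.curryLeft_apply, h1]
  simp only [productTower, sum_apply]
  rw [Finset.sum_comm, ← Finset.sum_add_distrib]
  refine Finset.sum_congr rfl fun b _ ↦ ?_
  have hl := Split.left_mul_cons (Split.ofWord b) (ContinuousLinearMap.coeLM ℂ)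
    (a ((Split.ofWord b).i + 1) (e.symm y)) (u _ (e.symm y)) (chartVector e y v)
    (fun i ↦ Y i (e.symm y))
  have hr := Split.right_mul_cons (Split.ofWord b) (ContinuousLinearMap.coeLM ℂ)
    (a _ (e.symm y)) (u ((Split.ofWord b).j + 1) (e.symm y)) (chartVector e y v)
    (fun i ↦ Y i (e.symm y))
  rw [Split.sum_mul_update]
  refine (congrArg₂ _ (congrArg₂ _ hl hr) rfl).trans ?_
  simp only [map_add, map_sum, add_apply, sum_apply]
  simp only [ContinuousLinearMap.coeLM_apply, ContinuousLinearMap.coe_coe]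
  exact add_add_add_comm _ _ _ _

/-- The product tower consists of the weak covariant derivatives of the product. -/
theorem isDerivativeTower_productTower (hE : IsSmoothHermitian n F E)
    (hE₁ : IsSmoothHermitian n F₁ E₁) (hcov : IsMetricConnection cov)
    (hcov₁ : IsMetricConnection cov₁) {l : ℕ} {p q r : ℝ≥0∞} [ENNReal.HolderTriple p q r]
    (hr : 1 ≤ r) {a₀ : ∀ x, E x →L[ℂ] E₁ x} {u₀ : ∀ x, E x}
    {a : ∀ (j : ℕ) (x : M), Tensor n (fun x ↦ E x →L[ℂ] E₁ x) j x}
    {u : ∀ (j : ℕ) (x : M), Tensor n E j x}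
    (ha : IsDerivativeTower (hom cov cov₁) l a₀ a) (hu : IsDerivativeTower (ofBundle cov) l u₀ u)
    (hap : ∀ j ≤ l, sectionLpNorm (hom cov cov₁) (a j) p < ⊤)
    (huq : ∀ j ≤ l, sectionLpNorm (ofBundle cov) (u j) q < ⊤) :
    IsDerivativeTower (ofBundle cov₁) l (fun x ↦ a₀ x (u₀ x)) (productTower a u) where
  zero x := by
    ext X
    simp only [productTower, Finset.univ_unique, Finset.sum_singleton]
    rw [Split.mul_apply]
    change ContinuousLinearMap.coeLM ℂ (a 0 x _) (u 0 x _) = _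
    rw [ha.zero, hu.zero]
    rfl
  measurable k hk := by
    intro φ hφ Y hY
    have h (x : M) : (ofBundle cov₁).inner x (φ x) (productTower a u k x fun i ↦ Y i x) =
        ∑ b : Fin k → Bool, (ofBundle cov₁).inner x (φ x)
          ((Split.ofWord b).mul (ContinuousLinearMap.coeLM ℂ) (a _ x) (u _ x) fun i ↦ Y i x) := by
      rw [productTower, sum_apply, (isHermitian_ofBundle hE₁).inner_sum_right]
    simp only [h]
    refine Finset.aestronglyMeasurable_fun_sum _ fun b _ ↦ ?_
    have hij := (Split.ofWord b).i_add_j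
    exact isMeasurableSection_mul hE _ (ha.measurable _ (by lia)) (hu.measurable _ (by lia)) φ hφ Y
      hY
  succ k hk := by
    have hH : (hom cov cov₁).IsHermitian := isHermitian_hom hE hE₁
    have hB : (ofBundle cov).IsHermitian := isHermitian_ofBundle hE
    have hB₁ : (ofBundle cov₁).IsHermitian := isHermitian_ofBundle hE₁
    rw [isWeakCovariantDerivative_iff hB₁]
    intro Y hY e he v
    have h (b : Fin k → Bool) := by
      have hij := (Split.ofWord b).i_add_j
      have hi : (Split.ofWord b).i < l := by lia
      have hj : (Split.ofWord b).j < l := by lia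
      have hYf : ∀ c, IsSmoothVectorField (Y ((Split.ofWord b).f c)) := fun c ↦ hY _
      have hYg : ∀ d, IsSmoothVectorField (Y ((Split.ofWord b).g d)) := fun d ↦ hY _
      exact HasWeakDerivAlong.apply hE hcov hcov₁ (p := p) (q := q) hr he
        ((isWeakCovariantDerivative_iff hH).1 (ha.succ _ hi) _ hYf e he v)
        ((isWeakCovariantDerivative_iff hB).1 (hu.succ _ hj) _ hYg e he v)
        (memLpLocAlong_apply hH (ha.measurable _ hi.le) (hap _ hi.le) hYf he)
        (memLpLocAlong_derivAlong hH (ha.measurable _ hi.le) (hap _ hi.le) (ha.measurable _ hi)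
          (hap _ hi) hYf he v)
        (memLpLocAlong_apply hB (hu.measurable _ hj.le) (huq _ hj.le) hYg he)
        (memLpLocAlong_derivAlong hB (hu.measurable _ hj.le) (huq _ hj.le) (hu.measurable _ hj)
          (huq _ hj) hYg he v)
    have h2 := HasWeakDerivAlong.sum hB₁ Finset.univ fun b _ ↦ h b
    have h3 : derivAlong (productTower a u k) (productTower a u (k + 1)) Y e v = _ :=
      funext fun y ↦ derivAlong_productTower a u k Y e v y
    rw [h3]
    have h4 : (fun x ↦ productTower a u k x fun i ↦ Y i x) = fun x ↦ ∑ b : Fin k → Bool,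
        a (Split.ofWord b).i x (fun c ↦ Y ((Split.ofWord b).f c) x)
          (u (Split.ofWord b).j x fun d ↦ Y ((Split.ofWord b).g d) x) := by
      ext x
      rw [productTower, sum_apply]
      rfl
    rw [h4]
    exact h2

end ProductTower

/-! ### Sobolev norms of sums and products -/

section LittleLp

variable {ι : Type*} [Fintype ι] {p : ℝ≥0∞} {c : ι → ℝ≥0∞}

theorem le_littleLpNorm (hp : 1 ≤ p) (i : ι) : c i ≤ littleLpNorm p c := by
  unfold littleLpNorm
  split_ifs with h
  · exact le_iSup c i
  · have hp0 : 0 < p.toReal := ENNReal.toReal_pos (zero_lt_one.trans_le hp).ne' h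
    calc c i = (c i ^ p.toReal) ^ (1 / p.toReal) := by
          rw [← ENNReal.rpow_mul, mul_one_div_cancel hp0.ne', ENNReal.rpow_one]
      _ ≤ _ := ENNReal.rpow_le_rpow (Finset.single_le_sum_of_canonicallyOrdered
          (f := fun i ↦ c i ^ p.toReal) (Finset.mem_univ i)) (by positivity)

theorem littleLpNorm_le [Nonempty ι] (hp : 1 ≤ p) {K : ℝ≥0∞} (h : ∀ i, c i ≤ K) :
    littleLpNorm p c ≤ Fintype.card ι * K := by
  have hcard : (1 : ℝ≥0∞) ≤ Fintype.card ι := by exact_mod_cast Fintype.card_pos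
  unfold littleLpNorm
  split_ifs with hp'
  · exact iSup_le fun i ↦ (h i).trans (le_mul_of_one_le_left' hcard)
  · have hp1 : 1 ≤ p.toReal := by
      rw [← ENNReal.toReal_one]
      exact ENNReal.toReal_mono hp' hp
    have hp0 : 0 < p.toReal := zero_lt_one.trans_le hp1
    calc (∑ i, c i ^ p.toReal) ^ (1 / p.toReal)
        ≤ (∑ _i : ι, K ^ p.toReal) ^ (1 / p.toReal) := by
          gcongr with i
          exact h i
      _ = (Fintype.card ι : ℝ≥0∞) ^ (1 / p.toReal) * K := by
          rw [Finset.sum_const, Finset.card_univ, nsmul_eq_mul,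
            ENNReal.mul_rpow_of_nonneg _ _ (by positivity), ← ENNReal.rpow_mul,
            mul_one_div_cancel hp0.ne', ENNReal.rpow_one]
      _ ≤ (Fintype.card ι : ℝ≥0∞) * K := by
          gcongr
          conv_rhs => rw [← ENNReal.rpow_one (Fintype.card ι : ℝ≥0∞)]
          exact ENNReal.rpow_le_rpow_of_exponent_le hcard ((div_le_one hp0).2 hp1)

end LittleLp

section SobolevNorm

variable {n : ℕ} {M : Type*} [TopologicalSpace M] [T2Space M] [SecondCountableTopology M]
  [MeasurableSpace M] [BorelSpace M]
  [ChartedSpace (EuclideanSpace ℝ (Fin n)) M] [IsManifold (𝓡 n) ∞ M]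
  [RiemannianBundle (fun x : M ↦ TangentSpace (𝓡 n) x)]
  [IsContMDiffRiemannianBundle (𝓡 n) ∞ (EuclideanSpace ℝ (Fin n))
    (fun x : M ↦ TangentSpace (𝓡 n) x)]

section Linear

variable {V : M → Type*} [∀ x, AddCommGroup (V x)] [∀ x, Module ℂ (V x)] {B : BundleData n V}
  {s : ℕ} {p : ℝ≥0∞} {u u' : ∀ x, V x} {w w' : ∀ (j : ℕ) (x : M), Tensor n V j x}

theorem IsDerivativeTower.add (hB : B.IsHermitian) (hw : IsDerivativeTower B s u w)
    (hw' : IsDerivativeTower B s u' w') :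
    IsDerivativeTower B s (fun x ↦ u x + u' x) (fun j x ↦ w j x + w' j x) where
  zero x := by
    rw [hw.zero, hw'.zero]
    rfl
  measurable j hj φ hφ Y hY := by
    simp only [add_apply, hB.inner_add_right]
    exact (hw.measurable j hj φ hφ Y hY).add (hw'.measurable j hj φ hφ Y hY)
  succ j hj := by
    rw [isWeakCovariantDerivative_iff hB]
    intro Y hY e he v φ hφ
    refine (((isWeakCovariantDerivative_iff hB).1 (hw.succ j hj) Y hY e he v φ hφ).add
      ((isWeakCovariantDerivative_iff hB).1 (hw'.succ j hj) Y hY e he v φ hφ)).congr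
      e.open_target ?_ ?_
    · intro y _
      simp only [add_apply, hB.inner_add_right]
    · intro y _
      simp only [derivAlong, MultilinearMap.curryLeft_apply, add_apply,
        hB.inner_add_right, Finset.sum_add_distrib]
      ring

theorem IsDerivativeTower.neg (hB : B.IsHermitian) (hw : IsDerivativeTower B s u w) :
    IsDerivativeTower B s (fun x ↦ - u x) (fun j x ↦ - w j x) where
  zero x := by
    rw [hw.zero]
    rfl
  measurable j hj φ hφ Y hY := by
    simp only [neg_apply, hB.inner_neg_right]
    exact (hw.measurable j hj φ hφ Y hY).neg
  succ j hj := by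
    rw [isWeakCovariantDerivative_iff hB]
    intro Y hY e he v φ hφ
    refine (((isWeakCovariantDerivative_iff hB).1 (hw.succ j hj) Y hY e he v φ hφ).const_mul
      (-1)).congr e.open_target ?_ ?_
    · intro y _
      simp [hB.inner_neg_right]
    · intro y _
      simp only [derivAlong, MultilinearMap.curryLeft_apply, neg_apply,
        hB.inner_add_right, hB.inner_neg_right, Finset.sum_neg_distrib]
      ring

theorem sectionLpNorm_add_le (hB : B.IsHermitian) (hp : 1 ≤ p) {j : ℕ}
    {w w' : ∀ x : M, Tensor n V j x} (hw : IsMeasurableSection B w)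
    (hw' : IsMeasurableSection B w') :
    sectionLpNorm B (fun x ↦ w x + w' x) p ≤ sectionLpNorm B w p + sectionLpNorm B w' p := by
  refine le_trans (eLpNorm_mono_real (g := fun x ↦ tensorNorm B (w x) + tensorNorm B (w' x))
    fun x ↦ ?_) (eLpNorm_add_le (hw.aestronglyMeasurable_tensorNorm hB)
      (hw'.aestronglyMeasurable_tensorNorm hB) hp)
  rw [Real.norm_of_nonneg (tensorNorm_nonneg _)]
  exact tensorNorm_add_le hB _ _

theorem MemSobolev.add (hB : B.IsHermitian) (hp : 1 ≤ p) (hu : MemSobolev B s p u)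
    (hu' : MemSobolev B s p u') : MemSobolev B s p (fun x ↦ u x + u' x) := by
  obtain ⟨w, hw, hwp⟩ := hu
  obtain ⟨w', hw', hwp'⟩ := hu'
  exact ⟨_, hw.add hB hw', fun j hj ↦ (sectionLpNorm_add_le hB hp (hw.measurable j hj)
    (hw'.measurable j hj)).trans_lt (ENNReal.add_lt_top.2 ⟨hwp j hj, hwp' j hj⟩)⟩

theorem MemSobolev.neg (hB : B.IsHermitian) (hu : MemSobolev B s p u) :
    MemSobolev B s p (fun x ↦ - u x) := by
  obtain ⟨w, hw, hwp⟩ := hu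
  refine ⟨_, hw.neg hB, fun j hj ↦ ?_⟩
  simpa only [sectionLpNorm, tensorNorm_neg hB] using hwp j hj

theorem MemSobolev.sub (hB : B.IsHermitian) (hp : 1 ≤ p) (hu : MemSobolev B s p u)
    (hu' : MemSobolev B s p u') : MemSobolev B s p (fun x ↦ u x - u' x) := by
  simpa only [sub_eq_add_neg] using hu.add hB hp (hu'.neg hB)

theorem IsDerivativeTower.sobolevNorm_le (hw : IsDerivativeTower B s u w) :
    sobolevNorm B s p u ≤ littleLpNorm p fun j : Fin (s + 1) ↦ sectionLpNorm B (w j) p :=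
  iInf₂_le w hw

theorem MemSobolev.sobolevNorm_lt_top (hp : 1 ≤ p) (hu : MemSobolev B s p u) :
    sobolevNorm B s p u < ⊤ := by
  obtain ⟨w, hw, hwp⟩ := hu
  refine hw.sobolevNorm_le.trans_lt ((littleLpNorm_le hp (K := ∑ j : Fin (s + 1),
    sectionLpNorm B (w j) p) fun j ↦ Finset.single_le_sum_of_canonicallyOrdered
      (f := fun j : Fin (s + 1) ↦ sectionLpNorm B (w j) p) (Finset.mem_univ j)).trans_lt ?_)
  exact ENNReal.mul_lt_top (ENNReal.natCast_lt_top _)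
    (ENNReal.sum_lt_top.2 fun j _ ↦ hwp j (Nat.lt_succ_iff.1 j.2))

theorem sobolevNorm_add_le (hB : B.IsHermitian) (hp : 1 ≤ p) :
    sobolevNorm B s p (fun x ↦ u x + u' x) ≤
      ((s + 1 : ℕ) : ℝ≥0∞) * (sobolevNorm B s p u + sobolevNorm B s p u') := by
  rw [← ENNReal.inv_mul_le_iff (by simp) (by simp), sobolevNorm.eq_def B s p u,
    sobolevNorm.eq_def B s p u']
  simp only [ENNReal.iInf_add, ENNReal.add_iInf]
  refine le_iInf fun w' ↦ le_iInf fun hw' ↦ le_iInf fun w ↦ le_iInf fun hw ↦ ?_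
  rw [ENNReal.inv_mul_le_iff (by simp) (by simp)]
  refine (hw.add hB hw').sobolevNorm_le.trans ?_
  refine (littleLpNorm_le hp fun j ↦ ?_).trans (by rw [Fintype.card_fin])
  have hj := Nat.lt_succ_iff.1 j.2
  exact (sectionLpNorm_add_le hB hp (hw.measurable j hj) (hw'.measurable j hj)).trans
    (add_le_add (le_littleLpNorm (c := fun j : Fin (s + 1) ↦ sectionLpNorm B (w j) p) hp j)
      (le_littleLpNorm (c := fun j : Fin (s + 1) ↦ sectionLpNorm B (w' j) p) hp j))

end Linear

variable {F : Type*} [NormedAddCommGroup F] [NormedSpace ℂ F] [FiniteDimensional ℂ F]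
  {E : M → Type*} [TopologicalSpace (TotalSpace F E)]
  [∀ x, NormedAddCommGroup (E x)] [∀ x, InnerProductSpace ℂ (E x)]
  [∀ x, FiniteDimensional ℂ (E x)]
  [FiberBundle F E] [VectorBundle ℂ F E] [VectorBundle ℝ F E]
  [ContMDiffVectorBundle ∞ F E (𝓡 n)]
  {F₁ : Type*} [NormedAddCommGroup F₁] [NormedSpace ℂ F₁] [FiniteDimensional ℂ F₁]
  {E₁ : M → Type*} [TopologicalSpace (TotalSpace F₁ E₁)]
  [∀ x, NormedAddCommGroup (E₁ x)] [∀ x, InnerProductSpace ℂ (E₁ x)]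
  [∀ x, FiniteDimensional ℂ (E₁ x)]
  [FiberBundle F₁ E₁] [VectorBundle ℂ F₁ E₁] [VectorBundle ℝ F₁ E₁]
  [ContMDiffVectorBundle ∞ F₁ E₁ (𝓡 n)]
  {cov : CovariantDerivative (𝓡 n) F E} {cov₁ : CovariantDerivative (𝓡 n) F₁ E₁}
  {l : ℕ} {p q r : ℝ≥0∞}

theorem eLpNorm_tensorNorm_mul_le [ENNReal.HolderTriple p q r] (hE : IsSmoothHermitian n F E)
    (hE₁ : IsSmoothHermitian n F₁ E₁) {i j : ℕ}
    {a : ∀ x : M, Tensor n (fun x ↦ E x →L[ℂ] E₁ x) i x} {u : ∀ x : M, Tensor n E j x}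
    (ha : IsMeasurableSection (hom cov cov₁) a) (hu : IsMeasurableSection (ofBundle cov) u) :
    eLpNorm (fun x ↦ tensorNorm (hom cov cov₁) (a x) * tensorNorm (ofBundle cov) (u x)) r
      (riemannianVolume n M) ≤
      sectionLpNorm (hom cov cov₁) a p * sectionLpNorm (ofBundle cov) u q := by
  have ha' := ha.aestronglyMeasurable_tensorNorm (isHermitian_hom hE hE₁)
  have hu' := hu.aestronglyMeasurable_tensorNorm (isHermitian_ofBundle hE)
  have h := eLpNorm_smul_le_mul_eLpNorm (p := p) (q := q) (r := r) hu' ha'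
  rw [sectionLpNorm, sectionLpNorm]
  exact h

/-- Hölder's inequality for the terms of the product tower. -/
theorem sectionLpNorm_productTower_le [ENNReal.HolderTriple p q r] (hr : 1 ≤ r)
    (hE : IsSmoothHermitian n F E) (hE₁ : IsSmoothHermitian n F₁ E₁)
    {a : ∀ (j : ℕ) (x : M), Tensor n (fun x ↦ E x →L[ℂ] E₁ x) j x}
    {u : ∀ (j : ℕ) (x : M), Tensor n E j x} {k : ℕ}
    (ha : ∀ j ≤ k, IsMeasurableSection (hom cov cov₁) (a j))
    (hu : ∀ j ≤ k, IsMeasurableSection (ofBundle cov) (u j)) {P Q : ℝ≥0∞}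
    (haP : ∀ j ≤ k, sectionLpNorm (hom cov cov₁) (a j) p ≤ P)
    (huQ : ∀ j ≤ k, sectionLpNorm (ofBundle cov) (u j) q ≤ Q) :
    sectionLpNorm (ofBundle cov₁) (productTower a u k) r ≤ 2 ^ k * (P * Q) := by
  have hij (b : Fin k → Bool) := (Split.ofWord b).i_add_j
  have hi (b : Fin k → Bool) : (Split.ofWord b).i ≤ k := by have := hij b; lia
  have hj (b : Fin k → Bool) : (Split.ofWord b).j ≤ k := by have := hij b; lia
  let G (b : Fin k → Bool) (x : M) : ℝ := tensorNorm (hom cov cov₁) (a (Split.ofWord b).i x) *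
    tensorNorm (ofBundle cov) (u (Split.ofWord b).j x)
  have h1 (x : M) : ‖tensorNorm (ofBundle cov₁) (productTower a u k x)‖ ≤ ∑ b, G b x := by
    rw [Real.norm_of_nonneg (tensorNorm_nonneg _), productTower]
    exact (tensorNorm_sum_le (isHermitian_ofBundle hE₁) _ _).trans
      (Finset.sum_le_sum fun b _ ↦ tensorNorm_mul_le _ _ _)
  have hm (b : Fin k → Bool) : AEStronglyMeasurable (G b) (riemannianVolume n M) :=
    ((ha _ (hi b)).aestronglyMeasurable_tensorNorm (isHermitian_hom hE hE₁)).mul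
      ((hu _ (hj b)).aestronglyMeasurable_tensorNorm (isHermitian_ofBundle hE))
  calc sectionLpNorm (ofBundle cov₁) (productTower a u k) r
      ≤ eLpNorm (fun x ↦ ∑ b, G b x) r (riemannianVolume n M) := eLpNorm_mono_real h1
    _ = eLpNorm (∑ b, G b) r (riemannianVolume n M) := by
        congr 1
        ext x
        rw [Finset.sum_apply]
    _ ≤ ∑ b, eLpNorm (G b) r (riemannianVolume n M) := eLpNorm_sum_le (fun b _ ↦ hm b) hr
    _ ≤ ∑ _b : Fin k → Bool, P * Q := Finset.sum_le_sum fun b _ ↦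
        (eLpNorm_tensorNorm_mul_le (p := p) (q := q) hE hE₁ (ha _ (hi b)) (hu _ (hj b))).trans
          (mul_le_mul' (haP _ (hi b)) (huQ _ (hj b)))
    _ = 2 ^ k * (P * Q) := by simp

theorem MemSobolev.apply [ENNReal.HolderTriple p q r] (hr : 1 ≤ r) (hE : IsSmoothHermitian n F E)
    (hE₁ : IsSmoothHermitian n F₁ E₁) (hcov : IsMetricConnection cov)
    (hcov₁ : IsMetricConnection cov₁) {a : ∀ x, E x →L[ℂ] E₁ x} {u : ∀ x, E x}
    (ha : MemSobolev (hom cov cov₁) l p a) (hu : MemSobolev (ofBundle cov) l q u) :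
    MemSobolev (ofBundle cov₁) l r (fun x ↦ a x (u x)) := by
  obtain ⟨w, hw, hwp⟩ := ha
  obtain ⟨w', hw', hwp'⟩ := hu
  refine ⟨_, isDerivativeTower_productTower hE hE₁ hcov hcov₁ hr hw hw' hwp hwp', fun k hk ↦ ?_⟩
  have hle {c : ℕ → ℝ≥0∞} {j : ℕ} (hj : j ≤ k) : c j ≤ ∑ j ∈ Finset.range (k + 1), c j :=
    Finset.single_le_sum_of_canonicallyOrdered (Finset.mem_range.2 (Nat.lt_succ_iff.2 hj))
  have hlt {c : ℕ → ℝ≥0∞} (hc : ∀ j ≤ l, c j < ⊤) : ∑ j ∈ Finset.range (k + 1), c j < ⊤ :=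
    ENNReal.sum_lt_top.2 fun j hj ↦ hc j ((Nat.lt_succ_iff.1 (Finset.mem_range.1 hj)).trans hk)
  refine (sectionLpNorm_productTower_le (p := p) (q := q) hr hE hE₁
    (fun j hj ↦ hw.measurable j (hj.trans hk)) (fun j hj ↦ hw'.measurable j (hj.trans hk))
    (fun j hj ↦ hle (c := fun j ↦ sectionLpNorm (hom cov cov₁) (w j) p) hj)
    (fun j hj ↦ hle (c := fun j ↦ sectionLpNorm (ofBundle cov) (w' j) q) hj)).trans_lt ?_
  exact ENNReal.mul_lt_top (ENNReal.pow_lt_top (by simp)) (ENNReal.mul_lt_top (hlt hwp) (hlt hwp'))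

/-- The Sobolev multiplication estimate, with the constant `(l + 1) 2^l`: each of the `l + 1`
derivatives of the product has at most `2^l` terms. -/
theorem sobolevNorm_apply_le [ENNReal.HolderTriple p q r] (hp : 1 ≤ p) (hq : 1 ≤ q) (hr : 1 ≤ r)
    (hE : IsSmoothHermitian n F E)
    (hE₁ : IsSmoothHermitian n F₁ E₁) (hcov : IsMetricConnection cov)
    (hcov₁ : IsMetricConnection cov₁) {a : ∀ x, E x →L[ℂ] E₁ x} {u : ∀ x, E x}
    (ha : MemSobolev (hom cov cov₁) l p a) (hu : MemSobolev (ofBundle cov) l q u) :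
    sobolevNorm (ofBundle cov₁) l r (fun x ↦ a x (u x)) ≤
      (((l + 1) * 2 ^ l : ℕ) : ℝ≥0∞) * (sobolevNorm (hom cov cov₁) l p a *
        sobolevNorm (ofBundle cov) l q u) := by
  have hC : (((l + 1) * 2 ^ l : ℕ) : ℝ≥0∞) ≠ 0 := by simp
  rw [← ENNReal.inv_mul_le_iff hC (ENNReal.natCast_ne_top _)]
  -- the infimum over the representatives is only approached by representatives of finite norm
  refine ENNReal.le_mul_of_forall_lt (.inr (hu.sobolevNorm_lt_top hq).ne)
    (.inl (ha.sobolevNorm_lt_top hp).ne) fun P hP Q hQ ↦ ?_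
  rw [ENNReal.inv_mul_le_iff hC (ENNReal.natCast_ne_top _)]
  simp only [gt_iff_lt, sobolevNorm, iInf_lt_iff] at hP hQ
  obtain ⟨w, hw, hwP⟩ := hP
  obtain ⟨w', hw', hwQ⟩ := hQ
  have h1 (j : ℕ) (hj : j ≤ l) : sectionLpNorm (hom cov cov₁) (w j) p < P :=
    (le_littleLpNorm (c := fun j : Fin (l + 1) ↦ sectionLpNorm (hom cov cov₁) (w j) p) hp
      ⟨j, Nat.lt_succ_iff.2 hj⟩).trans_lt hwP
  have h2 (j : ℕ) (hj : j ≤ l) : sectionLpNorm (ofBundle cov) (w' j) q < Q :=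
    (le_littleLpNorm (c := fun j : Fin (l + 1) ↦ sectionLpNorm (ofBundle cov) (w' j) q) hq
      ⟨j, Nat.lt_succ_iff.2 hj⟩).trans_lt hwQ
  refine (isDerivativeTower_productTower hE hE₁ hcov hcov₁ hr hw hw'
    (fun j hj ↦ (h1 j hj).trans_le le_top)
    (fun j hj ↦ (h2 j hj).trans_le le_top)).sobolevNorm_le.trans ?_
  refine (littleLpNorm_le hr (K := 2 ^ l * (P * Q)) fun k ↦ ?_).trans (le_of_eq ?_)
  · have hk := Nat.lt_succ_iff.1 k.2
    refine (sectionLpNorm_productTower_le (p := p) (q := q) hr hE hE₁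
      (fun j hj ↦ hw.measurable j (hj.trans hk)) (fun j hj ↦ hw'.measurable j (hj.trans hk))
      (fun j hj ↦ (h1 j (hj.trans hk)).le) (fun j hj ↦ (h2 j (hj.trans hk)).le)).trans ?_
    gcongr
    · exact one_le_two
  · rw [Fintype.card_fin]
    push_cast
    ring

/-- Continuity of the product follows from the estimate, by expanding
`a' u' - a u = (a' - a) (u' - u) + (a (u' - u) + (a' - a) u)`. -/
theorem exists_sobolevNorm_apply_sub_lt [ENNReal.HolderTriple p q r] (hp : 1 ≤ p) (hq : 1 ≤ q)
    (hr : 1 ≤ r) (hE : IsSmoothHermitian n F E)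
    (hE₁ : IsSmoothHermitian n F₁ E₁) (hcov : IsMetricConnection cov)
    (hcov₁ : IsMetricConnection cov₁) {a : ∀ x, E x →L[ℂ] E₁ x} {u : ∀ x, E x}
    (ha : MemSobolev (hom cov cov₁) l p a) (hu : MemSobolev (ofBundle cov) l q u)
    {ε : ℝ≥0∞} (hε : 0 < ε) : ∃ δ : ℝ≥0∞, 0 < δ ∧
      ∀ (a' : ∀ x, E x →L[ℂ] E₁ x) (u' : ∀ x, E x),
        MemSobolev (hom cov cov₁) l p a' → MemSobolev (ofBundle cov) l q u' →
        sobolevNorm (hom cov cov₁) l p (fun x ↦ a' x - a x) < δ →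
        sobolevNorm (ofBundle cov) l q (fun x ↦ u' x - u x) < δ →
        sobolevNorm (ofBundle cov₁) l r (fun x ↦ a' x (u' x) - a x (u x)) < ε := by
  have hH : (hom cov cov₁).IsHermitian := isHermitian_hom hE hE₁
  have hB : (ofBundle cov).IsHermitian := isHermitian_ofBundle hE
  have hB₁ : (ofBundle cov₁).IsHermitian := isHermitian_ofBundle hE₁
  set C : ℝ≥0∞ := (((l + 1) * 2 ^ l : ℕ) : ℝ≥0∞)
  set L : ℝ≥0∞ := ((l + 1 : ℕ) : ℝ≥0∞)
  set P := sobolevNorm (hom cov cov₁) l p a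
  set Q := sobolevNorm (ofBundle cov) l q u
  have hC : C ≠ ⊤ := ENNReal.natCast_ne_top _
  have hL : L ≠ ⊤ := ENNReal.natCast_ne_top _
  have hP : P ≠ ⊤ := (ha.sobolevNorm_lt_top hp).ne
  have hQ : Q ≠ ⊤ := (hu.sobolevNorm_lt_top hq).ne
  obtain ⟨δ, hδ, hδε⟩ := ENNReal.exists_nnreal_pos_mul_lt
    (a := L * (C + L * (C * P + C * Q))) (by finiteness) hε.ne'
  refine ⟨min δ 1, by simpa using hδ, fun a' u' ha' hu' hda hdu ↦ lt_of_le_of_lt ?_ hδε⟩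
  have hma := ha'.sub hH hp ha
  have hmu := hu'.sub hB hq hu
  have hexp : (fun x ↦ a' x (u' x) - a x (u x)) = fun x ↦ (a' x - a x) (u' x - u x) +
      (a x (u' x - u x) + (a' x - a x) (u x)) := by
    ext x
    simp only [map_sub, sub_apply]
    abel
  rw [hexp]
  refine (sobolevNorm_add_le hB₁ hr (u := fun x ↦ (a' x - a x) (u' x - u x))
    (u' := fun x ↦ a x (u' x - u x) + (a' x - a x) (u x))).trans ?_
  have h1 := sobolevNorm_apply_le (p := p) (q := q) hp hq hr hE hE₁ hcov hcov₁ hma hmu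
  have h2 := sobolevNorm_apply_le (p := p) (q := q) hp hq hr hE hE₁ hcov hcov₁ ha hmu
  have h3 := sobolevNorm_apply_le (p := p) (q := q) hp hq hr hE hE₁ hcov hcov₁ hma hu
  have h4 := sobolevNorm_add_le (s := l) hB₁ hr (u := fun x ↦ a x (u' x - u x))
    (u' := fun x ↦ (a' x - a x) (u x))
  have hda1 : sobolevNorm (hom cov cov₁) l p (fun x ↦ a' x - a x) ≤ δ :=
    hda.le.trans (min_le_left _ _)
  have hda2 : sobolevNorm (hom cov cov₁) l p (fun x ↦ a' x - a x) ≤ 1 :=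
    hda.le.trans (min_le_right _ _)
  have hdu1 : sobolevNorm (ofBundle cov) l q (fun x ↦ u' x - u x) ≤ δ :=
    hdu.le.trans (min_le_left _ _)
  calc L * (_ + _) ≤ L * (C * (1 * δ) + L * (C * (P * δ) + C * (δ * Q))) :=
        mul_le_mul_right (add_le_add (h1.trans (by gcongr))
          (h4.trans (mul_le_mul_right (add_le_add (h2.trans (by gcongr))
            (h3.trans (by gcongr))) _))) _
    _ = δ * (L * (C + L * (C * P + C * Q))) := by ring

end SobolevNorm

end NablaSobolev

theorem mainTheorem1 (l : ℕ) (p q r : ℝ≥0∞) (hp : 1 ≤ p) (hq : 1 ≤ q) (hr : 1 ≤ r)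
    (hpqr : p⁻¹ + q⁻¹ = r⁻¹) :
    ∃ C : ℝ≥0, 0 < C ∧
      ∀ (n : ℕ) (M : Type*) [TopologicalSpace M] [T2Space M] [SecondCountableTopology M]
        [MeasurableSpace M] [BorelSpace M]
        [ChartedSpace (EuclideanSpace ℝ (Fin n)) M] [IsManifold (𝓡 n) ∞ M]
        [RiemannianBundle (fun x : M ↦ TangentSpace (𝓡 n) x)]
        [IsContMDiffRiemannianBundle (𝓡 n) ∞ (EuclideanSpace ℝ (Fin n))
          (fun x : M ↦ TangentSpace (𝓡 n) x)]
        (F : Type*) [NormedAddCommGroup F] [NormedSpace ℂ F] [FiniteDimensional ℂ F]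
        (E : M → Type*) [TopologicalSpace (TotalSpace F E)]
        [∀ x, NormedAddCommGroup (E x)] [∀ x, InnerProductSpace ℂ (E x)]
        [∀ x, FiniteDimensional ℂ (E x)]
        [FiberBundle F E] [VectorBundle ℂ F E] [VectorBundle ℝ F E]
        [ContMDiffVectorBundle ∞ F E (𝓡 n)]
        (F₁ : Type*) [NormedAddCommGroup F₁] [NormedSpace ℂ F₁] [FiniteDimensional ℂ F₁]
        (E₁ : M → Type*) [TopologicalSpace (TotalSpace F₁ E₁)]
        [∀ x, NormedAddCommGroup (E₁ x)] [∀ x, InnerProductSpace ℂ (E₁ x)]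
        [∀ x, FiniteDimensional ℂ (E₁ x)]
        [FiberBundle F₁ E₁] [VectorBundle ℂ F₁ E₁] [VectorBundle ℝ F₁ E₁]
        [ContMDiffVectorBundle ∞ F₁ E₁ (𝓡 n)]
        (cov : CovariantDerivative (𝓡 n) F E) (cov₁ : CovariantDerivative (𝓡 n) F₁ E₁),
        NablaSobolev.IsSmoothHermitian n F E → NablaSobolev.IsSmoothHermitian n F₁ E₁ →
        NablaSobolev.IsMetricConnection cov → NablaSobolev.IsMetricConnection cov₁ →
        -- the estimate
        (∀ (a : ∀ x, E x →L[ℂ] E₁ x) (u : ∀ x, E x),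
          NablaSobolev.MemSobolev (NablaSobolev.hom cov cov₁) l p a →
          NablaSobolev.MemSobolev (NablaSobolev.ofBundle cov) l q u →
          NablaSobolev.MemSobolev (NablaSobolev.ofBundle cov₁) l r (fun x ↦ a x (u x)) ∧
          NablaSobolev.sobolevNorm (NablaSobolev.ofBundle cov₁) l r (fun x ↦ a x (u x)) ≤
            C * NablaSobolev.sobolevNorm (NablaSobolev.hom cov cov₁) l p a *
              NablaSobolev.sobolevNorm (NablaSobolev.ofBundle cov) l q u) ∧
        -- continuity of the bilinear map `(a, u) ↦ a u`
        (∀ (a : ∀ x, E x →L[ℂ] E₁ x) (u : ∀ x, E x),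
          NablaSobolev.MemSobolev (NablaSobolev.hom cov cov₁) l p a →
          NablaSobolev.MemSobolev (NablaSobolev.ofBundle cov) l q u →
          ∀ ε : ℝ≥0∞, 0 < ε → ∃ δ : ℝ≥0∞, 0 < δ ∧
            ∀ (a' : ∀ x, E x →L[ℂ] E₁ x) (u' : ∀ x, E x),
              NablaSobolev.MemSobolev (NablaSobolev.hom cov cov₁) l p a' →
              NablaSobolev.MemSobolev (NablaSobolev.ofBundle cov) l q u' →
              NablaSobolev.sobolevNorm (NablaSobolev.hom cov cov₁) l p
                (fun x ↦ a' x - a x) < δ →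
              NablaSobolev.sobolevNorm (NablaSobolev.ofBundle cov) l q
                (fun x ↦ u' x - u x) < δ →
              NablaSobolev.sobolevNorm (NablaSobolev.ofBundle cov₁) l r
                (fun x ↦ a' x (u' x) - a x (u x)) < ε) := by
  have : ENNReal.HolderTriple p q r := ⟨hpqr⟩
  refine ⟨((l + 1) * 2 ^ l : ℕ), by positivity, ?_⟩
  intro n M _ _ _ _ _ _ _ _ _ F _ _ _ E _ _ _ _ _ _ _ _ F₁ _ _ _ E₁ _ _ _ _ _ _ _ _ cov cov₁
    hE hE₁ hcov hcov₁
  refine ⟨fun a u ha hu ↦ ⟨ha.apply hr hE hE₁ hcov hcov₁ hu, ?_⟩, fun a u ha hu ε hε ↦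
    NablaSobolev.exists_sobolevNorm_apply_sub_lt hp hq hr hE hE₁ hcov hcov₁ ha hu hε⟩
  rw [mul_assoc]
  exact NablaSobolev.sobolevNorm_apply_le hp hq hr hE hE₁ hcov hcov₁ ha hu
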